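/- **Setting.** Let $c>0$ and $h_1\in\mathbb R\setminus\{0\}$. Let $a(k)$ (the reciprocal of a transmission coefficient) be a function that is analytic in the cut half-plane $\Omega=\mathbb C_+\setminus(0,ic]$, has non-zero boundary values $a_+(k)$ and $a_-(k)$ on the right and left sides of the cut for $k\in(0,ic)$, satisfies $\overline{a(-\overline k)}=a(k)$ for $k\in\Omega$, and has the singularity $$a(k)=\frac{h_1}{2}\sqrt[4]{\frac{k+ic}{k-ic}}\left(1+O\left(\sqrt{\frac{k-ic}{k+ic}}\right)\right),\qquad k\to ic,\ k\in\Omega,$$ with principal roots. Put $\Theta(z|\tau)=\sum_{m\in\mathbb Z}\exp\left(\frac12\tau m^2+zm\right)$ for $\tau<0$. For $\xi\in[-\frac{c^2}{2},\frac{c^2}{3}]$ let $d=f(\xi)\in[0,c]$ and $\mu=\mu(d)\ge 0$ be the solution of $$\int_0^1(\mu^2-\lambda^2d^2)\sqrt{\frac{1-\lambda^2}{c^2-\lambda^2d^2}}\,d\lambda=0,\qquad \frac{c^2}{2}+\xi=\mu^2+\frac{d^2}{2}.$$ For $d\in(0,c)$ let $w(k,d)=\sqrt{(k^2+c^2)(k^2+d^2)}$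 be analytic off $[ic,id]\cup[-ic,-id]$ with $w(0,d)=cd$, let $w_+$ be its boundary value on $(id,ic)$ from the right, and put $$B_g(d)=24\int_{id}^{ic}\frac{(k^2+\mu^2(d))(k^2+d^2)\,dk}{w_+(k,d)},\qquad \tau(d)=-\pi i\int_{id}^{ic}\frac{dk}{w_+(k,d)}\left(\int_0^{id}\frac{dk}{w(k,d)}\right)^{-1},$$ $$\Delta(d)=\int_{id}^{ic}\frac{\log(a_+(k)a_-(k))\,dk}{w_+(k,d)}\left(i\int_0^{id}\frac{dk}{w(k,d)}\right)^{-1}.$$ For $t>0$ and $-6c^2t<x<4c^2t$ let $\xi=\frac{x}{12t}$, $v=1-\frac{x}{4c^2t}$, $$q_{el}(x,t)=\sqrt{c^2-f^2(\xi)}\;\frac{\Theta\left(\pi i+itB_g(f(\xi))+i\Delta(f(\xi))\,|\,\tau(f(\xi))\right)}{\Theta\left(itB_g(f(\xi))+i\Delta(f(\xi))\,|\,\tau(f(\xi))\right)},$$ $\tau^*=\frac{4\pi^2}{\tau(f(\xi))}$ and $z=\frac1\pi\left(tB_g(f(\xi))+\Delta(f(\xi))\right)$. **Theorem.** There are real-valued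 functions $\alpha_n(x,t)$, $n\ge1$, with $$\frac{\tau^*(z-2n+1)}{4}=2c(x-4c^2t)+\left(2n-\tfrac12\right)\log t-\alpha_n(x,t)\qquad(t>0,\ -6c^2t<x<4c^2t),$$ such that the following is true as $t\to\infty$. **A.** For all integers $N\ge1$ and all $\varepsilon>0$, uniformly for $4c^2t-\frac{2N+\frac12-\varepsilon}{2c}\log t\le x\le4c^2t-\frac{\frac12+\varepsilon}{2c}\log t$, $$q_{el}(x,t)=\sum_{n=1}^N\frac{2c}{\cosh\left(2c(x-4c^2t)+(2n-\frac12)\log t-\alpha_n(x,t)\right)}+O\left(\frac1t\right).$$ **B.** For all $\varepsilon>0$, uniformly for $4c^2t-\frac{1-\varepsilon}{2c}\log t\le x<4c^2t$, $\;q_{el}(x,t)=O\left(t^{-1/2}\right)$. **The phases.** For all $n\ge1$ and all $\gamma>0$, uniformly for $4c^2t-\gamma\log t<x<4c^2t$, $$\alpha_n(x,t)=-\left(2n-\tfrac12\right)\log\frac{\log\frac1v}{vt}-\frac{8c^3tv}{\log\frac1v}-\left(6n-\tfrac72\right)\log2-\log h_1^2+O\left(\frac{\log^2\log\frac1v}{\log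 v}\right).$$ For all $n\ge1$ and all $0<\delta<\gamma$, the function $\alpha_n(x,t)$ is bounded for all sufficiently large $t$ and $4c^2t-\gamma\log t<x<4c^2t-\delta\log t$. -/

import Mathlib

open Filter Topology Asymptotics

noncomputable section

namespace ModulatedWave

/-- The theta function `Θ(z|τ) = ∑_{m ∈ ℤ} exp (τ m² / 2 + z m)` (used for `Re τ < 0`). -/
def Theta (z τ : ℂ) : ℂ :=
  ∑' m : ℤ, Complex.exp (1 / 2 * τ * (m : ℂ) ^ 2 + z * (m : ℂ))

/-- Boundary value of `F` at a point `k` of the imaginary axis, from the side `Re > 0`. This is the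
`+` side of the cuts in the upper half-plane, which are directed downwards. -/
def bdryPlus (F : ℂ → ℂ) (k : ℂ) : ℂ := limUnder (𝓝[{w : ℂ | 0 < w.re}] k) F

/-- Boundary value of `F` at a point `k` of the imaginary axis, from the side `Re < 0`. -/
def bdryMinus (F : ℂ → ℂ) (k : ℂ) : ℂ := limUnder (𝓝[{w : ℂ | w.re < 0}] k) F

/-- The integral `∫ F(k) dk` along the segment of the imaginary axis from `i p` to `i q`. -/
def segInt (F : ℂ → ℂ) (p q : ℝ) : ℂ :=
  ∫ y in p..q, F (Complex.I * (y : ℂ)) * Complex.I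

/-- `w(k,d) = √((k² + c²)(k² + d²))`, analytic off `[ic, id] ∪ [-ic, -id]`, with `w(0,d) = c d`:
the quotient under the principal root is a non-positive real number only on these two cuts. -/
def w (c d : ℝ) (k : ℂ) : ℂ :=
  (k ^ 2 + (c : ℂ) ^ 2) * ((k ^ 2 + (d : ℂ) ^ 2) / (k ^ 2 + (c : ℂ) ^ 2)) ^ (1 / 2 : ℂ)

/-- The first equation of the system for `(d, μ)`. -/
def FirstEq (c d μ : ℝ) : Prop :=
  ∫ l in (0 : ℝ)..1,
    (μ ^ 2 - l ^ 2 * d ^ 2) * Real.sqrt ((1 - l ^ 2) / (c ^ 2 - l ^ 2 * d ^ 2)) = 0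

/-- The second equation of the system for `(d, μ)`. -/
def SecondEq (c ξ d μ : ℝ) : Prop := c ^ 2 / 2 + ξ = μ ^ 2 + d ^ 2 / 2

/-- The function `μ(d)`, `d ∈ [0, c]`: the non-negative solution `μ` of the first equation. -/
def muFun (c d : ℝ) : ℝ := Classical.epsilon fun μ : ℝ => 0 ≤ μ ∧ FirstEq c d μ

/-- The function `d = f(ξ)`, `ξ ∈ [-c²/2, c²/3]`: the component `d ∈ [0, c]` of the solution of the
system of the two equations. -/
def fFun (c ξ : ℝ) : ℝ :=
  Classical.epsilon fun d : ℝ =>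
    (0 ≤ d ∧ d ≤ c) ∧ ∃ μ : ℝ, 0 ≤ μ ∧ FirstEq c d μ ∧ SecondEq c ξ d μ

/-- `B_g(d)`. -/
def Bg (c d : ℝ) : ℂ :=
  24 * segInt
    (fun k => (k ^ 2 + (muFun c d : ℂ) ^ 2) * (k ^ 2 + (d : ℂ) ^ 2) / bdryPlus (w c d) k) d c

/-- `τ(d)`. -/
def tau (c d : ℝ) : ℂ :=
  -(Real.pi : ℂ) * Complex.I * segInt (fun k => 1 / bdryPlus (w c d) k) d c
    * (segInt (fun k => 1 / w c d k) 0 d)⁻¹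

/-- `Δ(d)`, for the spectral function `a(k)`. -/
def Delta (c : ℝ) (a : ℂ → ℂ) (d : ℝ) : ℂ :=
  segInt (fun k => Complex.log (bdryPlus a k * bdryMinus a k) / bdryPlus (w c d) k) d c
    * (Complex.I * segInt (fun k => 1 / w c d k) 0 d)⁻¹

/-- `τ*(d) = 4π² / τ(d)`. -/
def tauStar (c d : ℝ) : ℂ := 4 * (Real.pi : ℂ) ^ 2 / tau c d

/-- The modulated elliptic wave `q_el(x,t)`. -/
def qEl (c : ℝ) (a : ℂ → ℂ) (x t : ℝ) : ℂ :=
  let d := fFun c (x / (12 * t))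
  (Real.sqrt (c ^ 2 - d ^ 2) : ℂ)
    * (Theta ((Real.pi : ℂ) * Complex.I + Complex.I * (t : ℂ) * Bg c d
          + Complex.I * Delta c a d) (tau c d)
        / Theta (Complex.I * (t : ℂ) * Bg c d + Complex.I * Delta c a d) (tau c d))

/-- `z = (t B_g(f(ξ)) + Δ(f(ξ))) / π`, `ξ = x / (12 t)`. -/
def zFun (c : ℝ) (a : ℂ → ℂ) (x t : ℝ) : ℂ :=
  ((t : ℂ) * Bg c (fFun c (x / (12 * t))) + Delta c a (fFun c (x / (12 * t)))) / (Real.pi : ℂ)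

/-- The small parameter `v = 1 - x / (4 c² t)`. -/
def vFun (c x t : ℝ) : ℝ := 1 - x / (4 * c ^ 2 * t)

/-- The open upper half-plane with the cut `[0, ic]`. -/
def slitUpper (c : ℝ) : Set ℂ := {k | 0 < k.im ∧ ¬ (k.re = 0 ∧ k.im ≤ c)}

/-- The functions `a(k)` considered (`1/a` being a transmission coefficient): `a` is analytic in the
cut upper half-plane, has non-zero boundary values on both sides of the open cut, satisfies the
symmetry condition, and at `ic` has a singularity of order exactly `(k - ic)^{-1/4}` with
coefficient determined by `h₁`. -/
structure IsSpectralFunction (c h₁ : ℝ) (a : ℂ → ℂ) : Prop where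
  analytic : DifferentiableOn ℂ a (slitUpper c)
  right : ∀ y : ℝ, 0 < y → y < c → ∃ l : ℂ, l ≠ 0 ∧
    Tendsto a (𝓝[{k : ℂ | 0 < k.re}] (Complex.I * (y : ℂ))) (𝓝 l)
  left : ∀ y : ℝ, 0 < y → y < c → ∃ l : ℂ, l ≠ 0 ∧
    Tendsto a (𝓝[{k : ℂ | k.re < 0}] (Complex.I * (y : ℂ))) (𝓝 l)
  symmetric : ∀ k ∈ slitUpper c,
    (starRingEnd ℂ) (a (-(starRingEnd ℂ) k)) = a k
  ne_zero : h₁ ≠ 0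
  singularity : ∃ r : ℂ → ℂ,
    (∀ k ∈ slitUpper c, a k = (h₁ : ℂ) / 2
      * ((k + Complex.I * (c : ℂ)) / (k - Complex.I * (c : ℂ))) ^ (1 / 4 : ℂ) * (1 + r k)) ∧
    r =O[𝓝[slitUpper c] (Complex.I * (c : ℂ))]
      fun k => ((k - Complex.I * (c : ℂ)) / (k + Complex.I * (c : ℂ))) ^ (1 / 2 : ℂ)

end ModulatedWave

end

noncomputable section

namespace ModulatedWave

/-! Write `d = c√(1 - p)` and `L = log (16 / p)`; the leading edge `x = 4c²t` is the limit `p → 0`.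
Put `l = -τ*/4`, which is `ell`. Two mechanisms give the theorem.

The first is the modular transformation of the theta function. Poisson summation
(`Theta_eq_gaussSum`) turns the wave into `c√p · G(z + 1) / G(z)`, where `G` is a sum of Gaussians
centred at the even integers whose width shrinks as `l` grows (`qEl_eq`). If `z` is within distance
1 of `2m - 1`, one Gaussian dominates the numerator and two neighbouring ones, which add up to a
hyperbolic cosine, dominate the denominator. Hence the quotient is `exp (l/2) / (2 cosh (l (z - 2m +
1)))` up to `O(exp (-l/2))` (`gaussSum_ratio`). Since `l = L + O(p)` (`ratio_estimate`), `√p exp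
(l/2) = 4 + O(p)`, and the wave is `2c / cosh (l (z - 2m + 1)) + O(p)` (`NearEdge.qEl_estimate`).
Solitons with other indices are themselves `O(exp (-l)) = O(p)`, so the sum over `n` may be
completed at no cost. The `α_n` are defined so that the argument of the hyperbolic cosine has the
required form.

The second is the expansion of all quantities in `p`: `v = p(L + 1)/2 + O(p²L²)` (`v_estimate`), `l
B_g / π = 8c³v - 4c³p + O(p²L²)` (`ell_mul_bg_estimate`), and `l Δ / π` is minus the mean of `log
|a₊|²` over the gap, which is `log (h₁²/4) + L/2 + O(√p)` (`IsSpectralFunction.logMean_estimate`).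
Together they give `l z = 2c(4c²t - x) - 4c³tp - log (h₁²/4) - L/2` up to small terms. In a strip of
logarithmic width `tp` is bounded, so every `O(p)` is `O(1/t)` and `l z = 2c(4c²t - x) - l/2 +
O(1)`. Where the distance to the edge is comparable to `log t`, also `l = log t + O(1)`; the window
of part A then lies in `0 ≤ z ≤ 2N`. In part B, `z` is separated from the nearest odd integer by
about `1/2`, and the soliton is of size `exp (-l/2)`. Finally, inverting `v` as a function of `p`
(`parameter_inversion`) expresses `l z` and `l` through `v` and `t`, which gives the phases. -/

instance neBot_nhdsWithin_right (y : ℝ) :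
    (𝓝[{k : ℂ | 0 < k.re}] (Complex.I * (y : ℂ))).NeBot := by
  rw [← mem_closure_iff_nhdsWithin_neBot, Complex.closure_setOfPred_lt_re]
  simp

instance neBot_nhdsWithin_left (y : ℝ) :
    (𝓝[{k : ℂ | k.re < 0}] (Complex.I * (y : ℂ))).NeBot := by
  rw [← mem_closure_iff_nhdsWithin_neBot, Complex.closure_setOfPred_re_lt]
  simp

/-! ### The root `w` on the imaginary axis and its boundary values -/

lemma w_I_mul (c d y : ℝ) :
    w c d (Complex.I * y)
      = ((c ^ 2 - y ^ 2 : ℝ) : ℂ) * (((d ^ 2 - y ^ 2) / (c ^ 2 - y ^ 2) : ℝ) : ℂ) ^ (1 / 2 : ℂ) := by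
  have h (e : ℝ) : (Complex.I * (y : ℂ)) ^ 2 + (e : ℂ) ^ 2 = ((e ^ 2 - y ^ 2 : ℝ) : ℂ) := by
    push_cast
    rw [mul_pow, Complex.I_sq]
    ring
  rw [w, h, h, Complex.ofReal_div]

lemma cpow_half_of_nonneg {x : ℝ} (hx : 0 ≤ x) : (x : ℂ) ^ (1 / 2 : ℂ) = (Real.sqrt x : ℂ) := by
  have := Complex.ofReal_cpow hx (1 / 2)
  rw [Real.sqrt_eq_rpow, this]
  norm_num

lemma cpow_half_of_neg {x : ℝ} (hx : x < 0) :
    (x : ℂ) ^ (1 / 2 : ℂ) = Complex.I * (Real.sqrt (-x) : ℂ) := by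
  rw [Complex.ofReal_cpow_of_nonpos hx.le, ← Complex.ofReal_neg,
    cpow_half_of_nonneg (by linarith)]
  have : Complex.exp ((Real.pi : ℂ) * Complex.I * (1 / 2)) = Complex.I := by
    rw [show (Real.pi : ℂ) * Complex.I * (1 / 2) = (Real.pi : ℂ) / 2 * Complex.I by ring,
      Complex.exp_pi_div_two_mul_I]
  rw [this, mul_comm]

lemma mul_sqrt_div {x y : ℝ} (hx : 0 < x) : x * √(y / x) = √(x * y) := by
  rw [← Real.sqrt_sq hx.le, ← Real.sqrt_mul (by positivity), Real.sqrt_sq hx.le]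
  congr 1
  field_simp

lemma w_below {c d y : ℝ} (hd : y ^ 2 < d ^ 2) (hc : d ^ 2 ≤ c ^ 2) :
    w c d (Complex.I * y) = (√((c ^ 2 - y ^ 2) * (d ^ 2 - y ^ 2)) : ℂ) := by
  rw [w_I_mul, cpow_half_of_nonneg (div_nonneg (by linarith) (by linarith)),
    ← Complex.ofReal_mul, mul_sqrt_div (by linarith)]

lemma w_on_cut {c d y : ℝ} (hd : d ^ 2 < y ^ 2) (hc : y ^ 2 < c ^ 2) :
    w c d (Complex.I * y) = Complex.I * (√((c ^ 2 - y ^ 2) * (y ^ 2 - d ^ 2)) : ℂ) := by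
  rw [w_I_mul, cpow_half_of_neg (div_neg_of_neg_of_pos (by linarith) (by linarith)),
    mul_left_comm, ← Complex.ofReal_mul, ← neg_div, mul_sqrt_div (by linarith)]
  ring_nf

/-- To the right of the cut the quotient under the root has non-negative imaginary part, and the
principal logarithm is continuous on the closed upper half-plane at negative reals. So the limit
from the right is the value of `w` at the point itself. -/
lemma bdryPlus_w {c d y : ℝ} (h0 : 0 < y) (hd : d ^ 2 < y ^ 2) (hc : y ^ 2 < c ^ 2) :
    bdryPlus (w c d) (Complex.I * y) = Complex.I * (√((c ^ 2 - y ^ 2) * (y ^ 2 - d ^ 2)) : ℂ) := by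
  rw [← w_on_cut hd hc]
  refine Tendsto.limUnder_eq (f := 𝓝[{k : ℂ | 0 < k.re}] (Complex.I * (y : ℂ))) ?_
  have h (e : ℝ) : (Complex.I * (y : ℂ)) ^ 2 + (e : ℂ) ^ 2 = ((e ^ 2 - y ^ 2 : ℝ) : ℂ) := by
    push_cast
    rw [mul_pow, Complex.I_sq]
    ring
  have hne : (Complex.I * (y : ℂ)) ^ 2 + (c : ℂ) ^ 2 ≠ 0 := by
    rw [h]
    exact_mod_cast (by linarith : (0 : ℝ) < c ^ 2 - y ^ 2).ne'
  set R : ℂ → ℂ := fun k => (k ^ 2 + (d : ℂ) ^ 2) / (k ^ 2 + (c : ℂ) ^ 2) with hR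
  have hRc : ContinuousAt R (Complex.I * (y : ℂ)) := by
    refine ContinuousAt.div ?_ ?_ hne <;> fun_prop
  have hR0 : R (Complex.I * (y : ℂ)) = (((d ^ 2 - y ^ 2) / (c ^ 2 - y ^ 2) : ℝ) : ℂ) := by
    rw [hR]
    simp only [h, Complex.ofReal_div]
  have hneg : (d ^ 2 - y ^ 2) / (c ^ 2 - y ^ 2) < 0 :=
    div_neg_of_neg_of_pos (by linarith) (by linarith)
  have him : ∀ᶠ k in 𝓝[{k : ℂ | 0 < k.re}] (Complex.I * (y : ℂ)), R k ∈ {z : ℂ | 0 ≤ z.im} := by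
    have h1 : ∀ᶠ k in 𝓝[{k : ℂ | 0 < k.re}] (Complex.I * (y : ℂ)), 0 < k.im :=
      nhdsWithin_le_nhds (Complex.continuous_im.continuousAt.eventually
        (lt_mem_nhds (by simpa using h0)))
    filter_upwards [h1, self_mem_nhdsWithin] with k hk1 hk2
    have hk2 : 0 < k.re := hk2
    change 0 ≤ (R k).im
    rw [hR]
    simp only [Complex.div_im]
    rw [← sub_div]
    refine div_nonneg ?_ (Complex.normSq_nonneg _)
    have e1 (e : ℝ) : (k ^ 2 + (e : ℂ) ^ 2).im = 2 * k.re * k.im := by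
      simp [sq]; ring
    have e2 (e : ℝ) : (k ^ 2 + (e : ℂ) ^ 2).re = k.re ^ 2 - k.im ^ 2 + e ^ 2 := by
      simp [sq]
    simp only [e1, e2]
    have : 0 ≤ 2 * k.re * k.im * (c ^ 2 - d ^ 2) := by
      have : 0 < c ^ 2 - d ^ 2 := by linarith
      positivity
    nlinarith
  have hlog : Tendsto (fun k => Complex.log (R k)) (𝓝[{k : ℂ | 0 < k.re}] (Complex.I * (y : ℂ)))
      (𝓝 (Complex.log (R (Complex.I * (y : ℂ))))) := by
    have hc := Complex.continuousWithinAt_log_of_re_neg_of_im_zero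
      (z := R (Complex.I * (y : ℂ))) (by rw [hR0, Complex.ofReal_re]; exact hneg)
      (by rw [hR0, Complex.ofReal_im])
    refine hc.tendsto.comp (tendsto_nhdsWithin_iff.2 ⟨hRc.tendsto.mono_left nhdsWithin_le_nhds, him⟩)
  have hR0ne : R (Complex.I * (y : ℂ)) ≠ 0 := by
    rw [hR0]
    exact_mod_cast hneg.ne
  have hRne : ∀ᶠ k in 𝓝[{k : ℂ | 0 < k.re}] (Complex.I * (y : ℂ)), R k ≠ 0 :=
    nhdsWithin_le_nhds (hRc.eventually_ne hR0ne)
  have hpow : Tendsto (fun k => R k ^ (1 / 2 : ℂ)) (𝓝[{k : ℂ | 0 < k.re}] (Complex.I * (y : ℂ)))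
      (𝓝 (R (Complex.I * (y : ℂ)) ^ (1 / 2 : ℂ))) := by
    rw [Complex.cpow_def_of_ne_zero hR0ne]
    refine Tendsto.congr' ?_ ((Complex.continuous_exp.tendsto _).comp (hlog.mul_const _))
    filter_upwards [hRne] with k hk
    simp only [Function.comp, Complex.cpow_def_of_ne_zero hk]
  refine Tendsto.mul ?_ hpow
  exact Tendsto.mono_left (Continuous.tendsto (by fun_prop) _) nhdsWithin_le_nhds

/-- Points close to the open cut and off the imaginary axis lie in the slit half-plane. -/
lemma eventually_mem_slitUpper_right {c y : ℝ} (h0 : 0 < y) :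
    ∀ᶠ k in 𝓝[{k : ℂ | 0 < k.re}] (Complex.I * (y : ℂ)), k ∈ slitUpper c := by
  have h1 : ∀ᶠ k in 𝓝[{k : ℂ | 0 < k.re}] (Complex.I * (y : ℂ)), 0 < k.im :=
    nhdsWithin_le_nhds (Complex.continuous_im.continuousAt.eventually
      (lt_mem_nhds (by simpa using h0)))
  filter_upwards [h1, self_mem_nhdsWithin] with k hk1 hk2
  exact ⟨hk1, fun h => (ne_of_gt hk2) h.1⟩

lemma eventually_mem_slitUpper_left {c y : ℝ} (h0 : 0 < y) :
    ∀ᶠ k in 𝓝[{k : ℂ | k.re < 0}] (Complex.I * (y : ℂ)), k ∈ slitUpper c := by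
  have h1 : ∀ᶠ k in 𝓝[{k : ℂ | k.re < 0}] (Complex.I * (y : ℂ)), 0 < k.im :=
    nhdsWithin_le_nhds (Complex.continuous_im.continuousAt.eventually
      (lt_mem_nhds (by simpa using h0)))
  filter_upwards [h1, self_mem_nhdsWithin] with k hk1 hk2
  exact ⟨hk1, fun h => (ne_of_lt hk2) h.1⟩

/-! ### Boundary values of `a` on the cut -/

section Spectral

variable {c h₁ : ℝ} {a : ℂ → ℂ}

lemma IsSpectralFunction.tendsto_right (ha : IsSpectralFunction c h₁ a) {y : ℝ} (h0 : 0 < y)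
    (hc : y < c) :
    Tendsto a (𝓝[{k : ℂ | 0 < k.re}] (Complex.I * (y : ℂ))) (𝓝 (bdryPlus a (Complex.I * y))) := by
  obtain ⟨l, -, hl⟩ := ha.right y h0 hc
  have : bdryPlus a (Complex.I * y) = l := hl.limUnder_eq
  rwa [this]

lemma IsSpectralFunction.bdryPlus_ne_zero (ha : IsSpectralFunction c h₁ a) {y : ℝ} (h0 : 0 < y)
    (hc : y < c) : bdryPlus a (Complex.I * y) ≠ 0 := by
  obtain ⟨l, hl0, hl⟩ := ha.right y h0 hc
  have : bdryPlus a (Complex.I * y) = l := hl.limUnder_eq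
  rwa [this]

/-- The reflection `k ↦ -conj k` fixes the imaginary axis and exchanges the two sides of the cut.
Hence `a₊ a₋ = |a₊|²`, and `Δ` is real. -/
lemma IsSpectralFunction.bdryMinus_eq (ha : IsSpectralFunction c h₁ a) {y : ℝ} (h0 : 0 < y)
    (hc : y < c) :
    bdryMinus a (Complex.I * y) = (starRingEnd ℂ) (bdryPlus a (Complex.I * y)) := by
  refine Tendsto.limUnder_eq (f := 𝓝[{k : ℂ | k.re < 0}] (Complex.I * (y : ℂ))) ?_
  have h1 : Tendsto (fun k : ℂ => -(starRingEnd ℂ) k) (𝓝[{k : ℂ | k.re < 0}] (Complex.I * (y : ℂ)))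
      (𝓝[{k : ℂ | 0 < k.re}] (Complex.I * (y : ℂ))) := by
    refine tendsto_nhdsWithin_iff.2 ⟨?_, ?_⟩
    · have : Continuous fun k : ℂ => -(starRingEnd ℂ) k := Complex.continuous_conj.neg
      have h2 := this.tendsto (Complex.I * (y : ℂ))
      have h3 : -(starRingEnd ℂ) (Complex.I * (y : ℂ)) = Complex.I * (y : ℂ) := by simp
      rw [h3] at h2
      exact h2.mono_left nhdsWithin_le_nhds
    · filter_upwards [self_mem_nhdsWithin] with k hk
      simpa using hk
  have h2 := (Complex.continuous_conj.tendsto _).comp ((ha.tendsto_right h0 hc).comp h1)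
  refine h2.congr' ?_
  filter_upwards [eventually_mem_slitUpper_left (c := c) h0] with k hk
  exact ha.symmetric k hk

/-- `log |a₊|²` on the cut. -/
def logBdry (a : ℂ → ℂ) (y : ℝ) : ℝ := Real.log (Complex.normSq (bdryPlus a (Complex.I * y)))

lemma IsSpectralFunction.log_bdry (ha : IsSpectralFunction c h₁ a) {y : ℝ} (h0 : 0 < y)
    (hc : y < c) :
    Complex.log (bdryPlus a (Complex.I * y) * bdryMinus a (Complex.I * y)) = (logBdry a y : ℂ) := by
  rw [ha.bdryMinus_eq h0 hc, Complex.mul_conj, logBdry,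
    Complex.ofReal_log (Complex.normSq_nonneg _)]

end Spectral

/-! ### Reduction of `B_g`, `τ`, `Δ` to real integrals over gap and band -/

/-- The weight `1 / √((c² - y²)(y² - d²))` integrated against `F` over the gap `[d, c]`. -/
def gapInt (c d : ℝ) (F : ℝ → ℝ) : ℝ :=
  ∫ y in d..c, F y / √((c ^ 2 - y ^ 2) * (y ^ 2 - d ^ 2))

/-- `∫₀^d dy / √((c² - y²)(d² - y²))`. -/
def bandInt (c d : ℝ) : ℝ := ∫ y in (0 : ℝ)..d, 1 / √((c ^ 2 - y ^ 2) * (d ^ 2 - y ^ 2))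

/-- The factor `i` of `dk = i dy` cancels the factor `i` of `w₊`. Agreement on the open interval is
enough, so nothing is asked at the singular end points. -/
lemma segInt_div_bdryPlus_w {c d : ℝ} (hd0 : 0 ≤ d) (hdc : d ≤ c) {F : ℂ → ℂ} {G : ℝ → ℝ}
    (hFG : ∀ y : ℝ, 0 < y → d < y → y < c → F (Complex.I * y) = (G y : ℂ)) :
    segInt (fun k => F k / bdryPlus (w c d) k) d c = (gapInt c d G : ℂ) := by
  rw [segInt, gapInt, ← intervalIntegral.integral_ofReal]
  refine intervalIntegral.integral_congr_Ioo_of_le hdc fun y hy => ?_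
  have hy0 : 0 < y := hd0.trans_lt hy.1
  have h1 : d ^ 2 < y ^ 2 := by nlinarith [hy.1]
  have h2 : y ^ 2 < c ^ 2 := by nlinarith [hy.2]
  have h3 : ((√((c ^ 2 - y ^ 2) * (y ^ 2 - d ^ 2)) : ℝ) : ℂ) ≠ 0 := by
    have : 0 < √((c ^ 2 - y ^ 2) * (y ^ 2 - d ^ 2)) :=
      Real.sqrt_pos.2 (mul_pos (by linarith) (by linarith))
    exact_mod_cast this.ne'
  simp only [bdryPlus_w hy0 h1 h2, hFG y hy0 hy.1 hy.2, Complex.ofReal_div]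
  field_simp [Complex.I_ne_zero]

lemma segInt_inv_w {c d : ℝ} (hd0 : 0 ≤ d) (hdc : d ≤ c) :
    segInt (fun k => 1 / w c d k) 0 d = Complex.I * (bandInt c d : ℂ) := by
  rw [segInt, bandInt, ← intervalIntegral.integral_ofReal, ← intervalIntegral.integral_const_mul]
  refine intervalIntegral.integral_congr_Ioo_of_le hd0 fun y hy => ?_
  have h1 : y ^ 2 < d ^ 2 := by nlinarith [hy.1, hy.2]
  have h2 : d ^ 2 ≤ c ^ 2 := by nlinarith
  simp only [w_below h1 h2, Complex.ofReal_div, Complex.ofReal_one]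
  ring

/-- The real number `B_g(d)`. -/
def bgReal (c d : ℝ) : ℝ :=
  24 * gapInt c d (fun y => (y ^ 2 - muFun c d ^ 2) * (y ^ 2 - d ^ 2))

lemma Bg_eq {c d : ℝ} (hd0 : 0 ≤ d) (hdc : d ≤ c) : Bg c d = (bgReal c d : ℂ) := by
  rw [Bg, segInt_div_bdryPlus_w hd0 hdc
    (G := fun y => (y ^ 2 - muFun c d ^ 2) * (y ^ 2 - d ^ 2)), bgReal]
  · push_cast
    ring
  · intro y _ _ _
    push_cast
    rw [mul_pow, Complex.I_sq]
    ring

/-- The real number `-τ*(d)/4 = π ∫₀^d / ∫_d^c`. -/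
def ell (c d : ℝ) : ℝ := Real.pi * bandInt c d / gapInt c d (fun _ => 1)

lemma tau_eq {c d : ℝ} (hd0 : 0 ≤ d) (hdc : d ≤ c) :
    tau c d = ((-(Real.pi * gapInt c d (fun _ => 1) / bandInt c d) : ℝ) : ℂ) := by
  rw [tau, segInt_div_bdryPlus_w hd0 hdc (F := fun _ => 1) (G := fun _ => 1) (by simp),
    segInt_inv_w hd0 hdc, mul_inv, Complex.inv_I]
  push_cast
  linear_combination (Real.pi : ℂ) * (gapInt c d fun _ => 1) * (bandInt c d : ℂ)⁻¹ * Complex.I_sq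

lemma tauStar_eq {c d : ℝ} (hd0 : 0 ≤ d) (hdc : d ≤ c) :
    tauStar c d = ((-4 * ell c d : ℝ) : ℂ) := by
  rw [tauStar, tau_eq hd0 hdc, ell]
  have : (Real.pi : ℂ) ≠ 0 := by exact_mod_cast Real.pi_ne_zero
  push_cast
  rw [div_neg, div_div_eq_mul_div, ← neg_div,
    show -(4 * (Real.pi : ℂ) ^ 2 * (bandInt c d : ℂ)) = Real.pi * (-4 * (Real.pi * bandInt c d))
      by ring, mul_div_mul_left _ _ this]
  ring

/-- The real number `Δ(d)`. -/
def deltaReal (c : ℝ) (a : ℂ → ℂ) (d : ℝ) : ℝ := -(gapInt c d (logBdry a) / bandInt c d)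

lemma Delta_eq {c h₁ d : ℝ} {a : ℂ → ℂ} (ha : IsSpectralFunction c h₁ a) (hd0 : 0 ≤ d)
    (hdc : d ≤ c) : Delta c a d = (deltaReal c a d : ℂ) := by
  rw [Delta, segInt_div_bdryPlus_w hd0 hdc (G := logBdry a), segInt_inv_w hd0 hdc,
    ← mul_assoc, Complex.I_mul_I, deltaReal]
  · push_cast
    rw [mul_inv, div_eq_mul_inv]
    norm_num
  · intro y hy0 _ hyc
    exact ha.log_bdry hy0 hyc

/-! ### Change of variables for integrals with end point singularities -/

open MeasureTheory Set

/-- The measure-theoretic change of variables on the open interval needs no integrability and no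
derivative at the ends. It also transfers integrability, which makes it suitable for the singular
integrands below. -/
lemma intervalIntegral_subst_of_injOn {f f' g G : ℝ → ℝ} {a b A B : ℝ} (hab : a ≤ b) (hAB : A ≤ B)
    (himg : f '' Ioo a b = Ioo A B) (hinj : InjOn f (Ioo a b))
    (hd : ∀ x ∈ Ioo a b, HasDerivAt f (f' x) x)
    (heq : ∀ x ∈ Ioo a b, |f' x| * g (f x) = G x) :
    ∫ y in A..B, g y = ∫ x in a..b, G x ∧
      (IntervalIntegrable g volume A B ↔ IntervalIntegrable G volume a b) := by
  have hd' : ∀ x ∈ Ioo a b, HasDerivWithinAt f (f' x) (Ioo a b) x :=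
    fun x hx => (hd x hx).hasDerivWithinAt
  have heq' : EqOn (fun x => |f' x| • g (f x)) G (Ioo a b) := fun x hx => heq x hx
  constructor
  · rw [intervalIntegral.integral_of_le hab, intervalIntegral.integral_of_le hAB,
      integral_Ioc_eq_integral_Ioo, integral_Ioc_eq_integral_Ioo, ← himg,
      integral_image_eq_integral_abs_deriv_smul measurableSet_Ioo hd' hinj]
    exact setIntegral_congr_fun measurableSet_Ioo heq'
  · rw [intervalIntegrable_iff_integrableOn_Ioo_of_le hab,
      intervalIntegrable_iff_integrableOn_Ioo_of_le hAB, ← himg,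
      integrableOn_image_iff_integrableOn_abs_deriv_smul measurableSet_Ioo hd' hinj]
    exact integrableOn_congr_fun heq' measurableSet_Ioo

lemma intervalIntegral_subst_inc {f f' g G : ℝ → ℝ} {a b A B : ℝ} (hab : a ≤ b)
    (hc : ContinuousOn f (Icc a b)) (hd : ∀ x ∈ Ioo a b, HasDerivAt f (f' x) x)
    (hpos : ∀ x ∈ Ioo a b, 0 < f' x) (hA : f a = A) (hB : f b = B)
    (heq : ∀ x ∈ Ioo a b, f' x * g (f x) = G x) :
    ∫ y in A..B, g y = ∫ x in a..b, G x ∧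
      (IntervalIntegrable g volume A B ↔ IntervalIntegrable G volume a b) := by
  have hm : StrictMonoOn f (Icc a b) := by
    refine strictMonoOn_of_deriv_pos (convex_Icc a b) hc fun x hx => ?_
    rw [interior_Icc] at hx
    rw [(hd x hx).deriv]
    exact hpos x hx
  have ha : a ∈ Icc a b := left_mem_Icc.2 hab
  have hb : b ∈ Icc a b := right_mem_Icc.2 hab
  refine intervalIntegral_subst_of_injOn hab (hA ▸ hB ▸ hm.monotoneOn ha hb hab) ?_
    (hm.injOn.mono Ioo_subset_Icc_self) hd fun x hx => ?_
  · refine Subset.antisymm ?_ (hA ▸ hB ▸ intermediate_value_Ioo hab hc)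
    rintro _ ⟨x, hx, rfl⟩
    exact ⟨hA ▸ hm ha (Ioo_subset_Icc_self hx) hx.1, hB ▸ hm (Ioo_subset_Icc_self hx) hb hx.2⟩
  · rw [abs_of_pos (hpos x hx), heq x hx]

lemma intervalIntegral_subst_dec {f f' g G : ℝ → ℝ} {a b A B : ℝ} (hab : a ≤ b)
    (hc : ContinuousOn f (Icc a b)) (hd : ∀ x ∈ Ioo a b, HasDerivAt f (f' x) x)
    (hneg : ∀ x ∈ Ioo a b, f' x < 0) (hA : f b = A) (hB : f a = B)
    (heq : ∀ x ∈ Ioo a b, -f' x * g (f x) = G x) :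
    ∫ y in A..B, g y = ∫ x in a..b, G x ∧
      (IntervalIntegrable g volume A B ↔ IntervalIntegrable G volume a b) := by
  have hm : StrictAntiOn f (Icc a b) := by
    refine strictAntiOn_of_deriv_neg (convex_Icc a b) hc fun x hx => ?_
    rw [interior_Icc] at hx
    rw [(hd x hx).deriv]
    exact hneg x hx
  have ha : a ∈ Icc a b := left_mem_Icc.2 hab
  have hb : b ∈ Icc a b := right_mem_Icc.2 hab
  refine intervalIntegral_subst_of_injOn hab (hA ▸ hB ▸ hm.antitoneOn ha hb hab) ?_
    (hm.injOn.mono Ioo_subset_Icc_self) hd fun x hx => ?_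
  · refine Subset.antisymm ?_ (hA ▸ hB ▸ intermediate_value_Ioo' hab hc)
    rintro _ ⟨x, hx, rfl⟩
    exact ⟨hA ▸ hm (Ioo_subset_Icc_self hx) hb hx.2, hB ▸ hm ha (Ioo_subset_Icc_self hx) hx.1⟩
  · rw [abs_of_neg (hneg x hx), heq x hx]

/-! ### Complete elliptic integrals in the parameter `p = 1 - d²/c²` -/

/-- The integrand `√(1 - p sin² θ)` of the complete elliptic integrals. -/
def ampl (p θ : ℝ) : ℝ := √(1 - p * Real.sin θ ^ 2)

/-- The complete elliptic integral with parameter `p`. -/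
def ellKc (p : ℝ) : ℝ := ∫ θ in (0 : ℝ)..(Real.pi / 2), 1 / ampl p θ

/-- The complete elliptic integral with complementary parameter `p`. -/
def ellK (p : ℝ) : ℝ := ∫ l in (0 : ℝ)..1, 1 / √((1 - l ^ 2) * (1 - (1 - p) * l ^ 2))

section

variable {c p : ℝ}

lemma one_sub_le_ampl_sq (hp0 : 0 ≤ p) (θ : ℝ) : 1 - p ≤ 1 - p * Real.sin θ ^ 2 := by
  nlinarith [Real.sin_sq_le_one θ]

lemma continuous_ampl (p : ℝ) : Continuous (ampl p) := by
  unfold ampl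
  fun_prop

lemma ampl_pos (hp0 : 0 ≤ p) (hp1 : p < 1) (θ : ℝ) : 0 < ampl p θ :=
  Real.sqrt_pos.2 (by linarith [one_sub_le_ampl_sq hp0 θ])

lemma ampl_sq (hp0 : 0 ≤ p) (hp1 : p < 1) (θ : ℝ) : ampl p θ ^ 2 = 1 - p * Real.sin θ ^ 2 :=
  Real.sq_sqrt (by linarith [one_sub_le_ampl_sq hp0 θ])

lemma gapInt_eq (hc : 0 < c) (hp0 : 0 < p) (hp1 : p < 1) (F : ℝ → ℝ) :
    gapInt c (c * √(1 - p)) F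
      = (∫ θ in (0 : ℝ)..(Real.pi / 2), F (c * ampl p θ) / ampl p θ) / c := by
  have hpi := Real.pi_pos
  rw [gapInt, ← intervalIntegral.integral_div]
  -- With `y = c √(1 - p sin² θ)` the root becomes `c² p sin θ cos θ`, which cancels the derivative
  -- up to `1 / (c · ampl p θ)`: both end point singularities disappear.
  refine (intervalIntegral_subst_dec (f := fun θ => c * ampl p θ)
    (f' := fun θ => -(c * p * (Real.sin θ * Real.cos θ) / ampl p θ)) (by positivity)
    (by have := continuous_ampl p; fun_prop) ?_ ?_ ?_ ?_ ?_).1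
  · intro θ _
    have h1 : HasDerivAt (fun θ => 1 - p * Real.sin θ ^ 2)
        (-(p * (2 * Real.sin θ * Real.cos θ))) θ := by
      have := (((Real.hasDerivAt_sin θ).pow 2).const_mul p).const_sub 1
      simpa using this
    have h2 := (h1.sqrt (by have := one_sub_le_ampl_sq hp0.le θ; linarith)).const_mul c
    refine h2.congr_deriv ?_
    have := ampl_pos hp0.le hp1 θ
    rw [ampl] at *
    field_simp
  · intro θ hθ
    have h1 := Real.sin_pos_of_pos_of_lt_pi hθ.1 (by linarith [hθ.2])
    have h2 := Real.cos_pos_of_mem_Ioo ⟨by linarith [hθ.1], hθ.2⟩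
    have := ampl_pos hp0.le hp1 θ
    have : 0 < c * p * (Real.sin θ * Real.cos θ) / ampl p θ := by positivity
    linarith
  · simp [ampl]
  · simp [ampl]
  · intro θ hθ
    have h1 := Real.sin_pos_of_pos_of_lt_pi hθ.1 (by linarith [hθ.2])
    have h2 := Real.cos_pos_of_mem_Ioo ⟨by linarith [hθ.1], hθ.2⟩
    have h3 := ampl_pos hp0.le hp1 θ
    have h4 := ampl_sq hp0.le hp1 θ
    have h5 : √((c ^ 2 - (c * ampl p θ) ^ 2) * ((c * ampl p θ) ^ 2 - (c * √(1 - p)) ^ 2))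
        = c ^ 2 * p * (Real.sin θ * Real.cos θ) := by
      rw [← Real.sqrt_sq (by positivity : 0 ≤ c ^ 2 * p * (Real.sin θ * Real.cos θ))]
      congr 1
      rw [mul_pow c (√(1 - p)), Real.sq_sqrt (by linarith), mul_pow, h4]
      have := Real.sin_sq_add_cos_sq θ
      have h6 : Real.cos θ ^ 2 = 1 - Real.sin θ ^ 2 := by linarith
      rw [mul_pow, mul_pow, mul_pow (Real.sin θ), h6]
      ring
    rw [h5]
    field_simp

lemma gapInt_one (hc : 0 < c) (hp0 : 0 < p) (hp1 : p < 1) :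
    gapInt c (c * √(1 - p)) (fun _ => 1) = ellKc p / c := by
  rw [gapInt_eq hc hp0 hp1, ellKc]

lemma bandInt_eq (hc : 0 < c) (hp1 : p < 1) :
    bandInt c (c * √(1 - p)) = ellK p / c := by
  have hs : 0 < √(1 - p) := Real.sqrt_pos.2 (by linarith)
  have hd : 0 < c * √(1 - p) := by positivity
  rw [bandInt, ellK, ← intervalIntegral.integral_div]
  refine (intervalIntegral_subst_inc (f := fun l => c * √(1 - p) * l)
    (f' := fun _ => c * √(1 - p)) zero_le_one (by fun_prop) ?_ ?_ ?_ ?_ ?_).1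
  · intro x _
    simpa using (hasDerivAt_id x).const_mul (c * √(1 - p))
  · intro x _
    exact hd
  · simp
  · simp
  · intro l hl
    have h5 : √((c ^ 2 - (c * √(1 - p) * l) ^ 2) * ((c * √(1 - p)) ^ 2 - (c * √(1 - p) * l) ^ 2))
        = c * (c * √(1 - p)) * √((1 - l ^ 2) * (1 - (1 - p) * l ^ 2)) := by
      rw [← Real.sqrt_sq (by positivity : 0 ≤ c * (c * √(1 - p))), ← Real.sqrt_mul (by positivity)]
      congr 1
      simp only [mul_pow, Real.sq_sqrt (by linarith : 0 ≤ 1 - p)]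
      ring
    rw [h5]
    by_cases h : √((1 - l ^ 2) * (1 - (1 - p) * l ^ 2)) = 0
    · simp [h]
    · field_simp

lemma ell_eq (hc : 0 < c) (hp0 : 0 < p) (hp1 : p < 1) :
    ell c (c * √(1 - p)) = Real.pi * ellK p / ellKc p := by
  rw [ell, gapInt_one hc hp0 hp1, bandInt_eq hc hp1, ← mul_div_assoc,
    div_div_div_cancel_right₀ hc.ne']

/-- Half of the integral for `ellK`, in the variable `u`, `l = u / √(1 + u²)`. -/
lemma ellK_halves (hp0 : 0 < p) :
    ellK p = 2 * ∫ u in (0 : ℝ)..(1 / √√p), 1 / √((1 + u ^ 2) * (1 + p * u ^ 2)) ∧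
    IntervalIntegrable (fun l : ℝ => 1 / √((1 - l ^ 2) * (1 - (1 - p) * l ^ 2))) volume 0 1 := by
  -- With `l = u / √(1 + u²)` the integrand is invariant under `u ↦ 1 / (√p u)`, whose fixed point
  -- is `U`. The second substitution `l = 1 / √(1 + p u²)` below is the first one composed with this
  -- involution, so both halves give the same integral over `[0, U]`.
  set U := 1 / √√p with hU
  have hs : 0 < √p := Real.sqrt_pos.2 hp0
  have hs2 : √p ^ 2 = p := Real.sq_sqrt hp0.le
  have hU0 : 0 < U := by positivity
  have hU2 : U ^ 2 = 1 / √p := by rw [hU, div_pow, Real.sq_sqrt hs.le, one_pow]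
  set l₀ := 1 / √(1 + √p) with hl₀
  have hGc : IntervalIntegrable (fun u : ℝ => 1 / √((1 + u ^ 2) * (1 + p * u ^ 2))) volume 0 U := by
    refine Continuous.intervalIntegrable ?_ _ _
    refine continuous_const.div (by fun_prop) fun u => ?_
    positivity
  have h1 := intervalIntegral_subst_inc (f := fun u : ℝ => u / √(1 + u ^ 2))
    (f' := fun u : ℝ => 1 / ((1 + u ^ 2) * √(1 + u ^ 2)))
    (g := fun l : ℝ => 1 / √((1 - l ^ 2) * (1 - (1 - p) * l ^ 2)))
    (G := fun u : ℝ => 1 / √((1 + u ^ 2) * (1 + p * u ^ 2))) (a := 0) (b := U) (A := 0) (B := l₀)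
    hU0.le ?_ ?_ ?_ ?_ ?_ ?_
  · have h2 := intervalIntegral_subst_dec (f := fun u : ℝ => 1 / √(1 + p * u ^ 2))
      (f' := fun u : ℝ => -(p * u / ((1 + p * u ^ 2) * √(1 + p * u ^ 2))))
      (g := fun l : ℝ => 1 / √((1 - l ^ 2) * (1 - (1 - p) * l ^ 2)))
      (G := fun u : ℝ => 1 / √((1 + u ^ 2) * (1 + p * u ^ 2))) (a := 0) (b := U) (A := l₀) (B := 1)
      hU0.le ?_ ?_ ?_ ?_ ?_ ?_
    · refine ⟨?_, (h1.2.2 hGc).trans (h2.2.2 hGc)⟩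
      rw [ellK, ← intervalIntegral.integral_add_adjacent_intervals (h1.2.2 hGc) (h2.2.2 hGc), h1.1,
        h2.1]
      ring
    · refine (continuous_const.div (by fun_prop) fun u => ?_).continuousOn
      positivity
    · intro u _
      have e1 : HasDerivAt (fun u : ℝ => 1 + p * u ^ 2) (p * (2 * u)) u := by
        simpa using (((hasDerivAt_id u).pow 2).const_mul p).const_add 1
      have e2 := (e1.sqrt (by positivity)).inv (by positivity)
      simp only [one_div]
      refine e2.congr_deriv ?_
      have : 0 < 1 + p * u ^ 2 := by positivity
      rw [Real.sq_sqrt this.le]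
      field_simp
    · intro u hu
      have := hu.1
      have : 0 < p * u / ((1 + p * u ^ 2) * √(1 + p * u ^ 2)) := by positivity
      linarith
    · rw [hU2, hl₀]
      congr 3
      nth_rw 1 [← hs2]
      field_simp
    · simp
    · intro u hu
      have hu0 := hu.1
      have hq : 0 < 1 + p * u ^ 2 := by positivity
      have e3 : √((1 - (1 / √(1 + p * u ^ 2)) ^ 2) * (1 - (1 - p) * (1 / √(1 + p * u ^ 2)) ^ 2))
          = p * u * √(1 + u ^ 2) / (1 + p * u ^ 2) := by
        rw [div_pow, Real.sq_sqrt hq.le, ← Real.sqrt_sq (by positivity : 0 ≤ p * u * √(1 + u ^ 2) / (1 + p * u ^ 2))]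
        congr 1
        rw [div_pow, mul_pow (p * u), Real.sq_sqrt (by positivity)]
        field_simp
        ring
      rw [e3, Real.sqrt_mul (by positivity)]
      field_simp
  · refine (continuous_id.div (by fun_prop) fun u => ?_).continuousOn
    positivity
  · intro u _
    have e1 : HasDerivAt (fun u : ℝ => 1 + u ^ 2) (2 * u) u := by
      simpa using ((hasDerivAt_id u).pow 2).const_add 1
    have e2 := (hasDerivAt_id u).div (e1.sqrt (by positivity)) (by positivity)
    refine e2.congr_deriv ?_
    have : 0 < 1 + u ^ 2 := by positivity
    have h3 := Real.sq_sqrt this.le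
    simp only [id]
    rw [h3]
    field_simp
    rw [h3]
    ring
  · intro u _
    positivity
  · simp
  · have e4 : 1 + 1 / √p = (1 + √p) / √p := by
      field_simp
      ring
    rw [hU2, hl₀, hU, e4, Real.sqrt_div (by positivity)]
    field_simp
  · intro u hu
    have hq : 0 < 1 + u ^ 2 := by positivity
    have e3 : √((1 - (u / √(1 + u ^ 2)) ^ 2) * (1 - (1 - p) * (u / √(1 + u ^ 2)) ^ 2))
        = √(1 + p * u ^ 2) / (1 + u ^ 2) := by
      rw [div_pow, Real.sq_sqrt hq.le,
        ← Real.sqrt_sq (by positivity : 0 ≤ √(1 + p * u ^ 2) / (1 + u ^ 2))]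
      congr 1
      rw [div_pow, Real.sq_sqrt (by positivity)]
      field_simp
      ring
    rw [e3, Real.sqrt_mul (by positivity)]
    field_simp

end

/-! ### Expansions of the elliptic integrals as `p → 0` -/

/-- The logarithm `log (16 / p)`, the leading term of the half period ratio. -/
def logPar (p : ℝ) : ℝ := Real.log (16 / p)

lemma inv_sqrt_one_sub_bounds {x : ℝ} (h0 : 0 ≤ x) (h1 : x ≤ 1 / 2) :
    1 + x / 2 ≤ 1 / √(1 - x) ∧ 1 / √(1 - x) ≤ 1 + x / 2 + x ^ 2 := by
  have hs : 0 < √(1 - x) := Real.sqrt_pos.2 (by linarith)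
  have hsq : √(1 - x) ^ 2 = 1 - x := Real.sq_sqrt (by linarith)
  constructor
  · rw [le_div_iff₀ hs]
    refine abs_le_of_sq_le_sq' ?_ zero_le_one |>.2
    rw [mul_pow, hsq]
    have := pow_nonneg h0 3
    nlinarith [sq_nonneg x]
  · rw [div_le_iff₀ hs]
    refine abs_le_of_sq_le_sq' ?_ (by positivity) |>.2
    rw [mul_pow, hsq]
    have h2 : 0 ≤ x ^ 2 * (1 / 2 - x) := mul_nonneg (sq_nonneg x) (by linarith)
    have h4 : x ^ 5 ≤ x ^ 2 * (1 / 8) := by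
      have : x ^ 3 ≤ (1 / 2) ^ 3 := pow_le_pow_left₀ h0 h1 3
      nlinarith [sq_nonneg x]
    nlinarith [sq_nonneg x]

lemma inv_sqrt_one_add_bounds {x : ℝ} (h0 : 0 ≤ x) (h1 : x ≤ 1) :
    1 - x / 2 ≤ 1 / √(1 + x) ∧ 1 / √(1 + x) ≤ 1 - x / 2 + x ^ 2 / 2 := by
  have hs : 0 < √(1 + x) := Real.sqrt_pos.2 (by linarith)
  have hsq : √(1 + x) ^ 2 = 1 + x := Real.sq_sqrt (by linarith)
  have h2 : 0 ≤ x ^ 2 * (1 - x) := mul_nonneg (sq_nonneg x) (by linarith)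
  constructor
  · rw [le_div_iff₀ hs]
    refine abs_le_of_sq_le_sq' ?_ zero_le_one |>.2
    rw [mul_pow, hsq]
    nlinarith [sq_nonneg x]
  · rw [div_le_iff₀ hs]
    have h3 : 0 ≤ 1 - x / 2 + x ^ 2 / 2 := by nlinarith [sq_nonneg x]
    refine abs_le_of_sq_le_sq' ?_ (by positivity) |>.2
    rw [mul_pow, hsq]
    have h5 : 0 ≤ x ^ 3 * (1 - x) := mul_nonneg (pow_nonneg h0 3) (by linarith)
    have h6 : 0 ≤ x ^ 5 := pow_nonneg h0 5
    nlinarith [sq_nonneg x, pow_nonneg h0 3]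

section

variable {p : ℝ}

lemma inv_ampl_bounds (hp0 : 0 ≤ p) (hp1 : p ≤ 1 / 2) (θ : ℝ) :
    1 + p / 2 * Real.sin θ ^ 2 ≤ 1 / ampl p θ ∧
      1 / ampl p θ ≤ 1 + p / 2 * Real.sin θ ^ 2 + p ^ 2 := by
  have hs0 := sq_nonneg (Real.sin θ)
  have hs1 := Real.sin_sq_le_one θ
  have h0 : 0 ≤ p * Real.sin θ ^ 2 := by positivity
  have h1 : p * Real.sin θ ^ 2 ≤ p := by nlinarith
  obtain ⟨h2, h3⟩ := inv_sqrt_one_sub_bounds h0 (h1.trans hp1)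
  have h4 : (p * Real.sin θ ^ 2) ^ 2 ≤ p ^ 2 := pow_le_pow_left₀ h0 h1 2
  rw [ampl]
  constructor <;> linarith

lemma one_le_inv_ampl (hp0 : 0 ≤ p) (hp1 : p ≤ 1 / 2) (θ : ℝ) : 1 ≤ 1 / ampl p θ := by
  have := (inv_ampl_bounds hp0 hp1 θ).1
  have : 0 ≤ p / 2 * Real.sin θ ^ 2 := by positivity
  linarith

lemma inv_ampl_le (hp0 : 0 ≤ p) (hp1 : p ≤ 1 / 2) (θ : ℝ) : 1 / ampl p θ ≤ 1 + p := by
  have h1 := (inv_ampl_bounds hp0 hp1 θ).2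
  have h2 : p / 2 * Real.sin θ ^ 2 ≤ p / 2 := by nlinarith [Real.sin_sq_le_one θ]
  nlinarith

lemma continuous_inv_ampl (hp0 : 0 ≤ p) (hp1 : p < 1) : Continuous fun θ => 1 / ampl p θ :=
  continuous_const.div (continuous_ampl p) fun θ => (ampl_pos hp0 hp1 θ).ne'

lemma integral_sin_sq_half : ∫ θ in (0 : ℝ)..(Real.pi / 2), Real.sin θ ^ 2 = Real.pi / 4 := by
  rw [integral_sin_sq]
  simp
  ring

lemma ellKc_estimate (hp0 : 0 ≤ p) (hp1 : p ≤ 1 / 2) :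
    |ellKc p - Real.pi / 2 * (1 + p / 4)| ≤ 2 * p ^ 2 := by
  have hpi := Real.pi_pos
  have hpi4 := Real.pi_le_four
  have hcont := continuous_inv_ampl hp0 (by linarith : p < 1)
  have hI (e : ℝ) : ∫ θ in (0 : ℝ)..(Real.pi / 2), (1 + p / 2 * Real.sin θ ^ 2 + e)
      = Real.pi / 2 * (1 + p / 4) + Real.pi / 2 * e := by
    rw [intervalIntegral.integral_add, intervalIntegral.integral_add,
      intervalIntegral.integral_const_mul, integral_sin_sq_half]
    · simp
      ring
    all_goals exact Continuous.intervalIntegrable (by fun_prop) _ _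
  have h1 : ∫ θ in (0 : ℝ)..(Real.pi / 2), (1 + p / 2 * Real.sin θ ^ 2 + 0) ≤ ellKc p := by
    refine intervalIntegral.integral_mono_on (by positivity)
      (Continuous.intervalIntegrable (by fun_prop) _ _) (hcont.intervalIntegrable _ _) fun θ _ => ?_
    linarith [(inv_ampl_bounds hp0 hp1 θ).1]
  have h2 : ellKc p ≤ ∫ θ in (0 : ℝ)..(Real.pi / 2), (1 + p / 2 * Real.sin θ ^ 2 + p ^ 2) := by
    refine intervalIntegral.integral_mono_on (by positivity) (hcont.intervalIntegrable _ _)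
      (Continuous.intervalIntegrable (by fun_prop) _ _) fun θ _ => ?_
    exact (inv_ampl_bounds hp0 hp1 θ).2
  rw [hI] at h1 h2
  rw [abs_le]
  constructor <;> nlinarith [sq_nonneg p]

lemma pi_div_two_le_ellKc (hp0 : 0 ≤ p) (hp1 : p ≤ 1 / 2) : Real.pi / 2 ≤ ellKc p := by
  have hcont := continuous_inv_ampl hp0 (by linarith : p < 1)
  have h1 : ∫ θ in (0 : ℝ)..(Real.pi / 2), (1 : ℝ) ≤ ellKc p := by
    refine intervalIntegral.integral_mono_on (by positivity)
      (Continuous.intervalIntegrable (by fun_prop) _ _) (hcont.intervalIntegrable _ _) fun θ _ => ?_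
    exact one_le_inv_ampl hp0 hp1 θ
  simpa using h1

lemma ellKc_le (hp0 : 0 ≤ p) (hp1 : p ≤ 1 / 2) : ellKc p ≤ Real.pi / 2 * (1 + p) := by
  have hcont := continuous_inv_ampl hp0 (by linarith : p < 1)
  have h1 : ellKc p ≤ ∫ θ in (0 : ℝ)..(Real.pi / 2), (1 + p) := by
    refine intervalIntegral.integral_mono_on (by positivity)
      (hcont.intervalIntegrable _ _) (Continuous.intervalIntegrable (by fun_prop) _ _) fun θ _ => ?_
    exact inv_ampl_le hp0 hp1 θ
  simpa only [intervalIntegral.integral_const, sub_zero, smul_eq_mul] using h1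

/-- A primitive of `(1 - p u² / 2) / √(1 + u²)`. -/
lemma hasDerivAt_arsinh_primitive (p u : ℝ) :
    HasDerivAt (fun u => (1 + p / 4) * Real.arsinh u - p / 4 * (u * √(1 + u ^ 2)))
      ((1 - p * u ^ 2 / 2) / √(1 + u ^ 2)) u := by
  have e1 : HasDerivAt (fun u : ℝ => 1 + u ^ 2) (2 * u) u := by
    simpa using ((hasDerivAt_id u).pow 2).const_add 1
  have e2 := (hasDerivAt_id u).mul (e1.sqrt (by positivity))
  have e3 := ((Real.hasDerivAt_arsinh u).const_mul (1 + p / 4)).sub (e2.const_mul (p / 4))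
  refine e3.congr_deriv ?_
  have h : √(1 + u ^ 2) ^ 2 = 1 + u ^ 2 := Real.sq_sqrt (by positivity)
  have : 0 < √(1 + u ^ 2) := by positivity
  simp only [id]
  field_simp
  rw [h]
  ring

/-- On `[0, U]` one has `p u² ≤ √p ≤ 1`, so the factor `1 / √(1 + p u²)` may be expanded. The
remainder is at most `p² u³ / 2`, with integral `p² U⁴ / 8 = p / 8` because `p U⁴ = 1`; doubling
gives `p / 4`. -/
lemma ellK_estimate_arsinh (hp0 : 0 < p) (hp1 : p ≤ 1) {U : ℝ} (hU : U = 1 / √√p) :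
    |ellK p - 2 * ((1 + p / 4) * Real.arsinh U - p / 4 * (U * √(1 + U ^ 2)))| ≤ p / 4 := by
  have hs : 0 < √p := Real.sqrt_pos.2 hp0
  have hs2 : √p ^ 2 = p := Real.sq_sqrt hp0.le
  have hU0 : 0 < U := by rw [hU]; positivity
  have hU2 : U ^ 2 = 1 / √p := by rw [hU, div_pow, Real.sq_sqrt hs.le, one_pow]
  have hU4 : p * U ^ 4 = 1 / 1 := by
    rw [show U ^ 4 = (U ^ 2) ^ 2 by ring, hU2, div_pow, hs2]
    field_simp
  rw [(ellK_halves hp0).1, ← hU]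
  have hcont1 : Continuous fun u : ℝ => (1 - p * u ^ 2 / 2) / √(1 + u ^ 2) := by
    refine Continuous.div (by fun_prop) (by fun_prop) fun u => ?_
    positivity
  have hcont2 : Continuous fun u : ℝ => 1 / √((1 + u ^ 2) * (1 + p * u ^ 2)) := by
    refine continuous_const.div (by fun_prop) fun u => ?_
    positivity
  have hcont3 : Continuous fun u : ℝ => p ^ 2 / 2 * u ^ 3 := by fun_prop
  have hG : ∫ u in (0 : ℝ)..U, (1 - p * u ^ 2 / 2) / √(1 + u ^ 2)
      = (1 + p / 4) * Real.arsinh U - p / 4 * (U * √(1 + U ^ 2)) := by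
    rw [intervalIntegral.integral_eq_sub_of_hasDerivAt
      (fun u _ => hasDerivAt_arsinh_primitive p u) (hcont1.intervalIntegrable _ _)]
    simp
  have key : ∀ u ∈ Icc 0 U, (1 - p * u ^ 2 / 2) / √(1 + u ^ 2)
      ≤ 1 / √((1 + u ^ 2) * (1 + p * u ^ 2)) ∧ 1 / √((1 + u ^ 2) * (1 + p * u ^ 2))
      ≤ (1 - p * u ^ 2 / 2) / √(1 + u ^ 2) + p ^ 2 / 2 * u ^ 3 := by
    intro u hu
    have hx0 : 0 ≤ p * u ^ 2 := by positivity
    have hx1 : p * u ^ 2 ≤ 1 := by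
      have h1 : u ^ 2 ≤ U ^ 2 := pow_le_pow_left₀ hu.1 hu.2 2
      have h2 : p * U ^ 2 = √p := by
        rw [hU2]
        nth_rw 1 [← hs2]
        field_simp
      have h3 : √p ≤ 1 := Real.sqrt_le_one.2 hp1
      nlinarith
    obtain ⟨h1, h2⟩ := inv_sqrt_one_add_bounds hx0 hx1
    have hr : 0 < √(1 + u ^ 2) := by positivity
    have hu1 : u ≤ √(1 + u ^ 2) := Real.le_sqrt_of_sq_le (by linarith)
    have e : 1 / √((1 + u ^ 2) * (1 + p * u ^ 2)) = 1 / √(1 + p * u ^ 2) / √(1 + u ^ 2) := by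
      rw [Real.sqrt_mul (by positivity), div_div, mul_comm]
    rw [e]
    refine ⟨by gcongr, ?_⟩
    calc 1 / √(1 + p * u ^ 2) / √(1 + u ^ 2)
        ≤ (1 - p * u ^ 2 / 2 + (p * u ^ 2) ^ 2 / 2) / √(1 + u ^ 2) := by gcongr
      _ = (1 - p * u ^ 2 / 2) / √(1 + u ^ 2) + p ^ 2 / 2 * (u ^ 3 * (u / √(1 + u ^ 2))) := by
          field_simp
      _ ≤ (1 - p * u ^ 2 / 2) / √(1 + u ^ 2) + p ^ 2 / 2 * (u ^ 3 * 1) := by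
          have : u / √(1 + u ^ 2) ≤ 1 := (div_le_one hr).2 hu1
          have := hu.1
          gcongr
      _ = _ := by ring
  have h1 := intervalIntegral.integral_mono_on hU0.le (hcont1.intervalIntegrable _ _)
    (hcont2.intervalIntegrable (μ := volume) _ _) fun u hu => (key u hu).1
  have h2 := intervalIntegral.integral_mono_on hU0.le (hcont2.intervalIntegrable (μ := volume) _ _)
    ((hcont1.intervalIntegrable _ _).add
      (hcont3.intervalIntegrable _ _))
    fun u hu => (key u hu).2
  rw [intervalIntegral.integral_add (hcont1.intervalIntegrable _ _)
    (hcont3.intervalIntegrable _ _), intervalIntegral.integral_const_mul,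
    integral_pow] at h2
  rw [hG] at h1 h2
  have h3 : p ^ 2 / 2 * ((U ^ (3 + 1) - 0 ^ (3 + 1)) / ((3 : ℕ) + 1)) = p / 8 := by
    norm_num
    nlinarith
  rw [h3] at h2
  rw [abs_le]
  constructor <;> linarith

/-- Both pieces contain a term `√p / 2` produced by the split at `U`. They are recorded with the
same coefficient so that they cancel in `ellK_estimate`. -/
lemma arsinh_estimate (hp0 : 0 < p) (hp1 : p ≤ 1) {U : ℝ} (hU : U = 1 / √√p) :
    |2 * Real.arsinh U - (logPar p / 2 + √p / 2)| ≤ p / 4 ∧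
      |p / 2 * (U * √(1 + U ^ 2)) - √p / 2| ≤ p / 4 := by
  set h := √p with hh
  have hs : 0 < h := Real.sqrt_pos.2 hp0
  have hs1 : h ≤ 1 := Real.sqrt_le_one.2 hp1
  have hs2 : h ^ 2 = p := Real.sq_sqrt hp0.le
  have hU0 : 0 < U := by rw [hU]; positivity
  have hU2 : U ^ 2 = 1 / h := by rw [hU, div_pow, Real.sq_sqrt hs.le, one_pow]
  set r := √(1 + h) with hr
  have hr2 : r ^ 2 = 1 + h := Real.sq_sqrt (by linarith)
  have hr0 : 0 ≤ r := Real.sqrt_nonneg _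
  have hr1 : r ≤ 1 + h / 2 := abs_le_of_sq_le_sq' (by nlinarith) (by positivity) |>.2
  have hr3 : 1 + h / 2 - h ^ 2 / 8 ≤ r := by
    refine abs_le_of_sq_le_sq' ?_ hr0 |>.2
    rw [hr2]
    nlinarith [pow_nonneg hs.le 3, pow_nonneg hs.le 4]
  have hsq : √(1 + U ^ 2) = U * r := by
    rw [← Real.sqrt_sq hU0.le, hr, ← Real.sqrt_mul (by positivity), Real.sq_sqrt (by positivity)]
    congr 1
    rw [mul_add, hU2]
    field_simp
    ring
  constructor
  · have e1 : Real.arsinh U = Real.log U + Real.log (1 + r) := by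
      rw [Real.arsinh, hsq, ← Real.log_mul (by positivity) (by positivity)]
      congr 1
      ring
    have e2 : 2 * Real.log U = -(1 / 2) * Real.log p := by
      have : Real.log (U ^ 2) = 2 * Real.log U := by simp
      rw [← this, hU2, one_div, Real.log_inv, hh, Real.log_sqrt hp0.le]
      ring
    have e3 : logPar p = 4 * Real.log 2 - Real.log p := by
      rw [logPar, Real.log_div (by norm_num) hp0.ne', show (16 : ℝ) = 2 ^ 4 by norm_num,
        Real.log_pow]
      norm_num
    have e4 : Real.log (1 + r) = Real.log 2 + Real.log ((1 + r) / 2) := by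
      rw [← Real.log_mul (by norm_num) (by positivity)]
      congr 1
      ring
    have e5 : Real.log ((1 + r) / 2) ≤ (1 + r) / 2 - 1 := Real.log_le_sub_one_of_pos (by positivity)
    have e6 : 1 - ((1 + r) / 2)⁻¹ ≤ Real.log ((1 + r) / 2) :=
      Real.one_sub_inv_le_log_of_pos (by positivity)
    have e7 : h / 4 - h ^ 2 / 8 ≤ 1 - ((1 + r) / 2)⁻¹ := by
      rw [le_sub_comm, inv_le_comm₀ (by positivity) (by nlinarith)]
      rw [inv_le_comm₀ (by nlinarith) (by positivity)]
      rw [inv_le_iff_one_le_mul₀ (by positivity)]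
      nlinarith [pow_nonneg hs.le 3, pow_nonneg hs.le 4]
    rw [abs_le]
    constructor <;> linarith
  · have e1 : p / 2 * (U * √(1 + U ^ 2)) = h / 2 * r := by
      rw [hsq, ← hs2, show h ^ 2 / 2 * (U * (U * r)) = h ^ 2 / 2 * U ^ 2 * r by ring, hU2]
      field_simp
    rw [e1, abs_le, ← hs2]
    constructor <;> nlinarith

lemma logPar_pos (hp0 : 0 < p) (hp1 : p ≤ 1) : 0 < logPar p :=
  Real.log_pos (by rw [lt_div_iff₀ hp0]; linarith)

lemma mul_logPar_le (hp0 : 0 < p) : p * logPar p ≤ 16 := by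
  have h1 : logPar p ≤ 16 / p := (Real.log_le_sub_one_of_pos (by positivity)).trans (by linarith)
  calc p * logPar p ≤ p * (16 / p) := by gcongr
    _ = 16 := by field_simp

lemma ellK_estimate (hp0 : 0 < p) (hp1 : p ≤ 1) :
    |ellK p - (1 + p / 4) * (logPar p / 2)| ≤ 2 * p := by
  have h1 := ellK_estimate_arsinh hp0 hp1 rfl
  obtain ⟨h2, h3⟩ := arsinh_estimate hp0 hp1 rfl
  set U := 1 / √√p
  have hs1 : √p ≤ 1 := Real.sqrt_le_one.2 hp1
  have hs0 := Real.sqrt_nonneg p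
  have h4 : |(1 + p / 4) * (2 * Real.arsinh U - (logPar p / 2 + √p / 2))| ≤ 5 / 4 * (p / 4) := by
    rw [abs_mul, abs_of_pos (by positivity)]
    gcongr
    linarith
  have h5 : p / 4 * (√p / 2) ≤ p / 4 * (1 / 2) := by gcongr
  have h6 : 0 ≤ p / 4 * (√p / 2) := by positivity
  rw [abs_le] at *
  constructor <;> nlinarith

/-- The half period ratio equals `log (16 / p)` up to `O(p)`: there is no term `p log p`. -/
lemma ratio_estimate (hp0 : 0 < p) (hp1 : p ≤ 1 / 2) :
    |Real.pi * ellK p / ellKc p - logPar p| ≤ 40 * p := by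
  have hpi := Real.pi_pos
  have hpi3 := Real.pi_gt_three
  have hpi4 := Real.pi_le_four
  have h1 := ellK_estimate hp0 (by linarith)
  have h2 := ellKc_estimate hp0.le hp1
  have h3 := pi_div_two_le_ellKc hp0.le hp1
  have h4 : 0 < ellKc p := by linarith
  have h5 := mul_logPar_le hp0
  have h6 := logPar_pos hp0 (by linarith)
  -- Both integrals carry the factor `1 + p/4` at first order, so in `π K - L K'` (`K = ellK p`, `K'
  -- = ellKc p`) it drops out. What remains is `8p + 32p`, from `h7` and `h8`.
  rw [div_sub' h4.ne', abs_div, abs_of_pos h4, div_le_iff₀ h4]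
  have h7 : |Real.pi * (ellK p - (1 + p / 4) * (logPar p / 2))| ≤ 4 * (2 * p) := by
    rw [abs_mul, abs_of_pos hpi]
    gcongr
  have h8 : |logPar p * (ellKc p - Real.pi / 2 * (1 + p / 4))| ≤ 32 * p := by
    rw [abs_mul, abs_of_pos h6]
    calc logPar p * |ellKc p - Real.pi / 2 * (1 + p / 4)| ≤ logPar p * (2 * p ^ 2) := by gcongr
      _ = 2 * p * (p * logPar p) := by ring
      _ ≤ 2 * p * 16 := by gcongr
      _ = 32 * p := by ring
  have h9 : 40 * p ≤ 40 * p * ellKc p := by nlinarith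
  rw [abs_le] at *
  constructor <;> nlinarith

end

/-! ### The system for `(d, μ)` and its parametrization by `p` -/

/-- The weight of the first equation of the system, for `c = 1` and `d² = 1 - p`. -/
def whithamWeight (p l : ℝ) : ℝ := √((1 - l ^ 2) / (1 - (1 - p) * l ^ 2))

/-- The moments of the weight of the first equation. -/
def whithamMoment (n : ℕ) (p : ℝ) : ℝ := ∫ l in (0 : ℝ)..1, l ^ n * whithamWeight p l

section

variable {c p : ℝ}

lemma whithamWeight_nonneg (p l : ℝ) : 0 ≤ whithamWeight p l := Real.sqrt_nonneg _

lemma whithamWeight_le_one (hp : 0 ≤ p) {l : ℝ} (hl : l ∈ Icc (0 : ℝ) 1) :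
    whithamWeight p l ≤ 1 := by
  have h1 : l ^ 2 ≤ 1 := pow_le_one₀ hl.1 hl.2
  rw [whithamWeight, Real.sqrt_le_one]
  refine div_le_one_of_le₀ ?_ ?_ <;> nlinarith [sq_nonneg l]

lemma whithamWeight_pos (hp : 0 ≤ p) {l : ℝ} (hl : l ∈ Ioo (0 : ℝ) 1) :
    0 < whithamWeight p l := by
  have h1 : l ^ 2 < 1 := pow_lt_one₀ hl.1.le hl.2 two_ne_zero
  refine Real.sqrt_pos.2 (div_pos (by linarith) (by nlinarith [sq_nonneg l]))

lemma measurable_whithamWeight (p : ℝ) : Measurable (whithamWeight p) := by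
  unfold whithamWeight
  fun_prop

lemma norm_pow_mul_whithamWeight_le (n : ℕ) (hp : 0 ≤ p) {l : ℝ} (hl : l ∈ Icc (0 : ℝ) 1) :
    ‖l ^ n * whithamWeight p l‖ ≤ 1 := by
  rw [Real.norm_of_nonneg (mul_nonneg (pow_nonneg hl.1 n) (whithamWeight_nonneg p l))]
  exact mul_le_one₀ (pow_le_one₀ hl.1 hl.2) (whithamWeight_nonneg p l) (whithamWeight_le_one hp hl)

lemma intervalIntegrable_whithamWeight (n : ℕ) (hp : 0 ≤ p) :
    IntervalIntegrable (fun l => l ^ n * whithamWeight p l) volume 0 1 := by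
  refine (intervalIntegrable_const (c := (1 : ℝ))).mono_fun
    (((measurable_id.pow_const n).mul (measurable_whithamWeight p)).aestronglyMeasurable) ?_
  refine (ae_restrict_iff' measurableSet_uIoc).2 (ae_of_all _ fun l hl => ?_)
  rw [uIoc_of_le zero_le_one] at hl
  simpa using norm_pow_mul_whithamWeight_le n hp (Ioc_subset_Icc_self hl)

lemma whithamMoment_pos (hp : 0 ≤ p) (n : ℕ) : 0 < whithamMoment n p :=
  intervalIntegral.intervalIntegral_pos_of_pos_on (intervalIntegrable_whithamWeight n hp)
    (fun _ hl => mul_pos (pow_pos hl.1 n) (whithamWeight_pos hp hl)) zero_lt_one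

/-- Dominated convergence with bound 1. The end point `p = 0` is included for the intermediate value
argument; there the denominator of the weight vanishes at `l = 1`, a null set. -/
lemma continuousOn_whithamMoment (n : ℕ) : ContinuousOn (whithamMoment n) (Icc 0 1) := by
  intro p₀ hp₀
  refine intervalIntegral.continuousWithinAt_of_dominated_interval (bound := fun _ => 1) ?_ ?_
    intervalIntegrable_const ?_
  · exact Eventually.of_forall fun p =>
      ((measurable_id.pow_const n).mul (measurable_whithamWeight p)).aestronglyMeasurable
  · filter_upwards [self_mem_nhdsWithin] with p hp
    refine ae_of_all _ fun l hl => ?_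
    rw [uIoc_of_le zero_le_one] at hl
    exact norm_pow_mul_whithamWeight_le n hp.1 (Ioc_subset_Icc_self hl)
  · have h1 : ∀ᵐ l : ℝ ∂volume, l ≠ 1 := by
      simp [ae_iff]
    filter_upwards [h1] with l hl1 hl
    rw [uIoc_of_le zero_le_one] at hl
    have hl2 : l ^ 2 < 1 := pow_lt_one₀ hl.1.le (lt_of_le_of_ne hl.2 hl1) two_ne_zero
    refine ContinuousAt.continuousWithinAt ?_
    unfold whithamWeight
    refine continuousAt_const.mul (Real.continuous_sqrt.continuousAt.comp ?_)
    refine continuousAt_const.div (by fun_prop) ?_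
    have := hp₀.1
    nlinarith [sq_nonneg l]

lemma whithamMoment_zero_param (n : ℕ) : whithamMoment n 0 = 1 / (n + 1) := by
  have : whithamMoment n 0 = ∫ l in (0 : ℝ)..1, l ^ n := by
    refine intervalIntegral.integral_congr_Ioo_of_le zero_le_one fun l hl => ?_
    have h1 : l ^ 2 < 1 := pow_lt_one₀ hl.1.le hl.2 two_ne_zero
    have h2 : 1 - l ^ 2 ≠ 0 := by linarith
    simp [whithamWeight, div_self h2]
  rw [this, integral_pow]
  simp

lemma firstEq_iff (hc : 0 < c) (hp0 : 0 ≤ p) (hp1 : p ≤ 1) (μ : ℝ) :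
    FirstEq c (c * √(1 - p)) μ
      ↔ μ ^ 2 * whithamMoment 0 p = c ^ 2 * (1 - p) * whithamMoment 2 p := by
  have h : ∫ l in (0 : ℝ)..1, (μ ^ 2 - l ^ 2 * (c * √(1 - p)) ^ 2)
      * √((1 - l ^ 2) / (c ^ 2 - l ^ 2 * (c * √(1 - p)) ^ 2))
      = (μ ^ 2 * whithamMoment 0 p - c ^ 2 * (1 - p) * whithamMoment 2 p) / c := by
    rw [whithamMoment, whithamMoment, ← intervalIntegral.integral_const_mul,
      ← intervalIntegral.integral_const_mul, ← intervalIntegral.integral_sub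
        ((intervalIntegrable_whithamWeight 0 hp0).const_mul _)
        ((intervalIntegrable_whithamWeight 2 hp0).const_mul _), ← intervalIntegral.integral_div]
    refine intervalIntegral.integral_congr fun l _ => ?_
    have h1 : (c * √(1 - p)) ^ 2 = c ^ 2 * (1 - p) := by
      rw [mul_pow, Real.sq_sqrt (by linarith)]
    have h2 : √((1 - l ^ 2) / (c ^ 2 - l ^ 2 * (c ^ 2 * (1 - p)))) = whithamWeight p l / c := by
      rw [whithamWeight, show c ^ 2 - l ^ 2 * (c ^ 2 * (1 - p)) = (1 - (1 - p) * l ^ 2) * c ^ 2 by ring,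
        ← div_div, Real.sqrt_div' _ (sq_nonneg c), Real.sqrt_sq hc.le]
    simp only [h1, h2]
    ring
  rw [FirstEq, h, div_eq_zero_iff, or_iff_left hc.ne', sub_eq_zero]

lemma one_le_inv_sqrt_ellK_integrand (hp0 : 0 < p) (hp1 : p < 1) {l : ℝ} (hl : l ∈ Ioo (0 : ℝ) 1) :
    0 < √((1 - l ^ 2) * (1 - (1 - p) * l ^ 2)) ∧ √((1 - l ^ 2) * (1 - (1 - p) * l ^ 2)) ≤ 1 ∧
      whithamWeight p l = (1 - l ^ 2) / √((1 - l ^ 2) * (1 - (1 - p) * l ^ 2)) ∧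
      √((1 - l ^ 2) * (1 - (1 - p) * l ^ 2)) ≤ 1 - l ^ 2 + p := by
  have h0 : 0 < l ^ 2 := pow_pos hl.1 2
  have h1 : l ^ 2 < 1 := pow_lt_one₀ hl.1.le hl.2 two_ne_zero
  have hX : 0 < 1 - l ^ 2 := by linarith
  have hY : 1 - l ^ 2 ≤ 1 - (1 - p) * l ^ 2 := by nlinarith
  have hY0 : 0 < 1 - (1 - p) * l ^ 2 := by linarith
  have hY1 : 1 - (1 - p) * l ^ 2 ≤ 1 := by nlinarith
  have hY2 : 1 - (1 - p) * l ^ 2 ≤ 1 - l ^ 2 + p := by nlinarith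
  refine ⟨Real.sqrt_pos.2 (mul_pos hX hY0), ?_, ?_, ?_⟩
  · rw [Real.sqrt_le_one]
    exact mul_le_one₀ (by linarith) hY0.le hY1
  · rw [whithamWeight, Real.sqrt_div hX.le, Real.sqrt_mul hX.le]
    have := Real.sqrt_pos.2 hX
    have := Real.sqrt_pos.2 hY0
    have h2 := Real.sq_sqrt hX.le
    field_simp
    rw [h2]
  · calc √((1 - l ^ 2) * (1 - (1 - p) * l ^ 2))
        ≤ √((1 - (1 - p) * l ^ 2) * (1 - (1 - p) * l ^ 2)) := by gcongr
      _ = 1 - (1 - p) * l ^ 2 := Real.sqrt_mul_self hY0.le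
      _ ≤ _ := hY2

lemma one_le_ellK (hp0 : 0 < p) (hp1 : p < 1) : 1 ≤ ellK p := by
  have h : ∫ l in (0 : ℝ)..1, (1 : ℝ) ≤ ellK p := by
    refine intervalIntegral.integral_mono_on_of_le_Ioo zero_le_one intervalIntegrable_const
      (ellK_halves hp0).2 fun l hl => ?_
    obtain ⟨h1, h2, -, -⟩ := one_le_inv_sqrt_ellK_integrand hp0 hp1 hl
    exact (one_le_div h1).2 h2
  simpa using h

lemma whithamMoment_le_one (hp0 : 0 ≤ p) : whithamMoment 0 p ≤ 1 := by
  have h : whithamMoment 0 p ≤ ∫ l in (0 : ℝ)..1, (1 : ℝ) :=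
    intervalIntegral.integral_mono_on zero_le_one (intervalIntegrable_whithamWeight 0 hp0)
      intervalIntegrable_const fun l hl => by simpa using whithamWeight_le_one hp0 hl
  simpa using h

/-- With `s` the root in the integrand of `ellK`, the weight is `(1 - l²) / s` and `s ≤ 1 - l² + p`.
So one minus the weight is at most `p / s`. -/
lemma one_sub_whithamMoment_le (hp0 : 0 < p) (hp1 : p < 1) :
    1 - whithamMoment 0 p ≤ p * ellK p := by
  have h1 : 1 - whithamMoment 0 p = ∫ l in (0 : ℝ)..1, (1 - l ^ 0 * whithamWeight p l) := by
    rw [intervalIntegral.integral_sub intervalIntegrable_const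
      (intervalIntegrable_whithamWeight 0 hp0.le), whithamMoment]
    simp
  rw [h1, ellK, ← intervalIntegral.integral_const_mul]
  refine intervalIntegral.integral_mono_on_of_le_Ioo zero_le_one
    (intervalIntegrable_const.sub (intervalIntegrable_whithamWeight 0 hp0.le))
    ((ellK_halves hp0).2.const_mul p) fun l hl => ?_
  obtain ⟨h2, -, h3, h4⟩ := one_le_inv_sqrt_ellK_integrand hp0 hp1 hl
  rw [h3, pow_zero, one_mul, sub_le_iff_le_add, mul_one_div, ← add_div, one_le_div h2]
  linarith

/-- An integration by parts between the moments and the complete elliptic integral. -/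
lemma whithamMoment_relation (hp0 : 0 < p) (hp1 : p < 1) :
    whithamMoment 0 p - 3 * (1 - p) * whithamMoment 2 p = p * (ellK p - whithamMoment 0 p) := by
  have hint0 := intervalIntegrable_whithamWeight 0 hp0.le
  have hint2 := intervalIntegrable_whithamWeight 2 hp0.le
  have hintK := (ellK_halves hp0).2
  have hint := (hint0.sub (hint2.const_mul (3 * (1 - p)))).sub ((hintK.sub hint0).const_mul p)
  -- This primitive vanishes at both ends, and its derivative is the combination of the three
  -- integrands in `hint`.
  have h := intervalIntegral.integral_eq_sub_of_hasDerivAt_of_le zero_le_one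
    (f := fun l : ℝ => l * √((1 - l ^ 2) * (1 - (1 - p) * l ^ 2))) (by fun_prop) ?_ hint
  · rw [intervalIntegral.integral_sub (hint0.sub (hint2.const_mul (3 * (1 - p))))
      ((hintK.sub hint0).const_mul p), intervalIntegral.integral_sub hint0
      (hint2.const_mul (3 * (1 - p))), intervalIntegral.integral_const_mul,
      intervalIntegral.integral_const_mul, intervalIntegral.integral_sub hintK hint0] at h
    simp only [whithamMoment, ellK]
    norm_num at h ⊢
    linarith
  · intro l hl
    obtain ⟨h2, -, h3, -⟩ := one_le_inv_sqrt_ellK_integrand hp0 hp1 hl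
    have e1 : HasDerivAt (fun l : ℝ => (1 - l ^ 2) * (1 - (1 - p) * l ^ 2))
        (-(2 * l) * (1 - (1 - p) * l ^ 2) + (1 - l ^ 2) * (-((1 - p) * (2 * l)))) l := by
      have e2 : HasDerivAt (fun l : ℝ => 1 - l ^ 2) (-(2 * l)) l := by
        simpa using ((hasDerivAt_id l).pow 2).const_sub 1
      have e3 : HasDerivAt (fun l : ℝ => 1 - (1 - p) * l ^ 2) (-((1 - p) * (2 * l))) l := by
        simpa using (((hasDerivAt_id l).pow 2).const_mul (1 - p)).const_sub 1
      exact e2.mul e3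
    have e4 := (hasDerivAt_id l).mul (e1.sqrt (Real.sqrt_pos.1 h2).ne')
    refine e4.congr_deriv ?_
    have h4 := Real.sq_sqrt (Real.sqrt_pos.1 h2).le
    rw [h3]
    simp only [id]
    generalize √((1 - l ^ 2) * (1 - (1 - p) * l ^ 2)) = s at h2 h4
    field_simp
    rw [h4]
    ring

/-- The parametrization of the solution of the system by `p = 1 - d² / c²`. -/
theorem exists_parameter (hc : 0 < c) {x t : ℝ} (ht : 0 < t) (hx1 : -(6 * c ^ 2 * t) < x)
    (hx2 : x < 4 * c ^ 2 * t) :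
    ∃ p : ℝ, 0 < p ∧ p < 1 ∧ fFun c (x / (12 * t)) = c * √(1 - p) ∧
      muFun c (c * √(1 - p)) ^ 2 = c ^ 2 * (1 / 3 - vFun c x t / 3 + p / 2) ∧
      vFun c x t = p * (ellK p / whithamMoment 0 p + 1 / 2) := by
  set ξ := x / (12 * t) with hξ
  have hξ1 : -(c ^ 2 / 2) < ξ := by
    rw [hξ, lt_div_iff₀ (by positivity)]
    linarith
  have hξ2 : ξ < c ^ 2 / 3 := by
    rw [hξ, div_lt_iff₀ (by positivity)]
    linarith
  have hmu {p : ℝ} (hp : p ∈ Icc (0 : ℝ) 1) :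
      0 ≤ (1 - p) * whithamMoment 2 p / whithamMoment 0 p :=
    div_nonneg (mul_nonneg (by linarith [hp.2]) (whithamMoment_pos hp.1 2).le)
      (whithamMoment_pos hp.1 0).le
  have hmuFirst {p : ℝ} (hp : p ∈ Icc (0 : ℝ) 1) :
      FirstEq c (c * √(1 - p)) (c * √((1 - p) * whithamMoment 2 p / whithamMoment 0 p)) := by
    rw [firstEq_iff hc hp.1 hp.2, mul_pow, Real.sq_sqrt (hmu hp)]
    have := (whithamMoment_pos hp.1 0).ne'
    field_simp
  -- This is the second equation divided by `c²`, after elimination of `μ` by the first. Its left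
  -- side is `0` at `p = 1` and `5/6` at `p = 0`, which correspond to `ξ = -c²/2` and `ξ = c²/3`.
  obtain ⟨p₀, hp₀, hHp₀⟩ : ∃ p₀ ∈ Icc (0 : ℝ) 1,
      (1 - p₀) * whithamMoment 2 p₀ / whithamMoment 0 p₀ + (1 - p₀) / 2 = 1 / 2 + ξ / c ^ 2 := by
    refine intermediate_value_Icc' zero_le_one (f := fun p =>
      (1 - p) * whithamMoment 2 p / whithamMoment 0 p + (1 - p) / 2) ?_ ⟨?_, ?_⟩
    · refine ContinuousOn.add (ContinuousOn.div (ContinuousOn.mul (by fun_prop)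
        (continuousOn_whithamMoment 2)) (continuousOn_whithamMoment 0) fun p hp =>
        (whithamMoment_pos hp.1 0).ne') (by fun_prop)
    · have : -(1 / 2) ≤ ξ / c ^ 2 := by
        rw [le_div_iff₀ (by positivity)]
        linarith
      simp only [sub_self, zero_mul, zero_div, add_zero]
      linarith
    · have : ξ / c ^ 2 ≤ 1 / 3 := by
        rw [div_le_iff₀ (by positivity)]
        linarith
      simp only [whithamMoment_zero_param]
      norm_num
      linarith
  have hsol : ∃ d : ℝ, (0 ≤ d ∧ d ≤ c) ∧ ∃ μ : ℝ, 0 ≤ μ ∧ FirstEq c d μ ∧ SecondEq c ξ d μ := by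
    refine ⟨c * √(1 - p₀), ⟨by positivity, ?_⟩,
      c * √((1 - p₀) * whithamMoment 2 p₀ / whithamMoment 0 p₀), by positivity, hmuFirst hp₀, ?_⟩
    · have : √(1 - p₀) ≤ 1 := by rw [Real.sqrt_le_one]; linarith [hp₀.1]
      nlinarith
    · rw [SecondEq, mul_pow, mul_pow, Real.sq_sqrt (hmu hp₀), Real.sq_sqrt (by linarith [hp₀.2])]
      field_simp at hHp₀ ⊢
      linarith
  -- The choice operator returns some solution. All conclusions are derived for an arbitrary
  -- solution, so uniqueness of `d` is not needed; `μ²` is determined by `d` because the zeroth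
  -- moment is positive.
  obtain ⟨⟨hd0, hdc⟩, μ, hμ0, hμ1, hμ2⟩ := Classical.epsilon_spec hsol
  change 0 ≤ fFun c ξ at hd0
  change fFun c ξ ≤ c at hdc
  change FirstEq c (fFun c ξ) μ at hμ1
  change SecondEq c ξ (fFun c ξ) μ at hμ2
  set d := fFun c ξ with hd
  set p := 1 - (d / c) ^ 2 with hp
  have hdp : d = c * √(1 - p) := by
    rw [hp, sub_sub_cancel, Real.sqrt_sq (by positivity)]
    field_simp
  have hdc1 : d / c ≤ 1 := (div_le_one hc).2 hdc
  have hdc0 : 0 ≤ d / c := by positivity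
  have hp0 : 0 ≤ p := by
    rw [hp]
    nlinarith
  have hp1 : p ≤ 1 := by
    rw [hp]
    nlinarith
  have hd2 : d ^ 2 = c ^ 2 * (1 - p) := by
    rw [hdp, mul_pow, Real.sq_sqrt (by linarith)]
  rw [hdp, firstEq_iff hc hp0 hp1] at hμ1
  rw [SecondEq, hd2] at hμ2
  have hI0 := whithamMoment_pos hp0 0
  have hmu' : 0 ≤ muFun c d ∧ FirstEq c d (muFun c d) :=
    Classical.epsilon_spec (p := fun μ : ℝ => 0 ≤ μ ∧ FirstEq c d μ)
      ⟨_, by positivity, hdp ▸ hmuFirst ⟨hp0, hp1⟩⟩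
  have hmueq : muFun c d ^ 2 = μ ^ 2 := by
    have h1 := hmu'.2
    rw [hdp, firstEq_iff hc hp0 hp1, ← hdp] at h1
    exact mul_right_cancel₀ hI0.ne' (h1.trans hμ1.symm)
  have hv : vFun c x t = 1 - 3 * ξ / c ^ 2 := by
    rw [vFun, hξ]
    field_simp
    ring
  have hv0 : 0 < vFun c x t := by
    rw [hv, sub_pos, div_lt_one (by positivity)]
    linarith
  have hμv : μ ^ 2 = c ^ 2 * (1 / 3 - vFun c x t / 3 + p / 2) := by
    rw [hv]
    field_simp
    linarith
  have hp1' : p ≠ 1 := by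
    intro h
    rw [h, sub_self, mul_zero, zero_mul] at hμ1
    have := (mul_eq_zero.1 hμ1).resolve_right (h ▸ hI0.ne')
    rw [this, h] at hμ2
    linarith
  have hp0' : p ≠ 0 := by
    intro h
    rw [h, whithamMoment_zero_param, whithamMoment_zero_param] at hμ1
    rw [h] at hμv
    norm_num at hμ1 hμv
    have : c ^ 2 * vFun c x t = 0 := by linarith
    have : 0 < c ^ 2 * vFun c x t := by positivity
    linarith
  have hp0'' : 0 < p := lt_of_le_of_ne hp0 (Ne.symm hp0')
  have hp1'' : p < 1 := lt_of_le_of_ne hp1 hp1'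
  refine ⟨p, hp0'', hp1'', hdp, by rw [← hdp, hmueq, hμv], ?_⟩
  -- Expressing the second moment through the zeroth one and `ellK` makes the first equation linear
  -- in `v`, and it can be solved for `v`.
  have hrel := whithamMoment_relation hp0'' hp1''
  rw [hμv, mul_assoc, mul_assoc] at hμ1
  have h2 := mul_left_cancel₀ (by positivity) hμ1
  field_simp
  linarith

end

/-! ### Expansions of `v` and `B_g` -/

lemma abs_log_le_two_mul {x : ℝ} (hx : |x - 1| ≤ 1 / 2) : |Real.log x| ≤ 2 * |x - 1| := by
  have h := abs_le.1 hx
  have hx0 : 0 < x := by linarith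
  have h1 := Real.log_le_sub_one_of_pos hx0
  have h2 := Real.one_sub_inv_le_log_of_pos hx0
  have h3 : 1 - x⁻¹ = (x - 1) / x := by field_simp
  have h4 : -(2 * |x - 1|) ≤ (x - 1) / x := by
    rw [le_div_iff₀ hx0]
    have := neg_abs_le (x - 1)
    nlinarith [abs_nonneg (x - 1)]
  rw [abs_le]
  constructor
  · linarith
  · linarith [le_abs_self (x - 1), abs_nonneg (x - 1)]

section

variable {c p v : ℝ}

lemma mul_logPar_le_sqrt (hp0 : 0 < p) : p * logPar p ≤ 8 * √p := by
  have hs : 0 < √p := Real.sqrt_pos.2 hp0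
  have hs2 : √p ^ 2 = p := Real.sq_sqrt hp0.le
  have h1 : logPar p = 2 * Real.log (4 / √p) := by
    rw [logPar, ← Real.log_rpow (by positivity)]
    congr 1
    rw [Real.rpow_ofNat, div_pow, hs2]
    norm_num
  have h2 : Real.log (4 / √p) ≤ 4 / √p :=
    (Real.log_le_sub_one_of_pos (by positivity)).trans (by linarith)
  calc p * logPar p = √p ^ 2 * (2 * Real.log (4 / √p)) := by rw [h1, hs2]
    _ ≤ √p ^ 2 * (2 * (4 / √p)) := by gcongr
    _ = 8 * √p := by
      field_simp
      norm_num

lemma mul_logPar_le_half (hp0 : 0 < p) (hp1 : p ≤ 1 / 256) : p * logPar p ≤ 1 / 2 := by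
  have h1 := mul_logPar_le_sqrt hp0
  have h2 : √p ≤ 1 / 16 := by
    rw [Real.sqrt_le_left (by norm_num)]
    norm_num
    linarith
  linarith

lemma two_le_logPar (hp0 : 0 < p) (hp1 : p ≤ 1) : 2 ≤ logPar p := by
  rw [logPar, Real.le_log_iff_exp_le (by positivity)]
  have h1 : Real.exp 2 ≤ 16 := by
    rw [show (2 : ℝ) = 1 + 1 by norm_num, Real.exp_add]
    have := Real.exp_one_lt_d9
    have := Real.exp_pos 1
    nlinarith
  refine h1.trans ?_
  rw [le_div_iff₀ hp0]
  linarith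

/-- The asymptotics of `v` in terms of the parameter `p`. -/
lemma v_estimate (hp0 : 0 < p) (hp1 : p ≤ 1 / 256) :
    |p * (ellK p / whithamMoment 0 p + 1 / 2) - p * (logPar p + 1) / 2|
      ≤ 4 * p ^ 2 * logPar p ^ 2 := by
  have hL := two_le_logPar hp0 (by linarith)
  have hpL := mul_logPar_le_half hp0 hp1
  have hK := abs_le.1 (ellK_estimate hp0 (by linarith))
  have hK1 := one_le_ellK hp0 (by linarith)
  have hKL : ellK p ≤ logPar p := by nlinarith
  have hI1 := whithamMoment_le_one hp0.le
  have hI2 := one_sub_whithamMoment_le hp0 (by linarith)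
  have hI3 : 1 / 2 ≤ whithamMoment 0 p := by nlinarith
  have h1 : ellK p / whithamMoment 0 p - ellK p ≤ 2 * p * ellK p ^ 2 := by
    rw [sub_le_iff_le_add, div_le_iff₀ (by linarith)]
    have h2 : 0 ≤ p * ellK p ^ 2 * (2 * whithamMoment 0 p - 1) :=
      mul_nonneg (by positivity) (by linarith)
    have h3 : ellK p * (1 - whithamMoment 0 p) ≤ ellK p * (p * ellK p) := by gcongr
    nlinarith
  have h0 : ellK p ≤ ellK p / whithamMoment 0 p := by
    rw [le_div_iff₀ (by linarith)]
    nlinarith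
  have h2 : ellK p ^ 2 ≤ logPar p ^ 2 := by gcongr
  have h3 : p * ellK p ^ 2 ≤ p * logPar p ^ 2 := by gcongr
  have h4 : p * (2 * logPar p) ≤ p * logPar p ^ 2 := by
    have : 2 * logPar p ≤ logPar p ^ 2 := by nlinarith
    gcongr
  have h5 : p * 4 ≤ p * (2 * logPar p) := by
    have : 4 ≤ 2 * logPar p := by linarith
    gcongr
  have h6 : |ellK p / whithamMoment 0 p + 1 / 2 - (logPar p + 1) / 2| ≤ 4 * p * logPar p ^ 2 := by
    rw [abs_le]
    constructor <;> nlinarith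
  rw [mul_div_assoc, ← mul_sub, abs_mul, abs_of_pos hp0]
  calc p * |ellK p / whithamMoment 0 p + 1 / 2 - (logPar p + 1) / 2|
      ≤ p * (4 * p * logPar p ^ 2) := by gcongr
    _ = _ := by ring

lemma p_le_v (hp0 : 0 < p) (hp1 : p < 1) : p ≤ p * (ellK p / whithamMoment 0 p + 1 / 2) := by
  have hK1 := one_le_ellK hp0 hp1
  have hI1 := whithamMoment_le_one hp0.le
  have hI0 := whithamMoment_pos hp0.le 0
  have : 1 ≤ ellK p / whithamMoment 0 p := by
    rw [le_div_iff₀ hI0]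
    linarith
  nlinarith

lemma integral_cos_sq_half : ∫ θ in (0 : ℝ)..(Real.pi / 2), Real.cos θ ^ 2 = Real.pi / 4 := by
  rw [integral_cos_sq]
  simp
  ring

/-- The asymptotics of `B_g` in terms of the parameter `p`. -/
lemma bg_estimate (hc : 0 < c) (hp0 : 0 < p) (hp1 : p ≤ 1 / 2) (hpv : p ≤ v) (hv : v ≤ 1)
    (hmu : muFun c (c * √(1 - p)) ^ 2 = c ^ 2 * (1 / 3 - v / 3 + p / 2)) :
    |bgReal c (c * √(1 - p)) - 4 * Real.pi * c ^ 3 * p| ≤ 240 * c ^ 3 * (p * v) := by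
  have hpi := Real.pi_pos
  have hpi4 := Real.pi_le_four
  have hcont := continuous_inv_ampl hp0.le (by linarith : p < 1)
  set F : ℝ → ℝ := fun θ =>
    Real.cos θ ^ 2 * ((2 / 3 + v / 3 - p / 2 - p * Real.sin θ ^ 2) * (1 / ampl p θ)) with hF
  have hFc : Continuous F := by fun_prop
  have e1 : bgReal c (c * √(1 - p)) = 24 * c ^ 3 * p * ∫ θ in (0 : ℝ)..(Real.pi / 2), F θ := by
    rw [bgReal, gapInt_eq hc hp0 (by linarith), ← intervalIntegral.integral_div,
      ← intervalIntegral.integral_const_mul, ← intervalIntegral.integral_const_mul]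
    refine intervalIntegral.integral_congr fun θ _ => ?_
    have h1 := ampl_sq hp0.le (by linarith : p < 1) θ
    have h2 : (c * √(1 - p)) ^ 2 = c ^ 2 * (1 - p) := by
      rw [mul_pow, Real.sq_sqrt (by linarith)]
    have h3 := Real.sin_sq_add_cos_sq θ
    have h4 : Real.cos θ ^ 2 = 1 - Real.sin θ ^ 2 := by linarith
    have h5 := (ampl_pos hp0.le (by linarith : p < 1) θ).ne'
    simp only [hF]
    rw [hmu, h2, mul_pow, h1, h4]
    field_simp
    ring
  -- At leading order `F` is `(2/3) cos² θ`, with integral `π/6`; times `24 c³ p` this is `4π c³ p`.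
  -- The corrections are `O(p)` or `O(v)`, hence `O(v)` since `p ≤ v`.
  have e2 : |(∫ θ in (0 : ℝ)..(Real.pi / 2), F θ) - Real.pi / 6| ≤ 10 * v := by
    have h1 : (∫ θ in (0 : ℝ)..(Real.pi / 2), F θ) - Real.pi / 6
        = ∫ θ in (0 : ℝ)..(Real.pi / 2), (F θ - 2 / 3 * Real.cos θ ^ 2) := by
      rw [intervalIntegral.integral_sub (hFc.intervalIntegrable _ _)
        (Continuous.intervalIntegrable (by fun_prop) _ _), intervalIntegral.integral_const_mul,
        integral_cos_sq_half]
      ring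
    rw [h1]
    have h2 : ∀ θ ∈ uIoc 0 (Real.pi / 2), ‖F θ - 2 / 3 * Real.cos θ ^ 2‖ ≤ 5 * v := by
      intro θ _
      have a1 := one_le_inv_ampl hp0.le hp1 θ
      have a2 := inv_ampl_le hp0.le hp1 θ
      have a3 := Real.cos_sq_le_one θ
      have a4 := Real.sin_sq_le_one θ
      have a5 : 0 ≤ p * Real.sin θ ^ 2 := by positivity
      have a6 : p * Real.sin θ ^ 2 ≤ p := by nlinarith
      set e := v / 3 - p / 2 - p * Real.sin θ ^ 2 with he
      have he1 : |e| ≤ 2 * v := by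
        rw [abs_le]
        constructor <;> linarith
      have e3 : F θ - 2 / 3 * Real.cos θ ^ 2
          = Real.cos θ ^ 2 * (e + (2 / 3 + e) * (1 / ampl p θ - 1)) := by
        rw [hF]
        ring
      rw [e3, norm_mul, Real.norm_of_nonneg (sq_nonneg _), Real.norm_eq_abs]
      have h3 : |e + (2 / 3 + e) * (1 / ampl p θ - 1)| ≤ 5 * v := by
        have h4 : |2 / 3 + e| ≤ 3 := by
          refine (abs_add_le _ _).trans ?_
          rw [abs_of_pos (by norm_num : (0 : ℝ) < 2 / 3)]
          linarith
        have h5 : |1 / ampl p θ - 1| ≤ v := by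
          rw [abs_of_nonneg (by linarith)]
          linarith
        calc |e + (2 / 3 + e) * (1 / ampl p θ - 1)|
            ≤ |e| + |2 / 3 + e| * |1 / ampl p θ - 1| := by
              rw [← abs_mul]
              exact abs_add_le _ _
          _ ≤ 2 * v + 3 * v := by gcongr
          _ = 5 * v := by ring
      calc Real.cos θ ^ 2 * |e + (2 / 3 + e) * (1 / ampl p θ - 1)| ≤ 1 * (5 * v) := by gcongr
        _ = 5 * v := one_mul _
    refine (intervalIntegral.norm_integral_le_of_norm_le_const h2).trans ?_
    rw [sub_zero, abs_of_pos (by positivity)]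
    nlinarith
  have e3 : bgReal c (c * √(1 - p)) - 4 * Real.pi * c ^ 3 * p
      = 24 * c ^ 3 * p * ((∫ θ in (0 : ℝ)..(Real.pi / 2), F θ) - Real.pi / 6) := by
    rw [e1]
    ring
  rw [e3, abs_mul, abs_of_pos (by positivity)]
  calc 24 * c ^ 3 * p * |(∫ θ in (0 : ℝ)..(Real.pi / 2), F θ) - Real.pi / 6|
      ≤ 24 * c ^ 3 * p * (10 * v) := by gcongr
    _ = _ := by ring

end

/-! ### The singularity of `a` at `ic` and the expansion of `Δ` -/

section Spectral

variable {c h₁ : ℝ} {a : ℂ → ℂ}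

/-- The singularity of `a` at `ic`, transferred to the boundary values. -/
lemma IsSpectralFunction.norm_bdryPlus_estimate (ha : IsSpectralFunction c h₁ a) :
    ∃ C ε : ℝ, 0 < C ∧ 0 < ε ∧ ∀ y : ℝ, 0 < y → c - ε < y → y < c →
      |‖bdryPlus a (Complex.I * y)‖ - |h₁| / 2 * ((c + y) / (c - y)) ^ (1 / 4 : ℝ)|
        ≤ |h₁| / 2 * ((c + y) / (c - y)) ^ (1 / 4 : ℝ)
          * (C * ((c - y) / (c + y)) ^ (1 / 2 : ℝ)) := by
  obtain ⟨r, hr, hO⟩ := ha.singularity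
  obtain ⟨C, hC, hO⟩ := hO.exists_pos
  rw [IsBigOWith, eventually_nhdsWithin_iff, Metric.eventually_nhds_iff] at hO
  obtain ⟨ε, hε, hO⟩ := hO
  refine ⟨C, ε, hC, hε, fun y hy0 hyε hyc => ?_⟩
  set l := 𝓝[{k : ℂ | 0 < k.re}] (Complex.I * (y : ℂ)) with hl
  have hball : ∀ᶠ k in l, dist k (Complex.I * (c : ℂ)) < ε := by
    refine nhdsWithin_le_nhds ((Metric.isOpen_ball (x := Complex.I * (c : ℂ)) (ε := ε)).mem_nhds ?_)
    rw [Metric.mem_ball, dist_eq_norm, ← mul_sub, norm_mul, Complex.norm_I, one_mul,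
      ← Complex.ofReal_sub, Complex.norm_real, Real.norm_eq_abs, abs_lt]
    constructor <;> linarith
  have hsum (s : ℂ → ℂ) (hs : Continuous s) : Tendsto s l (𝓝 (s (Complex.I * (y : ℂ)))) :=
    (hs.tendsto _).mono_left nhdsWithin_le_nhds
  have h1 : ‖Complex.I * (y : ℂ) + Complex.I * (c : ℂ)‖ = c + y := by
    rw [← mul_add, norm_mul, Complex.norm_I, one_mul, ← Complex.ofReal_add, Complex.norm_real,
      Real.norm_of_nonneg (by linarith)]
    ring
  have h2 : ‖Complex.I * (y : ℂ) - Complex.I * (c : ℂ)‖ = c - y := by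
    rw [← mul_sub, norm_mul, Complex.norm_I, one_mul, ← Complex.ofReal_sub, Complex.norm_real,
      Real.norm_eq_abs, abs_sub_comm, abs_of_pos (by linarith)]
  have hN : Tendsto (fun k : ℂ => ‖k + Complex.I * (c : ℂ)‖) l (𝓝 (c + y)) := by
    rw [← h1]
    exact (hsum (fun k => k + Complex.I * (c : ℂ)) (by fun_prop)).norm
  have hD : Tendsto (fun k : ℂ => ‖k - Complex.I * (c : ℂ)‖) l (𝓝 (c - y)) := by
    rw [← h2]
    exact (hsum (fun k => k - Complex.I * (c : ℂ)) (by fun_prop)).norm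
  have hcy1 : 0 < c - y := by linarith
  have hcy2 : 0 < c + y := by linarith
  have hQ := ((hN.div hD hcy1.ne').rpow_const (p := (1 / 4 : ℝ))
    (Or.inr (by norm_num))).const_mul (|h₁| / 2)
  have hR := ((hD.div hN hcy2.ne').rpow_const (p := (1 / 2 : ℝ))
    (Or.inr (by norm_num))).const_mul C
  -- The inequality is proved off the cut and passed to the limit. In absolute values the branches
  -- of the fractional powers play no role.
  refine le_of_tendsto_of_tendsto (((ha.tendsto_right hy0 hyc).norm.sub hQ).abs) (hQ.mul hR) ?_
  filter_upwards [hball, eventually_mem_slitUpper_right (c := c) hy0] with k hk1 hk2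
  have h3 : ‖a k‖ = |h₁| / 2 * (‖k + Complex.I * (c : ℂ)‖ / ‖k - Complex.I * (c : ℂ)‖) ^ (1 / 4 : ℝ)
      * ‖1 + r k‖ := by
    rw [hr k hk2, norm_mul, norm_mul, show (1 / 4 : ℂ) = ((1 / 4 : ℝ) : ℂ) by push_cast; rfl,
      Complex.norm_cpow_real, norm_div, norm_div, Complex.norm_real, Real.norm_eq_abs]
    norm_num
  have h4 := hO hk1 hk2
  rw [show (1 / 2 : ℂ) = ((1 / 2 : ℝ) : ℂ) by push_cast; rfl, Complex.norm_cpow_real,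
    norm_div] at h4
  simp only [Pi.div_apply]
  rw [h3, ← mul_sub_one, abs_mul, abs_of_nonneg (by positivity)]
  gcongr
  have h5 := abs_norm_sub_norm_le (1 + r k) 1
  rw [norm_one, add_sub_cancel_left] at h5
  exact h5.trans h4

lemma IsSpectralFunction.logBdry_estimate (ha : IsSpectralFunction c h₁ a) (hc : 0 < c) :
    ∃ C ε : ℝ, 0 < C ∧ 0 < ε ∧ ε < 1 ∧ ∀ s : ℝ, 0 < s → 1 - ε ≤ s → s < 1 →
      |logBdry a (c * s) - (Real.log (h₁ ^ 2 / 4) + 1 / 2 * Real.log ((1 + s) / (1 - s)))|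
        ≤ C * √(1 - s) := by
  obtain ⟨C, ε, hC, hε, h⟩ := ha.norm_bdryPlus_estimate
  have hh := ha.ne_zero
  -- The bound `ε / (2c)` keeps `c s` in the range of the previous estimate, and `1 / (4C²)` makes
  -- the relative error at most `1/2`, as `abs_log_le_two_mul` requires.
  refine ⟨4 * C, min (1 / 2) (min (ε / (2 * c)) (1 / (4 * C ^ 2))), by positivity, by positivity,
    (min_le_left _ _).trans_lt (by norm_num), fun s hs0 hsε hs1 => ?_⟩
  have hs2 : 1 - s ≤ ε / (2 * c) := by
    have := (min_le_right (1 / 2) (min (ε / (2 * c)) (1 / (4 * C ^ 2)))).trans (min_le_left _ _)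
    linarith
  have hs3 : 1 - s ≤ 1 / (4 * C ^ 2) := by
    have := (min_le_right (1 / 2) (min (ε / (2 * c)) (1 / (4 * C ^ 2)))).trans (min_le_right _ _)
    linarith
  have h1s : 0 < 1 - s := by linarith
  rw [le_div_iff₀ (by positivity)] at hs2 hs3
  have hb := h (c * s) (by positivity) (by nlinarith) (by nlinarith)
  have hq1 : (c + c * s) / (c - c * s) = (1 + s) / (1 - s) := by
    rw [show c + c * s = c * (1 + s) by ring, show c - c * s = c * (1 - s) by ring,
      mul_div_mul_left _ _ hc.ne']
  have hq2 : (c - c * s) / (c + c * s) = (1 - s) / (1 + s) := by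
    rw [show c + c * s = c * (1 + s) by ring, show c - c * s = c * (1 - s) by ring,
      mul_div_mul_left _ _ hc.ne']
  rw [hq1, hq2] at hb
  set Q := (1 + s) / (1 - s) with hQ
  have hQ0 : 0 < Q := by positivity
  set B := |h₁| / 2 * Q ^ (1 / 4 : ℝ) with hB
  have hB0 : 0 < B := by positivity
  set N := ‖bdryPlus a (Complex.I * ((c * s : ℝ) : ℂ))‖ with hN
  have hN0 : 0 < N := norm_pos_iff.2 (ha.bdryPlus_ne_zero (by positivity) (by nlinarith))
  have hδ : C * ((1 - s) / (1 + s)) ^ (1 / 2 : ℝ) ≤ C * √(1 - s) := by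
    rw [← Real.sqrt_eq_rpow]
    gcongr
    exact div_le_self h1s.le (by linarith)
  have hδ2 : C * √(1 - s) ≤ 1 / 2 := by
    refine abs_le_of_sq_le_sq' ?_ (by norm_num) |>.2
    rw [mul_pow, Real.sq_sqrt h1s.le]
    linarith
  have hX : |N / B - 1| ≤ C * √(1 - s) := by
    rw [div_sub_one hB0.ne', abs_div, abs_of_pos hB0, div_le_iff₀ hB0]
    refine hb.trans ?_
    rw [mul_comm B]
    gcongr
  have hlog := abs_log_le_two_mul (hX.trans hδ2)
  have e1 : logBdry a (c * s) - (Real.log (h₁ ^ 2 / 4) + 1 / 2 * Real.log Q)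
      = 2 * Real.log (N / B) := by
    rw [logBdry, Complex.normSq_eq_norm_sq, ← hN, Real.log_pow, Real.log_div hN0.ne' hB0.ne', hB,
      Real.log_mul (by positivity) (by positivity), Real.log_rpow hQ0,
      show h₁ ^ 2 / 4 = (|h₁| / 2) ^ 2 by rw [div_pow, sq_abs]; norm_num, Real.log_pow]
    push_cast
    ring
  rw [e1, abs_mul, abs_two]
  linarith

/-- The boundary value is the pointwise limit of `a` at points moved by `1/(n + 1)` to the right,
where `a` is continuous. -/
lemma IsSpectralFunction.aestronglyMeasurable_logBdry (ha : IsSpectralFunction c h₁ a) {g : ℝ → ℝ}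
    {s : Set ℝ} (hs : MeasurableSet s) (hg : ContinuousOn g s) (hg0 : ∀ θ ∈ s, 0 < g θ)
    (hgc : ∀ θ ∈ s, g θ < c) :
    AEStronglyMeasurable (fun θ => logBdry a (g θ)) (volume.restrict s) := by
  refine AEMeasurable.aestronglyMeasurable ?_
  refine aemeasurable_of_tendsto_metrizable_ae atTop (f := fun (n : ℕ) θ =>
    Real.log (Complex.normSq (a (Complex.I * (g θ : ℂ) + ((1 / ((n : ℝ) + 1) : ℝ) : ℂ))))) ?_ ?_
  · intro n
    refine Real.measurable_log.comp_aemeasurable (ContinuousOn.aemeasurable ?_ hs)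
    refine Complex.continuous_normSq.comp_continuousOn (ha.analytic.continuousOn.comp ?_ ?_)
    · exact ((continuous_const.mul Complex.continuous_ofReal).comp_continuousOn hg).add
        continuousOn_const
    · intro θ hθ
      refine ⟨by simpa using hg0 θ hθ, fun h => ?_⟩
      have h1 := h.1
      simp only [Complex.add_re, Complex.mul_re, Complex.I_re, Complex.I_im, Complex.ofReal_re,
        Complex.ofReal_im] at h1
      have : (0 : ℝ) < 1 / ((n : ℝ) + 1) := by positivity
      linarith
  · refine (ae_restrict_iff' hs).2 (ae_of_all _ fun θ hθ => ?_)
    have h1 : Tendsto (fun n : ℕ => Complex.I * (g θ : ℂ) + ((1 / ((n : ℝ) + 1) : ℝ) : ℂ)) atTop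
        (𝓝[{k : ℂ | 0 < k.re}] (Complex.I * (g θ : ℂ))) := by
      refine tendsto_nhdsWithin_iff.2 ⟨?_, Eventually.of_forall fun n => ?_⟩
      · have h2 := (Complex.continuous_ofReal.tendsto _).comp
          (tendsto_one_div_add_atTop_nhds_zero_nat (𝕜 := ℝ))
        simpa [Function.comp_def] using h2.const_add (Complex.I * (g θ : ℂ))
      · have : (0 : ℝ) < 1 / ((n : ℝ) + 1) := by positivity
        change 0 < (Complex.I * (g θ : ℂ) + ((1 / ((n : ℝ) + 1) : ℝ) : ℂ)).re
        simp only [Complex.add_re, Complex.mul_re, Complex.I_re, Complex.I_im, Complex.ofReal_re,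
          Complex.ofReal_im]
        linarith
    have h2 := (ha.tendsto_right (hg0 θ hθ) (hgc θ hθ)).comp h1
    have h3 := (Complex.continuous_normSq.tendsto _).comp h2
    have h4 : Complex.normSq (bdryPlus a (Complex.I * (g θ : ℂ))) ≠ 0 := by
      simpa using ha.bdryPlus_ne_zero (hg0 θ hθ) (hgc θ hθ)
    exact ((Real.continuousAt_log h4).tendsto).comp h3

end Spectral

/-- The mean of `log |a₊|²` over the gap. -/
def logMean (c : ℝ) (a : ℂ → ℂ) (d : ℝ) : ℝ :=
  gapInt c d (logBdry a) / gapInt c d (fun _ => 1)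

section

variable {c h₁ p : ℝ} {a : ℂ → ℂ}

/-- The band integral cancels in the product. Only a mean over the gap is left, and for small `p`
the gap lies close to `ic`, where `a` is known. -/
lemma ell_mul_deltaReal (hc : 0 < c) (hp0 : 0 < p) (hp1 : p < 1) :
    ell c (c * √(1 - p)) * deltaReal c a (c * √(1 - p))
      = -(Real.pi * logMean c a (c * √(1 - p))) := by
  have hB : bandInt c (c * √(1 - p)) ≠ 0 := by
    rw [bandInt_eq hc hp1]
    have := one_le_ellK hp0 hp1
    positivity
  rw [ell, deltaReal, logMean]
  field_simp

/-- On the gap, `log |a₊|²` is `M - log sin θ` up to `O(√p)`. -/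
lemma IsSpectralFunction.logBdry_ampl_estimate (ha : IsSpectralFunction c h₁ a) (hc : 0 < c) :
    ∃ C p₀ : ℝ, 0 < C ∧ 0 < p₀ ∧ p₀ ≤ 1 / 256 ∧ ∀ p : ℝ, 0 < p → p ≤ p₀ →
      ∀ θ ∈ Ioc 0 (Real.pi / 2), |logBdry a (c * ampl p θ)
        - (Real.log (h₁ ^ 2 / 4) + Real.log 2 - Real.log p / 2 - Real.log (Real.sin θ))|
        ≤ C * √p := by
  obtain ⟨C, ε, hC, hε, hε1, h⟩ := ha.logBdry_estimate hc
  refine ⟨C + 1, min (1 / 256) ε, by positivity, by positivity, min_le_left _ _,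
    fun p hp0 hp θ hθ => ?_⟩
  have hp1 : p ≤ 1 / 256 := hp.trans (min_le_left _ _)
  have hpε : p ≤ ε := hp.trans (min_le_right _ _)
  set s := ampl p θ with hs
  have hsin : 0 < Real.sin θ := Real.sin_pos_of_pos_of_lt_pi hθ.1 (by linarith [hθ.2, Real.pi_pos])
  have hs0 : 0 < s := ampl_pos hp0.le (by linarith) θ
  have hs2 : s ^ 2 = 1 - p * Real.sin θ ^ 2 := ampl_sq hp0.le (by linarith) θ
  have hs1 : s < 1 := by
    have : 0 < p * Real.sin θ ^ 2 := by positivity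
    nlinarith
  have hsp : 1 - p ≤ s := by
    have : p * Real.sin θ ^ 2 ≤ p := by nlinarith [Real.sin_sq_le_one θ]
    nlinarith
  have h1s : 0 < 1 - s := by linarith
  have hE := h s hs0 (by linarith) hs1
  have h2 : √(1 - s) ≤ √p := Real.sqrt_le_sqrt (by linarith)
  have h3 : p ≤ √p := by
    have := Real.sq_sqrt hp0.le
    have h4 : √p ≤ 1 := by
      rw [Real.sqrt_le_one]
      linarith
    nlinarith [Real.sqrt_nonneg p]
  -- Since `(1 - s)(1 + s) = p sin² θ`, the singularity at `s = 1` becomes `-log p - 2 log sin θ`;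
  -- the remaining factor `(1 + s)/2` is `1 + O(p)`.
  have e1 : Real.log ((1 + s) / (1 - s)) =
      2 * Real.log 2 + 2 * Real.log ((1 + s) / 2) - Real.log p - 2 * Real.log (Real.sin θ) := by
    have e2 : (1 + s) / (1 - s) = 2 ^ 2 * ((1 + s) / 2) ^ 2 / (p * Real.sin θ ^ 2) := by
      rw [show p * Real.sin θ ^ 2 = (1 - s) * (1 + s) by linarith]
      field_simp
    rw [e2, Real.log_div (by positivity) (by positivity), Real.log_mul (by positivity)
      (by positivity), Real.log_mul (by positivity) (by positivity), Real.log_pow, Real.log_pow,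
      Real.log_pow]
    push_cast
    ring
  have e3 : Real.log ((1 + s) / 2) ≤ 0 := Real.log_nonpos (by positivity) (by linarith)
  have e4 : -p ≤ Real.log ((1 + s) / 2) := by
    refine le_trans ?_ (Real.one_sub_inv_le_log_of_pos (by positivity))
    rw [inv_div, le_sub_comm, div_le_iff₀ (by positivity)]
    nlinarith
  have h5 : C * √(1 - s) ≤ C * √p := by gcongr
  rw [e1] at hE
  rw [abs_le] at hE ⊢
  constructor <;> linarith

/-- The asymptotics of the mean of `log |a₊|²`. -/
lemma IsSpectralFunction.logMean_estimate (ha : IsSpectralFunction c h₁ a) (hc : 0 < c) :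
    ∃ C p₀ : ℝ, 0 < C ∧ 0 < p₀ ∧ p₀ ≤ 1 / 256 ∧ ∀ p : ℝ, 0 < p → p ≤ p₀ →
      |logMean c a (c * √(1 - p)) - (Real.log (h₁ ^ 2 / 4) + logPar p / 2)| ≤ C * √p := by
  obtain ⟨C, p₀, hC, hp₀, hp₀1, h⟩ := ha.logBdry_ampl_estimate hc
  refine ⟨4 * C + 4, p₀, by positivity, hp₀, hp₀1, fun p hp0 hp => ?_⟩
  have hp1 : p ≤ 1 / 256 := hp.trans hp₀1
  have hpi := Real.pi_pos
  have hpi3 := Real.pi_gt_three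
  have hpi4 := Real.pi_le_four
  have hlog2 : 0 < Real.log 2 := Real.log_pos one_lt_two
  have hlog2' : Real.log 2 ≤ 1 := (Real.log_le_sub_one_of_pos two_pos).trans (by norm_num)
  have hcont := continuous_inv_ampl hp0.le (by linarith : p < 1)
  have hK1 := pi_div_two_le_ellKc hp0.le (by linarith)
  have hK2 := ellKc_le hp0.le (by linarith)
  have hK0 : 0 < ellKc p := by linarith
  set M := Real.log (h₁ ^ 2 / 4) + Real.log 2 - Real.log p / 2 with hM
  have hML : Real.log (h₁ ^ 2 / 4) + logPar p / 2 = M + Real.log 2 := by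
    rw [hM, logPar, Real.log_div (by norm_num) hp0.ne', show (16 : ℝ) = 2 ^ 4 by norm_num,
      Real.log_pow]
    push_cast
    ring
  have hsinint : IntervalIntegrable (fun θ => Real.log (Real.sin θ)) volume 0 (Real.pi / 2) :=
    intervalIntegrable_log_sin
  have hnegint : IntervalIntegrable (fun θ => p * -Real.log (Real.sin θ)) volume 0 (Real.pi / 2) :=
    hsinint.neg.const_mul p
  have hMint : IntervalIntegrable (fun θ => M * (1 / ampl p θ)) volume 0 (Real.pi / 2) :=
    (continuous_const.mul hcont).intervalIntegrable _ _
  -- The remainder after removal of `M / ampl - log sin θ`. The mean of `-log sin θ` over `[0, π/2]`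
  -- is `log 2`, which produces `M + log 2` in `hML`. Near `θ = 0` the remainder is controlled by `p
  -- |log sin θ|`, because `1 / ampl - 1 ≤ p`.
  set R : ℝ → ℝ := fun θ =>
    logBdry a (c * ampl p θ) / ampl p θ - M * (1 / ampl p θ) + Real.log (Real.sin θ) with hR
  set bnd : ℝ → ℝ := fun θ => 2 * C * √p + p * -Real.log (Real.sin θ) with hbnd
  have hbndint : IntervalIntegrable bnd volume 0 (Real.pi / 2) :=
    intervalIntegrable_const.add hnegint
  have hbound : ∀ θ ∈ Ioc 0 (Real.pi / 2), ‖R θ‖ ≤ bnd θ := by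
    intro θ hθ
    have h1 := h p hp0 hp θ hθ
    have h2 := one_le_inv_ampl hp0.le (by linarith) θ
    have h3 := inv_ampl_le hp0.le (by linarith) θ
    have h4 : Real.log (Real.sin θ) ≤ 0 := Real.log_nonpos
      (Real.sin_nonneg_of_nonneg_of_le_pi hθ.1.le (by linarith [hθ.2])) (Real.sin_le_one θ)
    set E := logBdry a (c * ampl p θ) - (M - Real.log (Real.sin θ)) with hE
    have e : R θ = E * (1 / ampl p θ) + (1 / ampl p θ - 1) * -Real.log (Real.sin θ) := by
      rw [hR, hE]
      ring
    rw [e]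
    refine (norm_add_le _ _).trans ?_
    rw [norm_mul, norm_mul, Real.norm_of_nonneg (by linarith : 0 ≤ 1 / ampl p θ),
      Real.norm_of_nonneg (by linarith : 0 ≤ 1 / ampl p θ - 1),
      Real.norm_of_nonneg (by linarith : 0 ≤ -Real.log (Real.sin θ)), Real.norm_eq_abs]
    have h5 : |E| * (1 / ampl p θ) ≤ C * √p * 2 := by
      gcongr
      linarith
    have h6 : (1 / ampl p θ - 1) * -Real.log (Real.sin θ) ≤ p * -Real.log (Real.sin θ) := by
      gcongr
      · linarith
      · linarith
    rw [hbnd]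
    linarith
  have hRint : IntervalIntegrable R volume 0 (Real.pi / 2) := by
    refine hbndint.mono_fun ?_ ?_
    · rw [uIoc_of_le (by positivity), ← restrict_Ioo_eq_restrict_Ioc]
      have hm := ha.aestronglyMeasurable_logBdry (g := fun θ => c * ampl p θ) measurableSet_Ioo
        (s := Ioo 0 (Real.pi / 2))
        (by have := continuous_ampl p; fun_prop)
        (fun θ _ => mul_pos hc (ampl_pos hp0.le (by linarith) θ)) ?_
      · refine AEStronglyMeasurable.add (AEStronglyMeasurable.sub (hm.div₀ ?_) ?_) ?_
        · exact (continuous_ampl p).aestronglyMeasurable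
        · exact (continuous_const.mul hcont).aestronglyMeasurable
        · exact (Real.measurable_log.comp Real.measurable_sin).aestronglyMeasurable
      · intro θ hθ
        have h1 := Real.sin_pos_of_pos_of_lt_pi hθ.1 (by linarith [hθ.2])
        have h2 := ampl_sq hp0.le (by linarith : p < 1) θ
        have h3 := ampl_pos hp0.le (by linarith : p < 1) θ
        have h4 : 0 < p * Real.sin θ ^ 2 := by positivity
        have h5 : ampl p θ < 1 := by nlinarith
        nlinarith
    · refine (ae_restrict_iff' measurableSet_uIoc).2 (ae_of_all _ fun θ hθ => ?_)
      rw [uIoc_of_le (by positivity)] at hθ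
      exact (hbound θ hθ).trans (le_abs_self _)
  have hRle : |∫ θ in (0 : ℝ)..(Real.pi / 2), R θ| ≤ 4 * C * √p + 2 * p := by
    have h1 := intervalIntegral.norm_integral_le_of_norm_le (by positivity : 0 ≤ Real.pi / 2)
      (ae_of_all _ hbound) hbndint
    refine h1.trans ?_
    rw [hbnd, intervalIntegral.integral_add intervalIntegrable_const hnegint,
      intervalIntegral.integral_const, intervalIntegral.integral_const_mul,
      intervalIntegral.integral_neg, integral_log_sin_zero_pi_div_two, smul_eq_mul, sub_zero]
    have h2 : Real.pi / 2 * (2 * C * √p) ≤ 2 * (2 * C * √p) := by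
      gcongr
      linarith
    have h3 : p * (Real.log 2 * Real.pi / 2) ≤ p * 2 := by
      gcongr
      nlinarith
    nlinarith
  have hN : gapInt c (c * √(1 - p)) (logBdry a) * c
      = (∫ θ in (0 : ℝ)..(Real.pi / 2), R θ) + M * ellKc p + Real.log 2 * Real.pi / 2 := by
    rw [gapInt_eq hc hp0 (by linarith), div_mul_cancel₀ _ hc.ne', ellKc,
      ← intervalIntegral.integral_const_mul, ← intervalIntegral.integral_add hRint hMint,
      show Real.log 2 * Real.pi / 2 = -(-Real.log 2 * Real.pi / 2) by ring,
      ← integral_log_sin_zero_pi_div_two, ← sub_eq_add_neg, ← intervalIntegral.integral_sub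
        (hRint.add hMint) hsinint]
    refine intervalIntegral.integral_congr fun θ _ => ?_
    simp only [hR]
    ring
  have hJ : logMean c a (c * √(1 - p)) = ((∫ θ in (0 : ℝ)..(Real.pi / 2), R θ)
      + M * ellKc p + Real.log 2 * Real.pi / 2) / ellKc p := by
    rw [logMean, gapInt_one hc hp0 (by linarith), ← hN]
    field_simp
  have h3 : p ≤ √p := by
    have := Real.sq_sqrt hp0.le
    have h4 : √p ≤ 1 := by
      rw [Real.sqrt_le_one]
      linarith
    nlinarith [Real.sqrt_nonneg p]
  have h4 : |Real.log 2 * (Real.pi / 2 - ellKc p)| ≤ 2 * p := by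
    rw [abs_mul, abs_of_pos hlog2, abs_of_nonpos (by linarith)]
    calc Real.log 2 * -(Real.pi / 2 - ellKc p) ≤ 1 * (2 * p) := by
          gcongr
          · linarith
          · nlinarith
      _ = 2 * p := one_mul _
  have e : logMean c a (c * √(1 - p)) - (M + Real.log 2) = ((∫ θ in (0 : ℝ)..(Real.pi / 2), R θ)
      + Real.log 2 * (Real.pi / 2 - ellKc p)) / ellKc p := by
    rw [hJ]
    field_simp
    ring
  rw [hML, e, abs_div, abs_of_pos hK0, div_le_iff₀ hK0]
  have h5 : (4 * C + 4) * √p ≤ (4 * C + 4) * √p * ellKc p :=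
    le_mul_of_one_le_right (by positivity) (by linarith)
  refine (abs_add_le _ _).trans ?_
  linarith

end

/-! ### Poisson summation and quotients of Gaussian sums -/

/-- The Gaussian sum `∑ exp (-ℓ (2n - x)² / 2)`, the Poisson dual of the theta function. -/
def gaussSum (l x : ℝ) : ℝ := ∑' n : ℤ, Real.exp (-(l / 2) * (2 * (n : ℝ) - x) ^ 2)

lemma gaussSum_add_two_mul (l x : ℝ) (m : ℤ) : gaussSum l (x + 2 * m) = gaussSum l x := by
  rw [gaussSum, gaussSum, ← (Equiv.addRight m).tsum_eq]
  congr 1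
  ext n
  simp only [Equiv.coe_addRight, Int.cast_add]
  ring_nf

/-- Poisson summation. The factor `κ` does not depend on `θ`, so it cancels in the quotient of theta
functions. -/
lemma Theta_eq_gaussSum {τ : ℝ} (hτ : τ < 0) :
    ∃ κ : ℂ, κ ≠ 0 ∧ ∀ θ : ℝ, Theta (Complex.I * θ) τ
      = κ * (gaussSum (-(Real.pi ^ 2 / τ)) (θ / Real.pi) : ℂ) := by
  have hpi := Real.pi_pos
  have hpiC : (Real.pi : ℂ) ≠ 0 := by exact_mod_cast hpi.ne'
  have hτC : (τ : ℂ) ≠ 0 := by exact_mod_cast hτ.ne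
  have ha : 0 < -τ / (2 * Real.pi) := div_pos (by linarith) (by positivity)
  have haC : ((-τ / (2 * Real.pi) : ℝ) : ℂ) ≠ 0 := by exact_mod_cast ha.ne'
  refine ⟨1 / ((-τ / (2 * Real.pi) : ℝ) : ℂ) ^ (1 / 2 : ℂ), ?_, fun θ => ?_⟩
  · rw [Ne, div_eq_zero_iff, not_or, Complex.cpow_eq_zero_iff]
    exact ⟨one_ne_zero, fun h => haC h.1⟩
  · have h := Complex.tsum_exp_neg_quadratic (a := ((-τ / (2 * Real.pi) : ℝ) : ℂ))
      (by rwa [Complex.ofReal_re]) (Complex.I * θ / (2 * Real.pi))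
    have e1 : Theta (Complex.I * θ) τ = ∑' n : ℤ, Complex.exp (-Real.pi
        * ((-τ / (2 * Real.pi) : ℝ) : ℂ) * n ^ 2
        + 2 * Real.pi * (Complex.I * θ / (2 * Real.pi)) * n) := by
      rw [Theta]
      congr 1
      ext n
      congr 1
      push_cast
      field_simp
    rw [e1, h, gaussSum, Complex.ofReal_tsum]
    congr 2
    ext n
    rw [Complex.ofReal_exp]
    congr 1
    have e2 : (n : ℂ) + Complex.I * (Complex.I * θ / (2 * Real.pi)) = n - θ / (2 * Real.pi) := by
      rw [← mul_div_assoc, ← mul_assoc, Complex.I_mul_I]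
      ring
    rw [e2]
    push_cast
    field_simp

/-- The constant in the tail estimates of the Gaussian sums. -/
def tailConst : ℝ := ∑' n : ℤ, Real.exp (1 - |(n : ℝ)|)

lemma summable_exp_one_sub_abs : Summable fun n : ℤ => Real.exp (1 - |(n : ℝ)|) := by
  have h : Summable fun n : ℕ => Real.exp (1 - (n : ℝ)) := by
    have h1 : (fun n : ℕ => Real.exp (1 - (n : ℝ))) = fun n : ℕ => Real.exp 1 * Real.exp (-n) := by
      ext n
      rw [← Real.exp_add]
      rfl
    rw [h1]
    exact Real.summable_exp_neg_nat.mul_left _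
  refine Summable.of_nat_of_neg ?_ ?_ <;> simpa using h

lemma tailConst_nonneg : 0 ≤ tailConst := tsum_nonneg fun _ => (Real.exp_pos _).le

/-- The Gaussian with index 0 is singled out. `N` need not be small when `|s|` is near 1; the weight
`exp (-2l(1 - |s|))` is kept because the decay of `1 / cosh` compensates it in `gaussSum_ratio`. -/
lemma gaussSum_numerator {l s : ℝ} (hl : 1 ≤ l) (hs : |s| ≤ 1) :
    ∃ N : ℝ, 0 ≤ N ∧ N ≤ tailConst * Real.exp (-2 * l * (1 - |s|)) ∧
      gaussSum l s = Real.exp (-(l / 2) * s ^ 2) * (1 + N) := by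
  set f : ℤ → ℝ := fun n => Real.exp (-2 * l * ((n : ℝ) ^ 2 - n * s)) with hf
  set g : ℤ → ℝ := fun n => (if n = 0 then 1 else 0)
    + Real.exp (-2 * l * (1 - |s|)) * Real.exp (1 - |(n : ℝ)|) with hg
  have hgsum : HasSum g (1 + Real.exp (-2 * l * (1 - |s|)) * tailConst) :=
    (hasSum_ite_eq 0 1).add (summable_exp_one_sub_abs.hasSum.mul_left _)
  have hfg : ∀ n, f n ≤ g n := by
    intro n
    rw [hf, hg]
    dsimp only
    split_ifs with hn
    · rw [hn]
      simp
      positivity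
    · rw [zero_add, ← Real.exp_add]
      refine Real.exp_le_exp.2 ?_
      have h1 : (1 : ℝ) ≤ |(n : ℝ)| := by exact_mod_cast Int.one_le_abs hn
      have h2 : (n : ℝ) * s ≤ |(n : ℝ)| * |s| := by
        rw [← abs_mul]
        exact le_abs_self _
      have h3 : (n : ℝ) ^ 2 = |(n : ℝ)| ^ 2 := (sq_abs _).symm
      have h4 : 1 - |s| + (|(n : ℝ)| - 1) ≤ (n : ℝ) ^ 2 - n * s := by
        rw [h3]
        nlinarith [abs_nonneg s]
      nlinarith
  have hfsum : Summable f := Summable.of_nonneg_of_le (fun n => (Real.exp_pos _).le) hfg hgsum.summable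
  have e1 : gaussSum l s = Real.exp (-(l / 2) * s ^ 2) * ∑' n, f n := by
    rw [gaussSum, ← tsum_mul_left]
    congr 1
    ext n
    rw [hf, ← Real.exp_add]
    ring_nf
  refine ⟨∑' n, f n - 1, ?_, ?_, by rw [e1]; ring⟩
  · have h := hfsum.le_tsum 0 fun n _ => (Real.exp_pos _).le
    have h0 : f 0 = 1 := by simp [hf]
    linarith
  · have h := hfsum.tsum_le_tsum hfg hgsum.summable
    rw [hgsum.tsum_eq] at h
    linarith

lemma exp_abs_le_two_cosh (x : ℝ) : Real.exp |x| ≤ 2 * Real.cosh x := by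
  rw [← Real.cosh_abs, Real.cosh_eq]
  have := Real.exp_pos (-|x|)
  linarith

/-- The point `s + 1` lies between the centres 0 and 2. Their two Gaussians may be of comparable
size and together form the hyperbolic cosine; all others are smaller by `exp (-l)`. -/
lemma gaussSum_denominator {l s : ℝ} (hl : 1 ≤ l) (hs : |s| ≤ 1) :
    ∃ D : ℝ, 0 ≤ D ∧ D ≤ tailConst * Real.exp (-l) ∧
      gaussSum l (s + 1)
        = Real.exp (-(l / 2) * (s ^ 2 + 1)) * (2 * Real.cosh (l * s) * (1 + D)) := by
  have hcosh := Real.cosh_pos (l * s)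
  set f : ℤ → ℝ := fun n => Real.exp (-l * (2 * (n : ℝ) ^ 2 - 2 * n - (2 * n - 1) * s)) with hf
  set g : ℤ → ℝ := fun n => ((if n = 0 then Real.exp (-(l * s)) else 0)
    + (if n = 1 then Real.exp (l * s) else 0))
    + 2 * Real.cosh (l * s) * Real.exp (-l) * Real.exp (1 - |(n : ℝ)|) with hg
  have hgsum : HasSum g ((Real.exp (-(l * s)) + Real.exp (l * s))
      + 2 * Real.cosh (l * s) * Real.exp (-l) * tailConst) :=
    ((hasSum_ite_eq 0 _).add (hasSum_ite_eq 1 _)).add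
      (summable_exp_one_sub_abs.hasSum.mul_left _)
  have hfg : ∀ n, f n ≤ g n := by
    intro n
    rw [hf, hg]
    dsimp only
    by_cases h0 : n = 0
    · rw [h0]
      simp
      positivity
    by_cases h1 : n = 1
    · rw [h1]
      simp
      rw [show l * ((2 - 1) * s) = l * s by ring]
      have : 0 ≤ 2 * Real.cosh (l * s) * Real.exp (-l) := by positivity
      linarith
    rw [if_neg h0, if_neg h1, zero_add, zero_add]
    have h2 : |(n : ℝ)| - |s| ≤ 2 * (n : ℝ) ^ 2 - 2 * n - (2 * n - 1) * s := by
      rcases (by omega : 2 ≤ n ∨ n ≤ -1) with h | h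
      · have h' : (2 : ℝ) ≤ n := by exact_mod_cast h
        rw [abs_of_nonneg (by linarith)]
        have h3 : (2 * (n : ℝ) - 1) * s ≤ (2 * (n : ℝ) - 1) * |s| := by
          gcongr
          · linarith
          · exact le_abs_self s
        nlinarith
      · have h' : (n : ℝ) ≤ -1 := by exact_mod_cast h
        rw [abs_of_neg (by linarith)]
        have h3 : (2 * (n : ℝ) - 1) * s ≤ (1 - 2 * (n : ℝ)) * |s| := by
          have := neg_abs_le s
          nlinarith
        nlinarith
    have h3 : (1 : ℝ) ≤ |(n : ℝ)| := by exact_mod_cast Int.one_le_abs h0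
    have h4 : Real.exp (l * |s|) ≤ 2 * Real.cosh (l * s) := by
      have := exp_abs_le_two_cosh (l * s)
      rwa [abs_mul, abs_of_pos (by linarith : 0 < l)] at this
    calc Real.exp (-l * (2 * (n : ℝ) ^ 2 - 2 * n - (2 * n - 1) * s))
        ≤ Real.exp (l * |s| + -l + (1 - |(n : ℝ)|)) := by
          refine Real.exp_le_exp.2 ?_
          nlinarith
      _ = Real.exp (l * |s|) * Real.exp (-l) * Real.exp (1 - |(n : ℝ)|) := by
          rw [Real.exp_add, Real.exp_add]
      _ ≤ _ := by gcongr
  have hfsum : Summable f := Summable.of_nonneg_of_le (fun n => (Real.exp_pos _).le) hfg hgsum.summable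
  have h2cosh : Real.exp (-(l * s)) + Real.exp (l * s) = 2 * Real.cosh (l * s) := by
    rw [Real.cosh_eq]
    ring
  have e1 : gaussSum l (s + 1) = Real.exp (-(l / 2) * (s ^ 2 + 1)) * ∑' n, f n := by
    rw [gaussSum, ← tsum_mul_left]
    congr 1
    ext n
    rw [hf, ← Real.exp_add]
    ring_nf
  refine ⟨(∑' n, f n) / (2 * Real.cosh (l * s)) - 1, ?_, ?_, by rw [e1]; field_simp; ring⟩
  · have h : ∑ n ∈ ({0, 1} : Finset ℤ), f n ≤ ∑' n, f n :=
      hfsum.sum_le_tsum {0, 1} fun n _ => (Real.exp_pos _).le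
    rw [Finset.sum_pair zero_ne_one] at h
    have h0 : f 0 = Real.exp (-(l * s)) := by simp [hf]
    have h1 : f 1 = Real.exp (l * s) := by
      simp only [hf]
      congr 1
      push_cast
      ring
    rw [h0, h1, h2cosh] at h
    rw [sub_nonneg, one_le_div (by positivity)]
    exact h
  · have h := hfsum.tsum_le_tsum hfg hgsum.summable
    rw [hgsum.tsum_eq, h2cosh] at h
    rw [sub_le_iff_le_add, div_le_iff₀ (by positivity)]
    linarith

/-- A shifted quotient of Gaussian sums is a hyperbolic secant up to an exponentially small
error. -/
lemma gaussSum_ratio {l s : ℝ} (hl : 1 ≤ l) (hs : |s| ≤ 1) :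
    |gaussSum l s / gaussSum l (s + 1) - Real.exp (l / 2) / (2 * Real.cosh (l * s))|
      ≤ 2 * tailConst * Real.exp (-(l / 2)) := by
  obtain ⟨N, hN0, hN1, hN⟩ := gaussSum_numerator hl hs
  obtain ⟨D, hD0, hD1, hD⟩ := gaussSum_denominator hl hs
  have hcosh := Real.cosh_pos (l * s)
  have hG := tailConst_nonneg
  have e1 : gaussSum l s / gaussSum l (s + 1) - Real.exp (l / 2) / (2 * Real.cosh (l * s))
      = Real.exp (l / 2) / (2 * Real.cosh (l * s)) * ((N - D) / (1 + D)) := by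
    rw [hN, hD, show -(l / 2) * (s ^ 2 + 1) = -(l / 2) * s ^ 2 - l / 2 by ring, Real.exp_sub]
    field_simp
    ring
  have h1 : |(N - D) / (1 + D)| ≤ N + D := by
    rw [abs_div, abs_of_pos (by linarith : 0 < 1 + D), div_le_iff₀ (by linarith)]
    have : |N - D| ≤ N + D := by
      rw [abs_le]
      constructor <;> linarith
    nlinarith
  have h2 : Real.exp (l / 2) / (2 * Real.cosh (l * s)) ≤ Real.exp (l / 2 - l * |s|) := by
    rw [div_le_iff₀ (by positivity)]
    have := exp_abs_le_two_cosh (l * s)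
    rw [abs_mul, abs_of_pos (by linarith : 0 < l)] at this
    calc Real.exp (l / 2) = Real.exp (l / 2 - l * |s|) * Real.exp (l * |s|) := by
          rw [← Real.exp_add]
          ring_nf
      _ ≤ _ := by gcongr
  rw [e1, abs_mul, abs_of_pos (by positivity)]
  -- The exponents are `-3l/2 + l|s|` and `-l/2 - l|s|`, both at most `-l/2` for `|s| ≤ 1`.
  calc Real.exp (l / 2) / (2 * Real.cosh (l * s)) * |(N - D) / (1 + D)|
      ≤ Real.exp (l / 2 - l * |s|)
        * (tailConst * Real.exp (-2 * l * (1 - |s|)) + tailConst * Real.exp (-l)) := by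
        gcongr
        linarith
    _ = tailConst * (Real.exp (l / 2 - l * |s| + -2 * l * (1 - |s|))
        + Real.exp (l / 2 - l * |s| + -l)) := by
        rw [Real.exp_add, Real.exp_add]
        ring
    _ ≤ tailConst * (Real.exp (-(l / 2)) + Real.exp (-(l / 2))) := by
        have := abs_nonneg s
        gcongr <;> nlinarith
    _ = _ := by ring

/-! ### The wave as a quotient of Gaussian sums -/

section

variable {c h₁ : ℝ} {a : ℂ → ℂ}

/-- The real number `z`. -/
def zReal (c : ℝ) (a : ℂ → ℂ) (x t : ℝ) : ℝ :=
  (t * bgReal c (fFun c (x / (12 * t))) + deltaReal c a (fFun c (x / (12 * t)))) / Real.pi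

lemma zFun_eq (ha : IsSpectralFunction c h₁ a) {x t : ℝ} (hd0 : 0 ≤ fFun c (x / (12 * t)))
    (hdc : fFun c (x / (12 * t)) ≤ c) : zFun c a x t = (zReal c a x t : ℂ) := by
  rw [zFun, zReal, Bg_eq hd0 hdc, Delta_eq ha hd0 hdc]
  push_cast
  rfl

/-- The argument of theta is `πi z`, so the extra `πi` in the numerator moves `z` by 1, half a
period of the Gaussian sum. -/
lemma qEl_eq (hc : 0 < c) (ha : IsSpectralFunction c h₁ a) {x t p : ℝ} (hp0 : 0 < p) (hp1 : p < 1)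
    (hd : fFun c (x / (12 * t)) = c * √(1 - p)) :
    qEl c a x t = ((c * √p * (gaussSum (ell c (c * √(1 - p))) (zReal c a x t + 1)
      / gaussSum (ell c (c * √(1 - p))) (zReal c a x t)) : ℝ) : ℂ) := by
  have hpi := Real.pi_pos
  have hd0 : 0 ≤ c * √(1 - p) := by positivity
  have hdc : c * √(1 - p) ≤ c := by
    have : √(1 - p) ≤ 1 := by
      rw [Real.sqrt_le_one]
      linarith
    nlinarith
  have hB : 0 < bandInt c (c * √(1 - p)) := by
    rw [bandInt_eq hc hp1]
    have := one_le_ellK hp0 hp1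
    positivity
  have hA : 0 < gapInt c (c * √(1 - p)) fun _ => 1 := by
    rw [gapInt_one hc hp0 hp1, ellKc]
    refine div_pos (intervalIntegral.intervalIntegral_pos_of_pos
      ((continuous_inv_ampl hp0.le hp1).intervalIntegrable _ _)
      (fun θ => one_div_pos.2 (ampl_pos hp0.le hp1 θ)) (by positivity)) hc
  have hτ : -(Real.pi * gapInt c (c * √(1 - p)) (fun _ => 1) / bandInt c (c * √(1 - p))) < 0 := by
    have : 0 < Real.pi * gapInt c (c * √(1 - p)) (fun _ => 1) / bandInt c (c * √(1 - p)) := by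
      positivity
    linarith
  obtain ⟨κ, hκ, hT⟩ := Theta_eq_gaussSum hτ
  have hell : -(Real.pi ^ 2 / -(Real.pi * gapInt c (c * √(1 - p)) (fun _ => 1)
      / bandInt c (c * √(1 - p)))) = ell c (c * √(1 - p)) := by
    rw [ell]
    field_simp
  rw [hell] at hT
  have hz : t * bgReal c (c * √(1 - p)) + deltaReal c a (c * √(1 - p))
      = zReal c a x t * Real.pi := by
    rw [zReal, hd]
    field_simp
  have e1 : Complex.I * (t : ℂ) * (bgReal c (c * √(1 - p)) : ℂ)
      + Complex.I * (deltaReal c a (c * √(1 - p)) : ℂ)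
      = Complex.I * ((zReal c a x t * Real.pi : ℝ) : ℂ) := by
    rw [← hz]
    push_cast
    ring
  have e2 : (Real.pi : ℂ) * Complex.I + Complex.I * (t : ℂ) * (bgReal c (c * √(1 - p)) : ℂ)
      + Complex.I * (deltaReal c a (c * √(1 - p)) : ℂ)
      = Complex.I * (((zReal c a x t + 1) * Real.pi : ℝ) : ℂ) := by
    rw [add_assoc, e1]
    push_cast
    ring
  have e3 : √(c ^ 2 - (c * √(1 - p)) ^ 2) = c * √p := by
    rw [mul_pow, Real.sq_sqrt (by linarith), show c ^ 2 - c ^ 2 * (1 - p) = c ^ 2 * p by ring,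
      Real.sqrt_mul (sq_nonneg c), Real.sqrt_sq hc.le]
  simp only [qEl]
  rw [hd, tau_eq hd0 hdc, Bg_eq hd0 hdc, Delta_eq ha hd0 hdc, e1, e2, hT, hT, e3,
    mul_div_cancel_right₀ _ hpi.ne', mul_div_cancel_right₀ _ hpi.ne', mul_div_mul_left _ _ hκ]
  push_cast
  rfl

end

/-! ### Uniform estimates near the leading edge -/

section

variable {c h₁ p v : ℝ} {a : ℂ → ℂ}

lemma p_eq_exp_logPar (hp0 : 0 < p) : p = 16 * Real.exp (-logPar p) := by
  rw [logPar, Real.exp_neg, Real.exp_log (by positivity)]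
  field_simp

lemma mul_logPar_pow_le (hp0 : 0 < p) (hp1 : p ≤ 1) (n : ℕ) :
    p * logPar p ^ n ≤ 16 * n.factorial := by
  have hL := logPar_pos hp0 hp1
  have h := Real.pow_div_factorial_le_exp _ hL.le n
  have hn : (0 : ℝ) < n.factorial := by exact_mod_cast n.factorial_pos
  rw [div_le_iff₀ hn] at h
  have h2 : Real.exp (-logPar p) * Real.exp (logPar p) = 1 := by
    rw [← Real.exp_add, neg_add_cancel, Real.exp_zero]
  calc p * logPar p ^ n = 16 * Real.exp (-logPar p) * logPar p ^ n := by
        rw [← p_eq_exp_logPar hp0]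
    _ ≤ 16 * Real.exp (-logPar p) * (Real.exp (logPar p) * n.factorial) := by gcongr
    _ = 16 * (Real.exp (-logPar p) * Real.exp (logPar p)) * n.factorial := by ring
    _ = _ := by rw [h2, mul_one]

lemma mul_logPar_le_sixteenth (hp0 : 0 < p) (hp1 : p ≤ 1 / 16384) : p * logPar p ≤ 1 / 16 := by
  have h1 := mul_logPar_le_sqrt hp0
  have h2 : √p ≤ 1 / 128 := by
    rw [Real.sqrt_le_left (by norm_num)]
    norm_num
    linarith
  linarith

/-- The product of the half period ratio with the leading part of `B_g`. -/
lemma ell_mul_bg_estimate (hc : 0 < c) (hp0 : 0 < p) (hp1 : p ≤ 1 / 16384) {l b : ℝ}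
    (hl : |l - logPar p| ≤ 40 * p) (hb : |b - 4 * Real.pi * c ^ 3 * p| ≤ 240 * c ^ 3 * (p * v))
    (hv : |v - p * (logPar p + 1) / 2| ≤ 4 * p ^ 2 * logPar p ^ 2) :
    |l * b / Real.pi - (8 * c ^ 3 * v - 4 * c ^ 3 * p)| ≤ 400 * c ^ 3 * (p ^ 2 * logPar p ^ 2) := by
  have hpi := Real.pi_pos
  have hpi3 := Real.pi_gt_three
  have hL := two_le_logPar hp0 (by linarith)
  have hpL := mul_logPar_le_sixteenth hp0 hp1
  set L := logPar p with hLdef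
  have hv2 : v ≤ 2 * (p * L) := by
    have h1 := (abs_le.1 hv).2
    have h2 : p ^ 2 * L ^ 2 ≤ 1 / 16 * (p * L) := by
      rw [← mul_pow, sq]
      gcongr
    nlinarith
  have hl2 : |l| ≤ 2 * L := by
    rw [abs_le] at hl ⊢
    constructor <;> linarith
  set e := b - 4 * Real.pi * c ^ 3 * p with he
  set e1 := l - L with he1
  set e2 := v - p * (L + 1) / 2 with he2
  -- At leading order the product is `4c³pL`, and `v ≈ p(L + 1)/2` rewrites this as `8c³v - 4c³p`.
  -- The three terms on the right are the errors of `l`, `b` and `v`.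
  have key : l * b / Real.pi - (8 * c ^ 3 * v - 4 * c ^ 3 * p)
      = 4 * c ^ 3 * p * e1 + l * e / Real.pi - 8 * c ^ 3 * e2 := by
    rw [he, he1, he2]
    field_simp
    ring
  have h1 : |4 * c ^ 3 * p * e1| ≤ 40 * c ^ 3 * (p ^ 2 * L ^ 2) := by
    rw [abs_mul, abs_of_pos (by positivity)]
    calc 4 * c ^ 3 * p * |e1| ≤ 4 * c ^ 3 * p * (40 * p) := by gcongr
      _ = 40 * c ^ 3 * (p ^ 2 * 2 ^ 2) := by ring
      _ ≤ _ := by gcongr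
  have h2 : |l * e / Real.pi| ≤ 320 * c ^ 3 * (p ^ 2 * L ^ 2) := by
    rw [abs_div, abs_mul, abs_of_pos hpi, div_le_iff₀ hpi]
    calc |l| * |e| ≤ 2 * L * (240 * c ^ 3 * (p * (2 * (p * L)))) := by
          gcongr
          exact hb.trans (by gcongr)
      _ = 320 * c ^ 3 * (p ^ 2 * L ^ 2) * 3 := by ring
      _ ≤ _ := by gcongr
  have h3 : |8 * c ^ 3 * e2| ≤ 32 * c ^ 3 * (p ^ 2 * L ^ 2) := by
    rw [abs_mul, abs_of_pos (by positivity)]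
    calc 8 * c ^ 3 * |e2| ≤ 8 * c ^ 3 * (4 * p ^ 2 * L ^ 2) := by gcongr
      _ = _ := by ring
  rw [key]
  have h4 : 0 ≤ c ^ 3 * (p ^ 2 * L ^ 2) := by positivity
  rw [abs_le] at *
  constructor <;> linarith

/-- All the quantities of the modulated wave in terms of the parameter `p`, for small `p`. -/
lemma IsSpectralFunction.exists_parameter_estimates (ha : IsSpectralFunction c h₁ a) (hc : 0 < c) :
    ∃ C p₀ : ℝ, 0 < C ∧ 0 < p₀ ∧ p₀ ≤ 1 / 16384 ∧ ∀ x t : ℝ, 0 < t → -(6 * c ^ 2 * t) < x →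
      x < 4 * c ^ 2 * t → ∃ p : ℝ, 0 < p ∧ p < 1 ∧ fFun c (x / (12 * t)) = c * √(1 - p) ∧
      p ≤ vFun c x t ∧ (p ≤ p₀ →
        |ell c (c * √(1 - p)) - logPar p| ≤ 40 * p ∧
        |vFun c x t - p * (logPar p + 1) / 2| ≤ 4 * p ^ 2 * logPar p ^ 2 ∧
        |ell c (c * √(1 - p)) * zReal c a x t - (8 * c ^ 3 * t * vFun c x t - 4 * c ^ 3 * t * p
          - Real.log (h₁ ^ 2 / 4) - logPar p / 2)| ≤ C * (t * (p ^ 2 * logPar p ^ 2) + √p)) := by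
  obtain ⟨C, p₀, hC, hp₀, -, hJ⟩ := ha.logMean_estimate hc
  refine ⟨400 * c ^ 3 + C, min p₀ (1 / 16384), by positivity, by positivity, min_le_right _ _,
    fun x t ht hx1 hx2 => ?_⟩
  obtain ⟨p, hp0, hp1, hd, hmu, hv⟩ := exists_parameter hc ht hx1 hx2
  refine ⟨p, hp0, hp1, hd, hv ▸ p_le_v hp0 hp1, fun hp => ?_⟩
  have hpp₀ : p ≤ p₀ := hp.trans (min_le_left _ _)
  have hps : p ≤ 1 / 16384 := hp.trans (min_le_right _ _)
  have hpi := Real.pi_pos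
  have h1 : |ell c (c * √(1 - p)) - logPar p| ≤ 40 * p := by
    rw [ell_eq hc hp0 hp1]
    exact ratio_estimate hp0 (by linarith)
  have h2 : |vFun c x t - p * (logPar p + 1) / 2| ≤ 4 * p ^ 2 * logPar p ^ 2 := by
    rw [hv]
    exact v_estimate hp0 (by linarith)
  refine ⟨h1, h2, ?_⟩
  have hpL := mul_logPar_le_sixteenth hp0 hps
  have hL := two_le_logPar hp0 (by linarith)
  have hv1 : vFun c x t ≤ 1 := by
    have h3 := (abs_le.1 h2).2
    have h4 : p ^ 2 * logPar p ^ 2 ≤ (1 / 16) ^ 2 := by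
      rw [← mul_pow]
      gcongr
    linarith
  have h3 := bg_estimate hc hp0 (by linarith) (hv ▸ p_le_v hp0 hp1) hv1 hmu
  have h4 := ell_mul_bg_estimate hc hp0 hps h1 h3 h2
  have h5 := hJ p hp0 hpp₀
  have h6 := ell_mul_deltaReal (a := a) hc hp0 hp1
  set l := ell c (c * √(1 - p))
  set b := bgReal c (c * √(1 - p)) with hb
  have e1 : l * zReal c a x t = t * (l * b / Real.pi) - logMean c a (c * √(1 - p)) := by
    rw [zReal, hd, ← hb, mul_div_assoc', mul_add, h6]
    field_simp
    ring
  rw [e1]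
  have h7 : |t * (l * b / Real.pi - (8 * c ^ 3 * vFun c x t - 4 * c ^ 3 * p))|
      ≤ t * (400 * c ^ 3 * (p ^ 2 * logPar p ^ 2)) := by
    rw [abs_mul, abs_of_pos ht]
    gcongr
  have h8 : 0 ≤ c ^ 3 * √p := by positivity
  have h9 : 0 ≤ C * (t * (p ^ 2 * logPar p ^ 2)) := by positivity
  rw [abs_le] at *
  constructor <;> nlinarith

/-- The inversion of the relation between `v` and `p`. -/
lemma parameter_inversion (hp0 : 0 < p) (hp1 : p ≤ 1 / 16384) (hpv : p ≤ v)
    (hv : |v - p * (logPar p + 1) / 2| ≤ 4 * p ^ 2 * logPar p ^ 2) (hvL : 8 ≤ -Real.log v) :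
    1 ≤ Real.log (-Real.log v) ∧ -Real.log v ≤ logPar p ∧ p * (-Real.log v) ≤ 4 * v ∧
      v ≤ 4 * (p * (-Real.log v)) ∧
      |p * (-Real.log v) / v - 2| ≤ 1040 * (Real.log (-Real.log v) / (-Real.log v)) := by
  have hL := two_le_logPar hp0 (by linarith)
  have hpL := mul_logPar_le_sixteenth hp0 hp1
  have hv0 : 0 < v := hp0.trans_le hpv
  have hpL2 : p * logPar p ^ 2 ≤ 32 := by
    have := mul_logPar_pow_le hp0 (by linarith) 2
    norm_num at this
    exact this
  have hlog2 : 0 < Real.log 2 := Real.log_pos one_lt_two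
  have hlog2' := Real.log_two_lt_d9
  have hlog2'' := Real.log_two_gt_d9
  set L := logPar p with hLdef
  set M := -Real.log v with hM
  have hLp : L = 4 * Real.log 2 - Real.log p := by
    rw [hLdef, logPar, Real.log_div (by norm_num) hp0.ne', show (16 : ℝ) = 2 ^ 4 by norm_num,
      Real.log_pow]
    norm_num
  have h8 : Real.log 8 = 3 * Real.log 2 := by
    rw [show (8 : ℝ) = 2 ^ 3 by norm_num, Real.log_pow]
    norm_num
  have hlogM : 3 * Real.log 2 ≤ Real.log M := by
    rw [← h8]
    exact Real.log_le_log (by norm_num) hvL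
  have hM1 : 1 ≤ Real.log M := by linarith
  have hML : M ≤ L := by
    have := Real.log_le_log hp0 hpv
    linarith
  have hpp : p ^ 2 * L ^ 2 ≤ 1 / 16 * (p * L) := by
    rw [← mul_pow, sq]
    gcongr
  have hvup : v ≤ 2 * (p * L) := by
    have h1 := (abs_le.1 hv).2
    nlinarith
  have hvlow : p * L / 4 ≤ v := by
    have h1 := (abs_le.1 hv).1
    nlinarith
  have hlogv : Real.log v ≤ Real.log 2 + (Real.log p + Real.log L) := by
    rw [← Real.log_mul hp0.ne' (by positivity), ← Real.log_mul two_ne_zero (by positivity)]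
    exact Real.log_le_log hv0 hvup
  have hL2 : L ≤ 2 * M := by
    have h1 : Real.log (L / 4) ≤ L / 4 - 1 := Real.log_le_sub_one_of_pos (by positivity)
    have h2 : Real.log (L / 4) = Real.log L - 2 * Real.log 2 := by
      rw [Real.log_div (by positivity) (by norm_num), show (4 : ℝ) = 2 ^ 2 by norm_num,
        Real.log_pow]
      norm_num
    linarith
  -- From `v ≤ 2pL` one has `L - M ≤ 5 log 2 + log L`. The crude bound `L ≤ 2M` gives `log L ≤ log 2
  -- + log M`, and `M ≥ 8` absorbs `6 log 2` into `2 log M`.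
  have hLM : L - M ≤ 3 * Real.log M := by
    have h1 : Real.log L ≤ Real.log 2 + Real.log M := by
      rw [← Real.log_mul two_ne_zero (by positivity)]
      exact Real.log_le_log (by positivity) hL2
    linarith
  have hM0 : 0 < M := by linarith
  refine ⟨hM1, hML, ?_, ?_, ?_⟩
  · nlinarith
  · nlinarith
  -- The constant is `3 + 1 + 256`: from `L - M`, from the summand 1 in `L + 1`, and from `8 p L² ≤
  -- 256`. The bound `pM/4 ≤ v` then turns 260 into 1040.
  · have h1 : |p * M - 2 * v| ≤ p * (260 * Real.log M) := by
      have h2 : 0 ≤ p * (L - M) := mul_nonneg hp0.le (by linarith)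
      have h3 : p * (L - M) ≤ p * (3 * Real.log M) := by gcongr
      have h4 : p * (p * L ^ 2) ≤ p * 32 := by gcongr
      have h5 : p * 1 ≤ p * Real.log M := by gcongr
      have h6 := abs_le.1 hv
      rw [abs_le]
      constructor <;> nlinarith
    rw [div_sub' hv0.ne', abs_div, abs_of_pos hv0, div_le_iff₀ hv0, mul_comm v 2]
    refine h1.trans ?_
    have h2 : p * M / 4 ≤ v := by nlinarith
    calc p * (260 * Real.log M) = 1040 * (Real.log M / M) * (p * M / 4) := by
          field_simp
          norm_num
      _ ≤ _ := by gcongr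

/-- In the logarithmic neighbourhood of the leading edge `v` is small. -/
lemma eventually_v_small (hc : 0 < c) (γ : ℝ) (ε : ℝ) (hε : 0 < ε) :
    ∃ T : ℝ, 1 < T ∧ ∀ t : ℝ, T ≤ t → γ * Real.log t < c ^ 2 * t ∧ 0 < Real.log t ∧
      t ^ (-(1 / 2) : ℝ) ≤ ε ∧ γ * Real.log t / (4 * c ^ 2 * t) ≤ t ^ (-(1 / 2) : ℝ) := by
  have h1 : Tendsto (fun t : ℝ => t ^ (-(1 / 2) : ℝ)) atTop (𝓝 0) :=
    tendsto_rpow_neg_atTop (by norm_num)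
  have h2 : Tendsto (fun t : ℝ => Real.log t / t ^ (1 / 2 : ℝ)) atTop (𝓝 0) :=
    (isLittleO_log_rpow_atTop (by norm_num)).tendsto_div_nhds_zero
  have h3 : ∀ᶠ t : ℝ in atTop, γ * (Real.log t / t ^ (1 / 2 : ℝ)) < 4 * c ^ 2 :=
    (h2.const_mul γ).eventually (gt_mem_nhds (by rw [mul_zero]; positivity))
  have h4 : ∀ᶠ t : ℝ in atTop, γ * (Real.log t / t ^ (1 / 2 : ℝ)) < c ^ 2 :=
    (h2.const_mul γ).eventually (gt_mem_nhds (by rw [mul_zero]; positivity))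
  obtain ⟨T, hT⟩ := eventually_atTop.1 (((h1.eventually (ge_mem_nhds hε)).and h3).and h4)
  refine ⟨max T 2, lt_max_of_lt_right one_lt_two, fun t ht => ?_⟩
  obtain ⟨⟨a1, a2⟩, a3⟩ := hT t ((le_max_left _ _).trans ht)
  have ht2 : 2 ≤ t := (le_max_right _ _).trans ht
  have ht0 : 0 < t := by linarith
  have hs0 : 0 < t ^ (1 / 2 : ℝ) := Real.rpow_pos_of_pos ht0 _
  have hs2 : t ^ (1 / 2 : ℝ) * t ^ (1 / 2 : ℝ) = t := by
    rw [← Real.rpow_add ht0]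
    norm_num
  have hs1 : 1 ≤ t ^ (1 / 2 : ℝ) := Real.one_le_rpow (by linarith) (by norm_num)
  refine ⟨?_, Real.log_pos (by linarith), a1, ?_⟩
  · rw [mul_div_assoc', div_lt_iff₀ hs0] at a3
    have : c ^ 2 * t ^ (1 / 2 : ℝ) ≤ c ^ 2 * t := by
      gcongr
      nlinarith
    linarith
  · rw [mul_div_assoc', div_lt_iff₀ hs0] at a2
    rw [Real.rpow_neg ht0.le, div_le_iff₀ (by positivity), inv_mul_eq_div, le_div_iff₀ hs0]
    calc γ * Real.log t * t ^ (1 / 2 : ℝ) ≤ 4 * c ^ 2 * t ^ (1 / 2 : ℝ) * t ^ (1 / 2 : ℝ) := by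
          gcongr
      _ = 4 * c ^ 2 * t := by rw [mul_assoc, hs2]

/-- The facts on the parameter `p` in a logarithmic neighbourhood of the leading edge. -/
structure NearEdge (c h₁ : ℝ) (a : ℂ → ℂ) (C x t p : ℝ) : Prop where
  one_lt : 1 < t
  pos : 0 < p
  le : p ≤ 1 / 16384
  range : -(6 * c ^ 2 * t) < x
  f_eq : fFun c (x / (12 * t)) = c * √(1 - p)
  ell_close : |ell c (c * √(1 - p)) - logPar p| ≤ 40 * p
  v_pos : 0 < vFun c x t
  t_mul_v : 4 * c ^ 2 * (t * vFun c x t) = 4 * c ^ 2 * t - x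
  log_le : Real.log t / 2 ≤ -Real.log (vFun c x t)
  log_ge : 8 ≤ -Real.log (vFun c x t)
  loglog_ge : 1 ≤ Real.log (-Real.log (vFun c x t))
  log_le_logPar : -Real.log (vFun c x t) ≤ logPar p
  t_mul_v_le : t * vFun c x t ≤ C * (-Real.log (vFun c x t))
  p_upper : p * (-Real.log (vFun c x t)) ≤ 4 * vFun c x t
  p_lower : vFun c x t ≤ 4 * (p * (-Real.log (vFun c x t)))
  p_close : |p * (-Real.log (vFun c x t)) / vFun c x t - 2|
    ≤ 1040 * (Real.log (-Real.log (vFun c x t)) / (-Real.log (vFun c x t)))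
  ell_mul_z_close : |ell c (c * √(1 - p)) * zReal c a x t - (8 * c ^ 3 * t * vFun c x t - 4 * c ^ 3 * t * p
    - Real.log (h₁ ^ 2 / 4) - logPar p / 2)| ≤ C / (-Real.log (vFun c x t))

/-- In the strip `v ≤ t^(-1/2)` for large `t`, so `M = -log v` is at least `(log t)/2` and `tv =
O(M)`. As `p` beats every power of `L ≥ M`, the error `t p² L² + √p` is `O(1/M)`. -/
lemma IsSpectralFunction.nearEdge (ha : IsSpectralFunction c h₁ a) (hc : 0 < c) {γ : ℝ}
    (hγ : 0 < γ) : ∃ C T : ℝ, 0 < C ∧ ∀ t : ℝ, T ≤ t → ∀ x : ℝ, 4 * c ^ 2 * t - γ * Real.log t < x →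
      x < 4 * c ^ 2 * t → ∃ p, NearEdge c h₁ a C x t p := by
  obtain ⟨C₀, p₀, hC₀, hp₀, hp₀1, H⟩ := ha.exists_parameter_estimates hc
  obtain ⟨T, hT1, hT⟩ := eventually_v_small hc γ (min p₀ (Real.exp (-8))) (by positivity)
  -- `4c² t v = 4c²t - x < γ log t ≤ 2γM`, so `tv ≤ ΓM`.
  set Γ := γ / (2 * c ^ 2) with hΓ
  have hΓ0 : 0 < Γ := by positivity
  refine ⟨Γ + C₀ * (Γ * 384 + 6), T, by positivity, fun t ht x hx1 hx2 => ?_⟩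
  obtain ⟨h1, hlogt, h2, h3⟩ := hT t ht
  have ht1 : 1 < t := hT1.trans_le ht
  have ht0 : 0 < t := by linarith
  have hxr : -(6 * c ^ 2 * t) < x := by
    have : 0 < c ^ 2 * t := by positivity
    linarith
  obtain ⟨p, hp0, hp1, hd, hpv, hest⟩ := H x t ht0 hxr hx2
  have htv : 4 * c ^ 2 * (t * vFun c x t) = 4 * c ^ 2 * t - x := by
    rw [vFun]
    field_simp
  have hv0 : 0 < vFun c x t := hp0.trans_le hpv
  have hvt : vFun c x t ≤ t ^ (-(1 / 2) : ℝ) := by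
    refine le_trans ?_ h3
    rw [le_div_iff₀ (by positivity)]
    linarith
  have hvmin : vFun c x t ≤ min p₀ (Real.exp (-8)) := hvt.trans h2
  have hpp₀ : p ≤ p₀ := (hpv.trans hvmin).trans (min_le_left _ _)
  obtain ⟨e1, e2, e3⟩ := hest hpp₀
  have hps : p ≤ 1 / 16384 := hpp₀.trans hp₀1
  have hlog8 : 8 ≤ -Real.log (vFun c x t) := by
    have := Real.log_le_log hv0 (hvmin.trans (min_le_right _ _))
    rw [Real.log_exp] at this
    linarith
  have hlogle : Real.log t / 2 ≤ -Real.log (vFun c x t) := by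
    have := Real.log_le_log hv0 hvt
    rw [Real.log_rpow ht0] at this
    linarith
  obtain ⟨f1, f2, f3, f4, f5⟩ := parameter_inversion hp0 hps hpv e2 hlog8
  -- `384 = 16 · 4!` and `32 = 16 · 2!`.
  have hpL4 : p * logPar p ^ 4 ≤ 384 := by
    have := mul_logPar_pow_le hp0 (by linarith) 4
    norm_num [Nat.factorial] at this
    exact this
  have hpL2 : p * logPar p ^ 2 ≤ 32 := by
    have := mul_logPar_pow_le hp0 (by linarith) 2
    norm_num at this
    exact this
  set v := vFun c x t with hv
  set M := -Real.log v with hM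
  have hM0 : 0 < M := by linarith
  have htvM : t * v ≤ Γ * M := by
    have h4 : 4 * c ^ 2 * (t * v) ≤ 4 * c ^ 2 * (Γ * M) := by
      rw [htv, hΓ]
      have : 4 * c ^ 2 * (γ / (2 * c ^ 2) * M) = 2 * γ * M := by
        field_simp
        norm_num
      rw [this]
      nlinarith
    exact le_of_mul_le_mul_left h4 (by positivity)
  refine ⟨p, ht1, hp0, hps, hxr, hd, e1, hv0, htv, hlogle, hlog8, f1, f2, ?_, f3, f4, f5,
    e3.trans ?_⟩
  · refine htvM.trans ?_
    have : 0 ≤ C₀ * (Γ * 384 + 6) * M := by positivity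
    linarith
  · have g1 : t * (p ^ 2 * logPar p ^ 2) ≤ Γ * 384 / M := by
      rw [le_div_iff₀ hM0]
      have k1 : p * logPar p ^ 2 * M ^ 2 ≤ 384 := by
        calc p * logPar p ^ 2 * M ^ 2 ≤ p * logPar p ^ 2 * logPar p ^ 2 := by gcongr
          _ = p * logPar p ^ 4 := by ring
          _ ≤ 384 := hpL4
      calc t * (p ^ 2 * logPar p ^ 2) * M = t * p * (p * logPar p ^ 2) * M := by ring
        _ ≤ t * v * (p * logPar p ^ 2) * M := by gcongr
        _ ≤ Γ * M * (p * logPar p ^ 2) * M := by gcongr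
        _ = Γ * (p * logPar p ^ 2 * M ^ 2) := by ring
        _ ≤ Γ * 384 := by gcongr
    have g2 : √p ≤ 6 / M := by
      rw [le_div_iff₀ hM0]
      refine abs_le_of_sq_le_sq' ?_ (by norm_num) |>.2
      rw [mul_pow, Real.sq_sqrt hp0.le]
      calc p * M ^ 2 ≤ p * logPar p ^ 2 := by gcongr
        _ ≤ 6 ^ 2 := by linarith
    calc C₀ * (t * (p ^ 2 * logPar p ^ 2) + √p) ≤ C₀ * (Γ * 384 / M + 6 / M) := by gcongr
      _ = C₀ * (Γ * 384 + 6) / M := by ring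
      _ ≤ _ := by
        gcongr
        linarith

end

/-! ### Phases and soliton profiles -/

/-- The phases `α_n(x,t)`. -/
def phase (c : ℝ) (a : ℂ → ℂ) (n : ℕ) (x t : ℝ) : ℝ :=
  2 * c * (x - 4 * c ^ 2 * t) + (2 * (n : ℝ) - 1 / 2) * Real.log t
    + ell c (fFun c (x / (12 * t))) * (zReal c a x t - 2 * n + 1)

section

variable {c h₁ C x t p : ℝ} {a : ℂ → ℂ}

/-- As `τ* = -4l`, the relation is the definition of `phase` solved for the argument of the soliton;
the content is that `τ*` and `z` are real. -/
lemma phase_relation (hc : 0 < c) (ha : IsSpectralFunction c h₁ a) (n : ℕ) (ht : 0 < t)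
    (hx1 : -(6 * c ^ 2 * t) < x) (hx2 : x < 4 * c ^ 2 * t) :
    tauStar c (fFun c (x / (12 * t))) * (zFun c a x t - 2 * (n : ℂ) + 1) / 4
      = ((2 * c * (x - 4 * c ^ 2 * t) + (2 * (n : ℝ) - 1 / 2) * Real.log t
        - phase c a n x t : ℝ) : ℂ) := by
  obtain ⟨p, hp0, hp1, hd, -, -⟩ := exists_parameter hc ht hx1 hx2
  have hd0 : 0 ≤ fFun c (x / (12 * t)) := by
    rw [hd]
    positivity
  have hdc : fFun c (x / (12 * t)) ≤ c := by
    have : √(1 - p) ≤ 1 := by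
      rw [Real.sqrt_le_one]
      linarith
    rw [hd]
    nlinarith
  rw [tauStar_eq hd0 hdc, zFun_eq ha hd0 hdc, phase]
  push_cast
  ring

lemma exp_neg_le_of_close {l : ℝ} (hp0 : 0 < p) (hp1 : p ≤ 1 / 16384) (hl : |l - logPar p| ≤ 40 * p) :
    Real.exp (-l) ≤ p := by
  have h1 : -l ≤ 1 + -logPar p := by
    have := (abs_le.1 hl).1
    linarith
  calc Real.exp (-l) ≤ Real.exp (1 + -logPar p) := Real.exp_le_exp.2 h1
    _ = Real.exp 1 * Real.exp (-logPar p) := Real.exp_add _ _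
    _ ≤ 16 * Real.exp (-logPar p) := by
        have := Real.exp_one_lt_d9
        gcongr
        linarith
    _ = p := (p_eq_exp_logPar hp0).symm

lemma one_div_cosh_le (y : ℝ) : 1 / Real.cosh y ≤ 2 * Real.exp (-|y|) := by
  rw [div_le_iff₀ (Real.cosh_pos y)]
  have h1 := exp_abs_le_two_cosh y
  have h2 : Real.exp (-|y|) * Real.exp |y| = 1 := by
    rw [← Real.exp_add, neg_add_cancel, Real.exp_zero]
  nlinarith [Real.exp_pos (-|y|)]

/-- From `√p = 4 exp (-L/2)`. This fixes the amplitude `2c` of the solitons. -/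
lemma sqrt_mul_exp_estimate {l : ℝ} (hp0 : 0 < p) (hp1 : p ≤ 1 / 16384)
    (hl : |l - logPar p| ≤ 40 * p) : |√p * Real.exp (l / 2) - 4| ≤ 160 * p := by
  have h1 : √p = 4 * Real.exp (-(logPar p / 2)) := by
    have h2 : p = (4 * Real.exp (-(logPar p / 2))) ^ 2 := by
      rw [mul_pow, ← Real.exp_nat_mul]
      nth_rw 1 [p_eq_exp_logPar hp0]
      push_cast
      ring_nf
    nth_rw 1 [h2]
    exact Real.sqrt_sq (by positivity)
  have h3 : √p * Real.exp (l / 2) - 4 = 4 * (Real.exp ((l - logPar p) / 2) - 1) := by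
    rw [h1, mul_assoc, ← Real.exp_add]
    ring_nf
  have h4 : |(l - logPar p) / 2| ≤ 20 * p := by
    rw [abs_div, abs_two]
    linarith
  have h5 := Real.abs_exp_sub_one_le (x := (l - logPar p) / 2) (h4.trans (by linarith))
  rw [h3, abs_mul, abs_of_pos (by norm_num : (0 : ℝ) < 4)]
  linarith

lemma one_le_of_close {l : ℝ} (hp0 : 0 < p) (hp1 : p ≤ 1 / 16384)
    (hl : |l - logPar p| ≤ 40 * p) : 1 ≤ l := by
  have := two_le_logPar hp0 (by linarith)
  have := (abs_le.1 hl).1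
  linarith

/-- The elliptic wave is a single soliton profile up to `O(p)`. -/
lemma NearEdge.qEl_estimate (h : NearEdge c h₁ a C x t p) (hc : 0 < c)
    (ha : IsSpectralFunction c h₁ a) (m : ℤ) (hm : |zReal c a x t - (2 * m - 1)| ≤ 1) :
    ‖qEl c a x t - ((2 * c / Real.cosh (ell c (c * √(1 - p))
      * (zReal c a x t - (2 * m - 1))) : ℝ) : ℂ)‖ ≤ (80 * c + 2 * c * tailConst) * p := by
  have hp0 := h.pos
  have hp1 : p < 1 := by linarith [h.le]
  have hell := h.ell_close
  rw [qEl_eq hc ha hp0 hp1 h.f_eq, ← Complex.ofReal_sub, Complex.norm_real, Real.norm_eq_abs]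
  set l := ell c (c * √(1 - p))
  set z := zReal c a x t
  set s := z - (2 * m - 1) with hs
  have hl1 : 1 ≤ l := one_le_of_close hp0 h.le hell
  have hG := tailConst_nonneg
  have e1 : gaussSum l (z + 1) = gaussSum l s := by
    rw [← gaussSum_add_two_mul l s m]
    congr 1
    rw [hs]
    ring
  have e2 : gaussSum l z = gaussSum l (s + 1) := by
    rw [← gaussSum_add_two_mul l (s + 1) (m - 1)]
    congr 1
    rw [hs]
    push_cast
    ring
  rw [e1, e2]
  have h1 := gaussSum_ratio hl1 hm
  have h2 := sqrt_mul_exp_estimate hp0 h.le hell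
  have hcosh := Real.one_le_cosh (l * s)
  have hsq : √p ^ 2 = p := Real.sq_sqrt hp0.le
  have hexp : Real.exp (-(l / 2)) ≤ √p := by
    refine abs_le_of_sq_le_sq' ?_ (Real.sqrt_nonneg p) |>.2
    rw [hsq, ← Real.exp_nat_mul]
    refine le_trans (le_of_eq ?_) (exp_neg_le_of_close hp0 h.le hell)
    push_cast
    ring_nf
  set q := gaussSum l s / gaussSum l (s + 1)
  have e3 : c * √p * q - 2 * c / Real.cosh (l * s)
      = c * √p * (q - Real.exp (l / 2) / (2 * Real.cosh (l * s)))
        + c / (2 * Real.cosh (l * s)) * (√p * Real.exp (l / 2) - 4) := by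
    field_simp
    ring
  rw [e3]
  refine (abs_add_le _ _).trans ?_
  rw [abs_mul (c * √p), abs_mul (c / _), abs_of_nonneg (by positivity : 0 ≤ c * √p),
    abs_of_pos (by positivity : 0 < c / (2 * Real.cosh (l * s)))]
  have h3 : c * √p * |q - Real.exp (l / 2) / (2 * Real.cosh (l * s))|
      ≤ 2 * c * tailConst * p := by
    calc c * √p * |q - Real.exp (l / 2) / (2 * Real.cosh (l * s))|
        ≤ c * √p * (2 * tailConst * √p) := by
          gcongr
          exact h1.trans (by gcongr)
      _ = 2 * c * tailConst * √p ^ 2 := by ring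
      _ = _ := by rw [hsq]
  have h4 : c / (2 * Real.cosh (l * s)) * |√p * Real.exp (l / 2) - 4| ≤ c / 2 * (160 * p) := by
    gcongr
    linarith
  linarith

/-- `p` is of order `v / M`, whereas `tv = O(M)`. This is the source of the error `O(1/t)`. -/
lemma NearEdge.t_mul_p_le (h : NearEdge c h₁ a C x t p) : t * p ≤ 4 * C := by
  have hM : 0 < -Real.log (vFun c x t) := by linarith [h.log_ge]
  have ht : 0 < t := by linarith [h.one_lt]
  refine le_of_mul_le_mul_right ?_ hM
  have h1 : t * (p * (-Real.log (vFun c x t))) ≤ t * (4 * vFun c x t) :=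
    mul_le_mul_of_nonneg_left h.p_upper ht.le
  linarith [h.t_mul_v_le]

lemma NearEdge.logPar_eq (h : NearEdge c h₁ a C x t p) :
    logPar p = Real.log 16 + Real.log t - Real.log (t * p) := by
  have ht : 0 < t := by linarith [h.one_lt]
  rw [logPar, Real.log_div (by norm_num) h.pos.ne', Real.log_mul ht.ne' h.pos.ne']
  ring

lemma NearEdge.ell_ge (h : NearEdge c h₁ a C x t p) :
    Real.log t - 4 * C - 1 ≤ ell c (c * √(1 - p)) := by
  have ht : 0 < t := by linarith [h.one_lt]
  have htp : 0 < t * p := mul_pos ht h.pos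
  have h1 : Real.log (t * p) ≤ t * p := (Real.log_le_sub_one_of_pos htp).trans (by linarith)
  have h2 := h.t_mul_p_le
  have h3 := h.logPar_eq
  have h4 := (abs_le.1 h.ell_close).1
  have h5 := h.le
  have h6 : 0 < Real.log 16 := Real.log_pos (by norm_num)
  linarith

/-- An upper bound for `l` needs `p` to be at least of order `1/t`, which holds only if `x` stays at
a distance of order `log t` from the edge. -/
lemma NearEdge.ell_le (h : NearEdge c h₁ a C x t p) {δ : ℝ} (hδ : 0 < δ)
    (hv : δ * Real.log t ≤ t * vFun c x t) (ht1 : 1 ≤ δ * Real.log t) :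
    ell c (c * √(1 - p)) ≤ Real.log t + (Real.log 16 - Real.log (δ / 4) + 1) := by
  have ht : 0 < t := by linarith [h.one_lt]
  have hv0 := h.v_pos
  have hM : 0 < -Real.log (vFun c x t) := by linarith [h.log_ge]
  have hMt : -Real.log (vFun c x t) ≤ Real.log t := by
    rw [← Real.log_inv]
    refine Real.log_le_log (by positivity) ?_
    rw [inv_le_iff_one_le_mul₀ hv0]
    linarith
  have h1 : δ / 4 ≤ t * p := by
    have h2 : t * vFun c x t ≤ t * (4 * (p * (-Real.log (vFun c x t)))) :=
      mul_le_mul_of_nonneg_left h.p_lower ht.le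
    have h3 : δ * (-Real.log (vFun c x t)) ≤ δ * Real.log t := by gcongr
    refine le_of_mul_le_mul_right ?_ hM
    linarith
  have h2 := Real.log_le_log (by positivity) h1
  have h3 := h.logPar_eq
  have h4 := (abs_le.1 h.ell_close).2
  have h5 := h.le
  linarith

/-- It locates `z` up to `O(1/l)`, which is what is needed to choose the index of the relevant
soliton; `tp`, `h₁` and `L - l` contribute only bounded terms. -/
lemma NearEdge.ell_mul_z (h : NearEdge c h₁ a C x t p) (hc : 0 < c) (hC : 0 < C) :
    |ell c (c * √(1 - p)) * zReal c a x t
      - (2 * c * (4 * c ^ 2 * t - x) - ell c (c * √(1 - p)) / 2)|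
      ≤ 16 * c ^ 3 * C + C + |Real.log (h₁ ^ 2 / 4)| + 1 := by
  have ht : 0 < t := by linarith [h.one_lt]
  have hM := h.log_ge
  have h1 := h.ell_mul_z_close
  have h2 : C / (-Real.log (vFun c x t)) ≤ C := div_le_self hC.le (by linarith)
  have h3 : c ^ 3 * (t * p) ≤ c ^ 3 * (4 * C) :=
    mul_le_mul_of_nonneg_left h.t_mul_p_le (by positivity)
  have h3' : 0 ≤ c ^ 3 * (t * p) := by
    have := h.pos
    positivity
  have h4 := h.ell_close
  have h5 := h.le
  have h6 : 8 * c ^ 3 * t * vFun c x t = 2 * c * (4 * c ^ 2 * t - x) := by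
    rw [← h.t_mul_v]
    ring
  rw [h6] at h1
  have h7 := neg_abs_le (Real.log (h₁ ^ 2 / 4))
  have h8 := le_abs_self (Real.log (h₁ ^ 2 / 4))
  rw [abs_le] at h1 h4 ⊢
  constructor <;> linarith

/-- The leading terms of the phases. -/
def phaseMain (c h₁ : ℝ) (n : ℕ) (x t : ℝ) : ℝ :=
  -(2 * (n : ℝ) - 1 / 2) * Real.log (Real.log (1 / vFun c x t) / (vFun c x t * t))
    - 8 * c ^ 3 * t * vFun c x t / Real.log (1 / vFun c x t)
    - (6 * (n : ℝ) - 7 / 2) * Real.log 2 - Real.log (h₁ ^ 2)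

/-- An exact identity, obtained by expanding logarithms: the deviation from the main terms is split
into the errors of the inversion `pM/v ≈ 2` (twice), of `l z`, and of `l ≈ L`. -/
lemma phase_decomposition {v M l z n : ℝ} (hv0 : 0 < v) (hp0 : 0 < p) (hM0 : 0 < M) (ht : 0 < t)
    (hh : h₁ ≠ 0) (hM : M = -Real.log v) (htv : 4 * c ^ 2 * (t * v) = 4 * c ^ 2 * t - x) :
    2 * c * (x - 4 * c ^ 2 * t) + (2 * n - 1 / 2) * Real.log t
      + l * (z - 2 * n + 1) - (-(2 * n - 1 / 2) * Real.log (M / (v * t))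
        - 8 * c ^ 3 * t * v / M - (6 * n - 7 / 2) * Real.log 2 - Real.log (h₁ ^ 2))
      = -(4 * c ^ 3 * (t * v / M) * (p * M / v - 2)) + (2 * n - 1 / 2) * Real.log (p * M / v / 2)
        + (l * z - (8 * c ^ 3 * t * v - 4 * c ^ 3 * t * p - Real.log (h₁ ^ 2 / 4) - logPar p / 2))
        + (1 - 2 * n) * (l - logPar p) := by
  have hX0 : 0 < p * M / v := by positivity
  have hlogX : Real.log (p * M / v) = Real.log p + Real.log M + M := by
    rw [Real.log_div (by positivity) hv0.ne', Real.log_mul hp0.ne' hM0.ne', hM]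
    ring
  have hlog16 : Real.log 16 = 4 * Real.log 2 := by
    rw [show (16 : ℝ) = 2 ^ 4 by norm_num, Real.log_pow]
    norm_num
  have hlog4 : Real.log 4 = 2 * Real.log 2 := by
    rw [show (4 : ℝ) = 2 ^ 2 by norm_num, Real.log_pow]
    norm_num
  have k1 : 4 * c ^ 3 * (t * v / M) * (p * M / v - 2)
      = 4 * c ^ 3 * t * p - 8 * c ^ 3 * t * v / M := by
    field_simp
    ring
  have k2 : Real.log (M / (v * t)) = Real.log M + M - Real.log t := by
    rw [Real.log_div hM0.ne' (by positivity), Real.log_mul hv0.ne' ht.ne', hM]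
    ring
  have k3 : 2 * c * (x - 4 * c ^ 2 * t) = -(8 * c ^ 3 * t * v) := by linear_combination 2 * c * htv
  rw [k1, k2, k3, Real.log_div hX0.ne' two_ne_zero, hlogX,
    Real.log_div (pow_ne_zero 2 hh) (by norm_num), hlog4, logPar,
    Real.log_div (by norm_num) hp0.ne', hlog16]
  ring

/-- Each error in `phase_decomposition` is `O(log M / M)`, one factor `log M` better than required.
The coefficient of `n` is `2·4160 + 2·40`. -/
lemma NearEdge.phase_estimate (h : NearEdge c h₁ a C x t p) (hc : 0 < c) (hC : 0 < C)
    (hh : h₁ ≠ 0) (n : ℕ) (hn : 1 ≤ n) :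
    |phase c a n x t - phaseMain c h₁ n x t| ≤ (4160 * c ^ 3 * C + 8400 * n + C)
      * (Real.log (-Real.log (vFun c x t)) / (-Real.log (vFun c x t))) := by
  have ht : 0 < t := by linarith [h.one_lt]
  have hn' : (1 : ℝ) ≤ n := by exact_mod_cast hn
  have hp0 := h.pos
  have hv0 := h.v_pos
  have hM8 := h.log_ge
  have hlogM := h.loglog_ge
  have hphase := h.ell_mul_z_close
  have hell := h.ell_close
  have hclose := h.p_close
  have hlow := h.p_lower
  have htv := h.t_mul_v
  have htvM := h.t_mul_v_le
  have hple := h.log_le_logPar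
  rw [phase, phaseMain, one_div (vFun c x t), Real.log_inv, h.f_eq]
  set v := vFun c x t with hv
  set M := -Real.log v with hM
  have hM0 : 0 < M := by linarith
  set l := ell c (c * √(1 - p))
  set z := zReal c a x t
  set E := l * z - (8 * c ^ 3 * t * v - 4 * c ^ 3 * t * p - Real.log (h₁ ^ 2 / 4) - logPar p / 2)
    with hE
  set X := p * M / v with hX
  set κ := Real.log M / M with hκ
  have hX0 : 0 < X := by positivity
  have hX8 : 1 / 8 ≤ X / 2 := by
    rw [hX, div_div, le_div_iff₀ (by positivity)]
    linarith
  have hκ0 : 0 < κ := by positivity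
  have hκM : 1 / M ≤ κ := by
    rw [hκ]
    gcongr
  rw [phase_decomposition hv0 hp0 hM0 ht hh rfl htv]
  have b1 : |4 * c ^ 3 * (t * v / M) * (X - 2)| ≤ 4160 * c ^ 3 * C * κ := by
    have h1 : t * v / M ≤ C := by rwa [div_le_iff₀ hM0]
    rw [abs_mul, abs_of_pos (by positivity)]
    calc 4 * c ^ 3 * (t * v / M) * |X - 2| ≤ 4 * c ^ 3 * C * (1040 * κ) := by gcongr
      _ = _ := by ring
  have b2 : |Real.log (X / 2)| ≤ 4160 * κ := by
    have h1 := Real.log_le_sub_one_of_pos (half_pos hX0)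
    have h2 := Real.one_sub_inv_le_log_of_pos (half_pos hX0)
    have h3 : -(8 * |X / 2 - 1|) ≤ 1 - (X / 2)⁻¹ := by
      have h4 : 1 - (X / 2)⁻¹ = (X / 2 - 1) / (X / 2) := by field_simp
      rw [h4, le_div_iff₀ (half_pos hX0)]
      nlinarith [neg_abs_le (X / 2 - 1), abs_nonneg (X / 2 - 1)]
    have h5 : |X / 2 - 1| ≤ 520 * κ := by
      rw [show X / 2 - 1 = (X - 2) / 2 by ring, abs_div, abs_two]
      linarith
    have h6 := le_abs_self (X / 2 - 1)
    have h7 := abs_nonneg (X / 2 - 1)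
    rw [abs_le]
    constructor <;> linarith
  have b3 : |(2 * (n : ℝ) - 1 / 2) * Real.log (X / 2)| ≤ 2 * n * (4160 * κ) := by
    rw [abs_mul, abs_of_pos (by linarith)]
    gcongr
    linarith
  have b4 : |E| ≤ C * κ := by
    calc |E| ≤ C / M := hphase
      _ = C * (1 / M) := by ring
      _ ≤ C * κ := by gcongr
  have b5 : |(1 - 2 * (n : ℝ)) * (l - logPar p)| ≤ 2 * n * (40 * κ) := by
    have h1 : p ≤ κ := by
      have h2 : p * M ≤ 1 := by
        have := mul_logPar_le_sixteenth hp0 h.le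
        nlinarith
      refine le_trans ?_ hκM
      rwa [le_div_iff₀ hM0]
    rw [abs_mul, abs_of_neg (by linarith)]
    gcongr
    · linarith
    · exact hell.trans (by gcongr)
  rw [abs_le] at *
  constructor <;> linarith

end

section

variable {c h₁ C x t p : ℝ} {a : ℂ → ℂ}

lemma NearEdge.soliton_argument (h : NearEdge c h₁ a C x t p) (n : ℕ) :
    2 * c * (x - 4 * c ^ 2 * t) + (2 * (n : ℝ) - 1 / 2) * Real.log t - phase c a n x t
      = -(ell c (c * √(1 - p)) * (zReal c a x t - (2 * n - 1))) := by
  rw [phase, h.f_eq]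
  ring

/-- Comparison of the wave with the sum of solitons, as long as `0 ≤ z ≤ 2N`. -/
lemma NearEdge.qEl_sub_sum_le (h : NearEdge c h₁ a C x t p) (hc : 0 < c)
    (ha : IsSpectralFunction c h₁ a) {N : ℕ} (hN : 1 ≤ N) (hz0 : 0 ≤ zReal c a x t)
    (hz1 : zReal c a x t ≤ 2 * N) :
    ‖qEl c a x t - ((∑ n ∈ Finset.Icc 1 N, 2 * c / Real.cosh (2 * c * (x - 4 * c ^ 2 * t)
      + (2 * (n : ℝ) - 1 / 2) * Real.log t - phase c a n x t) : ℝ) : ℂ)‖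
      ≤ (80 * c + 2 * c * tailConst + 4 * c * N) * p := by
  set z := zReal c a x t with hz
  set l := ell c (c * √(1 - p)) with hl
  have hp0 := h.pos
  have hl1 : 1 ≤ l := one_le_of_close hp0 h.le h.ell_close
  -- The interval `[2m - 2, 2m]` containing `z` has `m = ⌊z/2⌋ + 1`, except at `z = 2N`, where `m =
  -- N` is taken.
  obtain ⟨m, hm1, hmN, hm⟩ : ∃ m : ℕ, 1 ≤ m ∧ m ≤ N ∧ |z - (2 * m - 1)| ≤ 1 := by
    have h1 := Nat.floor_le (by positivity : 0 ≤ z / 2)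
    have h2 := Nat.lt_floor_add_one (z / 2)
    rcases le_or_gt (⌊z / 2⌋₊ + 1) N with hle | hlt
    · refine ⟨⌊z / 2⌋₊ + 1, by omega, hle, ?_⟩
      push_cast
      rw [abs_le]
      constructor <;> linarith
    · refine ⟨N, hN, le_rfl, ?_⟩
      have h3 : (N : ℝ) ≤ ⌊z / 2⌋₊ := by exact_mod_cast (by omega : N ≤ ⌊z / 2⌋₊)
      rw [abs_le]
      constructor <;> linarith
  have h1 := h.qEl_estimate hc ha (m : ℤ) (by exact_mod_cast hm)
  rw [← hz, ← hl] at h1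
  have hterm (n : ℕ) : 2 * c / Real.cosh (2 * c * (x - 4 * c ^ 2 * t)
      + (2 * (n : ℝ) - 1 / 2) * Real.log t - phase c a n x t)
      = 2 * c / Real.cosh (l * (z - (2 * n - 1))) := by
    rw [h.soliton_argument, Real.cosh_neg]
  rw [Finset.sum_congr rfl fun n _ => hterm n,
    ← Finset.add_sum_erase _ _ (Finset.mem_Icc.2 ⟨hm1, hmN⟩)]
  set S := ∑ n ∈ (Finset.Icc 1 N).erase m, 2 * c / Real.cosh (l * (z - (2 * (n : ℝ) - 1)))
  have hS : ‖(S : ℂ)‖ ≤ 4 * c * N * p := by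
    rw [Complex.norm_real]
    have h2 : ∀ n ∈ (Finset.Icc 1 N).erase m,
        ‖2 * c / Real.cosh (l * (z - (2 * (n : ℝ) - 1)))‖ ≤ 4 * c * p := by
      intro n hn
      have hnm := Finset.ne_of_mem_erase hn
      have h3 : 1 ≤ |z - (2 * (n : ℝ) - 1)| := by
        have hm' := abs_le.1 hm
        rcases lt_or_gt_of_ne hnm with hlt | hgt
        · have h4 : (n : ℝ) + 1 ≤ m := by exact_mod_cast hlt
          exact le_trans (by linarith) (le_abs_self _)
        · have h4 : (m : ℝ) + 1 ≤ n := by exact_mod_cast hgt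
          exact le_trans (by linarith) (neg_le_abs _)
      have h5 : Real.exp (-|l * (z - (2 * (n : ℝ) - 1))|) ≤ p := by
        refine le_trans (Real.exp_le_exp.2 ?_) (exp_neg_le_of_close hp0 h.le h.ell_close)
        rw [abs_mul, abs_of_pos (by linarith : 0 < l)]
        nlinarith
      have h6 := one_div_cosh_le (l * (z - (2 * (n : ℝ) - 1)))
      have hcosh := Real.cosh_pos (l * (z - (2 * (n : ℝ) - 1)))
      rw [Real.norm_of_nonneg (by positivity), ← mul_one_div]
      calc 2 * c * (1 / Real.cosh (l * (z - (2 * (n : ℝ) - 1)))) ≤ 2 * c * (2 * p) := by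
            gcongr
            linarith
        _ = 4 * c * p := by ring
    refine (norm_sum_le_of_le _ h2).trans ?_
    rw [Finset.sum_const, nsmul_eq_mul]
    have h3 : (((Finset.Icc 1 N).erase m).card : ℝ) ≤ N := by
      have := (Finset.card_le_card (Finset.erase_subset m (Finset.Icc 1 N)))
      rw [Nat.card_Icc, Nat.add_sub_cancel] at this
      exact_mod_cast this
    calc (((Finset.Icc 1 N).erase m).card : ℝ) * (4 * c * p) ≤ N * (4 * c * p) := by gcongr
      _ = _ := by ring
  rw [Complex.ofReal_add, ← sub_sub]
  refine (norm_sub_le _ _).trans ?_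
  have h2 := add_le_add h1 hS
  push_cast at h2 ⊢
  linarith

lemma NearEdge.p_le_div (h : NearEdge c h₁ a C x t p) : p ≤ 4 * C / t := by
  have ht : 0 < t := by linarith [h.one_lt]
  rw [le_div_iff₀ ht, mul_comm]
  exact h.t_mul_p_le

end

/-! ### The asymptotic statements -/

/-- The sum of solitons approximates the modulated elliptic wave. -/
lemma IsSpectralFunction.qEl_solitons {c h₁ : ℝ} {a : ℂ → ℂ} (ha : IsSpectralFunction c h₁ a)
    (hc : 0 < c) (N : ℕ) (hN : 1 ≤ N) (ε : ℝ) (hε : 0 < ε) :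
    ∃ C T : ℝ, ∀ t : ℝ, T ≤ t → ∀ x : ℝ,
      4 * c ^ 2 * t - (2 * (N : ℝ) + 1 / 2 - ε) / (2 * c) * Real.log t ≤ x →
      x ≤ 4 * c ^ 2 * t - (1 / 2 + ε) / (2 * c) * Real.log t →
      ‖qEl c a x t - ((∑ n ∈ Finset.Icc 1 N, 2 * c / Real.cosh (2 * c * (x - 4 * c ^ 2 * t)
        + (2 * (n : ℝ) - 1 / 2) * Real.log t - phase c a n x t) : ℝ) : ℂ)‖ ≤ C / t := by
  have hN' : (1 : ℝ) ≤ N := by exact_mod_cast hN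
  obtain ⟨C, T, hC, H⟩ := ha.nearEdge hc (γ := (2 * N + 1) / (2 * c)) (by positivity)
  set B₁ := 16 * c ^ 3 * C + C + |Real.log (h₁ ^ 2 / 4)| + 1 with hB₁
  -- `8c³ t v = 2c(4c²t - x)` exceeds `(log t)/2` in the window, hence `tv ≥ δ log t` and
  -- `NearEdge.ell_le` applies.
  set δ := 1 / (16 * c ^ 3) with hδ
  set B₂ := Real.log 16 - Real.log (δ / 4) + 1
  have hG := tailConst_nonneg
  set R := 1 + 1 / δ + |(B₂ / 2 + B₁) / ε| + ((2 * N + 1 / 2) * (4 * C + 1) + B₁) / ε with hR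
  have hB₁0 : 0 < B₁ := by positivity
  have hδ0 : 0 < δ := by positivity
  refine ⟨(80 * c + 2 * c * tailConst + 4 * c * N) * (4 * C), max T (Real.exp R),
    fun t ht x hx1 hx2 => ?_⟩
  have hlogR : R ≤ Real.log t := by
    rw [Real.le_log_iff_exp_le ((Real.exp_pos R).trans_le ((le_max_right _ _).trans ht))]
    exact (le_max_right _ _).trans ht
  have hq1 : 0 < 1 / δ := by positivity
  have hq2 : 0 < ((2 * N + 1 / 2) * (4 * C + 1) + B₁) / ε := by positivity
  have hq3 := abs_nonneg ((B₂ / 2 + B₁) / ε)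
  have hq4 := le_abs_self ((B₂ / 2 + B₁) / ε)
  have hlog0 : 0 < Real.log t := by linarith
  have r1 : 1 ≤ δ * Real.log t := by
    have : 1 / δ ≤ Real.log t := by linarith
    rw [div_le_iff₀ hδ0] at this
    linarith
  have r2 : B₂ / 2 + B₁ ≤ ε * Real.log t := by
    have : (B₂ / 2 + B₁) / ε ≤ Real.log t := by linarith
    rw [div_le_iff₀ hε] at this
    linarith
  have r3 : (2 * N + 1 / 2) * (4 * C + 1) + B₁ ≤ ε * Real.log t := by
    have : ((2 * N + 1 / 2) * (4 * C + 1) + B₁) / ε ≤ Real.log t := by linarith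
    rw [div_le_iff₀ hε] at this
    linarith
  have hu1 : (1 / 2 + ε) * Real.log t ≤ 2 * c * (4 * c ^ 2 * t - x) := by
    have h1 : (1 / 2 + ε) / (2 * c) * Real.log t ≤ 4 * c ^ 2 * t - x := by linarith
    calc (1 / 2 + ε) * Real.log t = 2 * c * ((1 / 2 + ε) / (2 * c) * Real.log t) := by field_simp
      _ ≤ _ := by gcongr
  have hu2 : 2 * c * (4 * c ^ 2 * t - x) ≤ (2 * N + 1 / 2 - ε) * Real.log t := by
    have h1 : 4 * c ^ 2 * t - x ≤ (2 * N + 1 / 2 - ε) / (2 * c) * Real.log t := by linarith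
    calc 2 * c * (4 * c ^ 2 * t - x)
        ≤ 2 * c * ((2 * N + 1 / 2 - ε) / (2 * c) * Real.log t) := by gcongr
      _ = _ := by field_simp
  have hx1' : 4 * c ^ 2 * t - (2 * N + 1) / (2 * c) * Real.log t < x := by
    have : 2 * c * (4 * c ^ 2 * t - x) < 2 * c * ((2 * N + 1) / (2 * c) * Real.log t) := by
      have : 2 * c * ((2 * N + 1) / (2 * c) * Real.log t) = (2 * N + 1) * Real.log t := by
        field_simp
      rw [this]
      nlinarith
    have := lt_of_mul_lt_mul_left this (by positivity)
    linarith
  have hx2' : x < 4 * c ^ 2 * t := by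
    have : 0 < (1 / 2 + ε) / (2 * c) * Real.log t := by positivity
    linarith
  obtain ⟨p, h⟩ := H t ((le_max_left _ _).trans ht) x hx1' hx2'
  have hell1 := h.ell_ge
  have htv : δ * Real.log t ≤ t * vFun c x t := by
    have h1 := h.t_mul_v
    have h2 : δ * (8 * c ^ 3 * (t * vFun c x t)) = t * vFun c x t / 2 := by
      rw [hδ]
      field_simp
      ring
    have h3 : 1 / 2 * Real.log t ≤ 8 * c ^ 3 * (t * vFun c x t) := by
      have : 2 * c * (4 * c ^ 2 * t - x) = 8 * c ^ 3 * (t * vFun c x t) := by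
        rw [← h1]
        ring
      rw [← this]
      nlinarith
    have h4 := mul_le_mul_of_nonneg_left h3 hδ0.le
    linarith
  have hell2 := h.ell_le hδ0 htv r1
  have hz := abs_le.1 (h.ell_mul_z hc hC)
  have hl1 := one_le_of_close h.pos h.le h.ell_close
  set l := ell c (c * √(1 - p))
  have hl0 : 0 < l := by linarith
  -- `l z ≥ (1/2 + ε) log t - l/2 - B₁` and `l ≤ log t + B₂`: the margin `ε log t` outweighs the
  -- constants.
  have hz0 : 0 ≤ zReal c a x t := by
    refine nonneg_of_mul_nonneg_right (a := l) ?_ hl0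
    linarith
  -- `l z ≤ (2N + 1/2 - ε) log t - l/2 + B₁`, and `log t ≤ l + 4C + 1`; again `ε log t` absorbs the
  -- constants.
  have hz1 : zReal c a x t ≤ 2 * N := by
    refine le_of_mul_le_mul_left ?_ hl0
    have h1 : (2 * N + 1 / 2) * (Real.log t - 4 * C - 1) ≤ (2 * N + 1 / 2) * l := by gcongr
    linarith
  refine (h.qEl_sub_sum_le hc ha hN hz0 hz1).trans ?_
  rw [mul_div_assoc]
  have := h.p_le_div
  gcongr

/-- The modulated elliptic wave is small close to the leading edge. -/
lemma IsSpectralFunction.qEl_small {c h₁ : ℝ} {a : ℂ → ℂ} (ha : IsSpectralFunction c h₁ a)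
    (hc : 0 < c) (ε : ℝ) (hε : 0 < ε) :
    ∃ C T : ℝ, ∀ t : ℝ, T ≤ t → ∀ x : ℝ,
      4 * c ^ 2 * t - (1 - ε) / (2 * c) * Real.log t ≤ x → x < 4 * c ^ 2 * t →
      ‖qEl c a x t‖ ≤ C * t ^ (-(1 / 2) : ℝ) := by
  obtain ⟨C, T, hC, H⟩ := ha.nearEdge hc (γ := 1 / (2 * c)) (by positivity)
  set B₁ := 16 * c ^ 3 * C + C + |Real.log (h₁ ^ 2 / 4)| + 1 with hB₁
  have hB₁0 : 0 < B₁ := by positivity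
  set B := B₁ + (4 * C + 1) with hB
  have hG := tailConst_nonneg
  set K := 80 * c + 2 * c * tailConst with hK
  refine ⟨(4 * c * Real.exp B + K) * (2 * √C), max T (Real.exp (1 + 2 * B + (4 * C + 1))),
    fun t ht x hx1 hx2 => ?_⟩
  have hlogR : 1 + 2 * B + (4 * C + 1) ≤ Real.log t := by
    rw [Real.le_log_iff_exp_le ((Real.exp_pos _).trans_le ((le_max_right _ _).trans ht))]
    exact (le_max_right _ _).trans ht
  have hlog0 : 0 < Real.log t := by
    have : 0 < B := by positivity
    linarith
  have hu2 : 2 * c * (4 * c ^ 2 * t - x) ≤ (1 - ε) * Real.log t := by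
    have h1 : 4 * c ^ 2 * t - x ≤ (1 - ε) / (2 * c) * Real.log t := by linarith
    calc 2 * c * (4 * c ^ 2 * t - x)
        ≤ 2 * c * ((1 - ε) / (2 * c) * Real.log t) := by gcongr
      _ = _ := by field_simp
  have hu3 : 2 * c * (4 * c ^ 2 * t - x) < Real.log t := by nlinarith
  have hu1 : 0 < 2 * c * (4 * c ^ 2 * t - x) := mul_pos (by positivity) (by linarith)
  have hx1' : 4 * c ^ 2 * t - 1 / (2 * c) * Real.log t < x := by
    have h1 : 2 * c * (4 * c ^ 2 * t - x) < 2 * c * (1 / (2 * c) * Real.log t) := by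
      have : 2 * c * (1 / (2 * c) * Real.log t) = Real.log t := by field_simp
      rwa [this]
    have := lt_of_mul_lt_mul_left h1 (by positivity)
    linarith
  obtain ⟨p, h⟩ := H t ((le_max_left _ _).trans ht) x hx1' hx2
  have hp0 := h.pos
  have hell1 := h.ell_ge
  have hz := abs_le.1 (h.ell_mul_z hc hC)
  have hexp := exp_neg_le_of_close hp0 h.le h.ell_close
  have hest := h.qEl_estimate hc ha
  set l := ell c (c * √(1 - p))
  set z := zReal c a x t
  have hl0 : 0 < l := by linarith
  -- Here `l z` lies between `-l/2 - B` and `l/2 + B`. So `z` is about `1/2` or more away from the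
  -- nearer of the centres `1` (`m = 1`) and `-1` (`m = 0`), and the soliton is `O(exp (-l/2)) =
  -- O(√p)`.
  obtain ⟨m, hm1, hm2⟩ : ∃ m : ℤ, |z - (2 * m - 1)| ≤ 1 ∧ l / 2 - B ≤ |l * (z - (2 * m - 1))| := by
    have hz1 : z ≤ 1 := by
      refine le_of_mul_le_mul_left ?_ hl0
      linarith
    have hz2 : -1 ≤ z := by
      refine le_of_mul_le_mul_left ?_ hl0
      linarith
    rcases le_or_gt 0 z with h0 | h0
    · refine ⟨1, ?_, ?_⟩
      · rw [abs_le]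
        push_cast
        constructor <;> linarith
      · refine le_trans ?_ (neg_le_abs _)
        push_cast
        linarith
    · refine ⟨0, ?_, ?_⟩
      · rw [abs_le]
        push_cast
        constructor <;> linarith
      · refine le_trans ?_ (le_abs_self _)
        push_cast
        linarith
  have hest := hest m hm1
  have hsq : √p ^ 2 = p := Real.sq_sqrt hp0.le
  have hexp2 : Real.exp (-(l / 2)) ≤ √p := by
    refine abs_le_of_sq_le_sq' ?_ (Real.sqrt_nonneg p) |>.2
    rw [hsq, ← Real.exp_nat_mul]
    refine le_trans (le_of_eq ?_) hexp
    push_cast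
    ring_nf
  have hcosh := Real.cosh_pos (l * (z - (2 * m - 1)))
  have h1 : ‖((2 * c / Real.cosh (l * (z - (2 * m - 1))) : ℝ) : ℂ)‖
      ≤ 4 * c * Real.exp B * √p := by
    rw [Complex.norm_real, Real.norm_of_nonneg (by positivity), ← mul_one_div]
    have h2 := one_div_cosh_le (l * (z - (2 * m - 1)))
    have h3 : Real.exp (-|l * (z - (2 * m - 1))|) ≤ Real.exp B * Real.exp (-(l / 2)) := by
      rw [← Real.exp_add]
      exact Real.exp_le_exp.2 (by linarith)
    calc 2 * c * (1 / Real.cosh (l * (z - (2 * m - 1))))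
        ≤ 2 * c * (2 * (Real.exp B * √p)) := by
          gcongr
          refine h2.trans ?_
          gcongr
          exact h3.trans (by gcongr)
      _ = _ := by ring
  have hpsq : p ≤ √p := by
    have h4 : √p ≤ 1 := by
      rw [Real.sqrt_le_one]
      linarith [h.le]
    nlinarith [Real.sqrt_nonneg p]
  have hspt : √p ≤ 2 * √C * t ^ (-(1 / 2) : ℝ) := by
    have ht0 : 0 < t := by linarith [h.one_lt]
    rw [Real.rpow_neg ht0.le, ← Real.sqrt_eq_rpow, ← div_eq_mul_inv]
    refine (Real.sqrt_le_sqrt h.p_le_div).trans (le_of_eq ?_)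
    rw [Real.sqrt_div (by positivity), Real.sqrt_mul (by norm_num), show (4 : ℝ) = 2 ^ 2 by norm_num,
      Real.sqrt_sq (by norm_num)]
  calc ‖qEl c a x t‖
      = ‖(qEl c a x t - ((2 * c / Real.cosh (l * (z - (2 * m - 1))) : ℝ) : ℂ))
        + ((2 * c / Real.cosh (l * (z - (2 * m - 1))) : ℝ) : ℂ)‖ := by rw [sub_add_cancel]
    _ ≤ K * p + 4 * c * Real.exp B * √p := (norm_add_le _ _).trans (add_le_add hest h1)
    _ ≤ K * √p + 4 * c * Real.exp B * √p := by gcongr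
    _ = (4 * c * Real.exp B + K) * √p := by ring
    _ ≤ (4 * c * Real.exp B + K) * (2 * √C * t ^ (-(1 / 2) : ℝ)) := by gcongr
    _ = _ := by ring

/-- The expansion of the phases near the leading edge. -/
lemma IsSpectralFunction.phase_expansion {c h₁ : ℝ} {a : ℂ → ℂ} (ha : IsSpectralFunction c h₁ a)
    (hc : 0 < c) (n : ℕ) (hn : 1 ≤ n) (γ : ℝ) (hγ : 0 < γ) :
    ∃ C T : ℝ, ∀ t : ℝ, T ≤ t → ∀ x : ℝ, 4 * c ^ 2 * t - γ * Real.log t < x →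
      x < 4 * c ^ 2 * t → |phase c a n x t - phaseMain c h₁ n x t|
        ≤ C * |Real.log (Real.log (1 / vFun c x t)) ^ 2 / Real.log (vFun c x t)| := by
  obtain ⟨C, T, hC, H⟩ := ha.nearEdge hc hγ
  refine ⟨4160 * c ^ 3 * C + 8400 * n + C, T, fun t ht x hx1 hx2 => ?_⟩
  obtain ⟨p, h⟩ := H t ht x hx1 hx2
  refine (h.phase_estimate hc hC ha.ne_zero n hn).trans ?_
  have h1 := h.log_ge
  have h2 := h.loglog_ge
  rw [one_div, Real.log_inv, abs_div, abs_of_nonneg (sq_nonneg _),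
    abs_of_neg (by linarith : Real.log (vFun c x t) < 0)]
  -- It remains to see `log M ≤ log² M`, which holds as `log M ≥ 1`.
  gcongr
  nlinarith

/-- The phases are bounded in a logarithmic strip behind the leading edge. -/
lemma IsSpectralFunction.phase_bounded {c h₁ : ℝ} {a : ℂ → ℂ} (ha : IsSpectralFunction c h₁ a)
    (hc : 0 < c) (n : ℕ) (hn : 1 ≤ n) (δ γ : ℝ) (hδ : 0 < δ) (hδγ : δ < γ) :
    ∃ C T : ℝ, ∀ t : ℝ, T ≤ t → ∀ x : ℝ, 4 * c ^ 2 * t - γ * Real.log t < x →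
      x < 4 * c ^ 2 * t - δ * Real.log t → |phase c a n x t| ≤ C := by
  obtain ⟨C, T, hC, H⟩ := ha.nearEdge hc (hδ.trans hδγ)
  have hn' : (1 : ℝ) ≤ n := by exact_mod_cast hn
  set η := δ / (4 * c ^ 2) with hη
  have hη0 : 0 < η := by positivity
  refine ⟨(4160 * c ^ 3 * C + 8400 * n + C) + 2 * n * (|Real.log (1 / C)| + |Real.log (1 / η)|)
    + 8 * c ^ 3 * C + 6 * n + |Real.log (h₁ ^ 2)|, max T (Real.exp (1 / η)),
    fun t ht x hx1 hx2 => ?_⟩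
  have hlogR : 1 / η ≤ Real.log t := by
    rw [Real.le_log_iff_exp_le ((Real.exp_pos _).trans_le ((le_max_right _ _).trans ht))]
    exact (le_max_right _ _).trans ht
  have hq : 0 < 1 / η := by positivity
  have hlog0 : 0 < Real.log t := by linarith
  have hx2' : x < 4 * c ^ 2 * t := by
    have : 0 < δ * Real.log t := by positivity
    linarith
  obtain ⟨p, h⟩ := H t ((le_max_left _ _).trans ht) x hx1 hx2'
  have ht0 : 0 < t := by linarith [h.one_lt]
  have hv0 := h.v_pos
  have hest := h.phase_estimate hc hC ha.ne_zero n hn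
  have hM8 := h.log_ge
  have hlogM := h.loglog_ge
  have htvM := h.t_mul_v_le
  have htv : η * Real.log t ≤ t * vFun c x t := by
    have h1 := h.t_mul_v
    rw [hη, div_mul_eq_mul_div, div_le_iff₀ (by positivity)]
    linarith
  have hMt : -Real.log (vFun c x t) ≤ Real.log t := by
    rw [← Real.log_inv]
    refine Real.log_le_log (by positivity) ?_
    rw [inv_le_iff_one_le_mul₀ hv0]
    rw [div_le_iff₀ hη0] at hlogR
    linarith
  rw [phaseMain, one_div (vFun c x t), Real.log_inv] at hest
  set v := vFun c x t
  set M := -Real.log v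
  have hM0 : 0 < M := by linarith
  have k1 : Real.log M / M ≤ 1 := by
    rw [div_le_one hM0]
    exact (Real.log_le_sub_one_of_pos hM0).trans (by linarith)
  have k2 : 8 * c ^ 3 * t * v / M ≤ 8 * c ^ 3 * C := by
    rw [div_le_iff₀ hM0]
    calc 8 * c ^ 3 * t * v = 8 * c ^ 3 * (t * v) := by ring
      _ ≤ 8 * c ^ 3 * (C * M) := by gcongr
      _ = _ := by ring
  have k3 : 0 ≤ 8 * c ^ 3 * t * v / M := by positivity
  -- `M` and `tv` are comparable: `tv ≤ CM` in the whole strip, and `tv ≥ η log t ≥ ηM` away from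
  -- the edge.
  have k4 : |Real.log (M / (v * t))| ≤ |Real.log (1 / C)| + |Real.log (1 / η)| := by
    have h1 : Real.log (1 / C) ≤ Real.log (M / (v * t)) := by
      refine Real.log_le_log (by positivity) ?_
      rw [div_le_div_iff₀ hC (by positivity)]
      linarith
    have h2 : Real.log (M / (v * t)) ≤ Real.log (1 / η) := by
      refine Real.log_le_log (by positivity) ?_
      rw [div_le_div_iff₀ (by positivity) hη0]
      nlinarith
    have h3 := neg_abs_le (Real.log (1 / C))
    have h4 := le_abs_self (Real.log (1 / η))
    have h5 := abs_nonneg (Real.log (1 / C))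
    have h6 := abs_nonneg (Real.log (1 / η))
    rw [abs_le]
    constructor <;> linarith
  have k5 : |(2 * (n : ℝ) - 1 / 2) * Real.log (M / (v * t))|
      ≤ 2 * n * (|Real.log (1 / C)| + |Real.log (1 / η)|) := by
    rw [abs_mul, abs_of_pos (by linarith)]
    gcongr
    linarith
  have k6 : |(6 * (n : ℝ) - 7 / 2) * Real.log 2| ≤ 6 * n := by
    have hlog2 : 0 < Real.log 2 := Real.log_pos one_lt_two
    have hlog2' : Real.log 2 ≤ 1 := (Real.log_le_sub_one_of_pos two_pos).trans (by norm_num)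
    rw [abs_of_pos (mul_pos (by linarith) hlog2)]
    nlinarith
  have k7 : (4160 * c ^ 3 * C + 8400 * n + C) * (Real.log M / M)
      ≤ 4160 * c ^ 3 * C + 8400 * n + C := mul_le_of_le_one_right (by positivity) k1
  have k8 := neg_abs_le (Real.log (h₁ ^ 2))
  have k9 := le_abs_self (Real.log (h₁ ^ 2))
  rw [abs_le] at hest k5 k6 ⊢
  constructor <;> linarith

end ModulatedWave

end

theorem theorem1 (c : ℝ) (hc : 0 < c) (h₁ : ℝ) (a : ℂ → ℂ)
    (ha : ModulatedWave.IsSpectralFunction c h₁ a) :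
    ∃ α : ℕ → ℝ → ℝ → ℝ,
      -- the relation that defines the phases
      (∀ n : ℕ, 1 ≤ n → ∀ x t : ℝ, 0 < t → -(6 * c ^ 2 * t) < x → x < 4 * c ^ 2 * t →
        ModulatedWave.tauStar c (ModulatedWave.fFun c (x / (12 * t)))
            * (ModulatedWave.zFun c a x t - 2 * (n : ℂ) + 1) / 4
          = ((2 * c * (x - 4 * c ^ 2 * t) + (2 * (n : ℝ) - 1 / 2) * Real.log t - α n x t : ℝ) : ℂ))
      ∧
      -- part A
      (∀ N : ℕ, 1 ≤ N → ∀ ε : ℝ, 0 < ε → ∃ C T : ℝ, ∀ t : ℝ, T ≤ t → ∀ x : ℝ,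
        4 * c ^ 2 * t - (2 * (N : ℝ) + 1 / 2 - ε) / (2 * c) * Real.log t ≤ x →
        x ≤ 4 * c ^ 2 * t - (1 / 2 + ε) / (2 * c) * Real.log t →
        ‖ModulatedWave.qEl c a x t
            - ((∑ n ∈ Finset.Icc 1 N, 2 * c / Real.cosh (2 * c * (x - 4 * c ^ 2 * t)
                + (2 * (n : ℝ) - 1 / 2) * Real.log t - α n x t) : ℝ) : ℂ)‖ ≤ C / t)
      ∧
      -- part B
      (∀ ε : ℝ, 0 < ε → ∃ C T : ℝ, ∀ t : ℝ, T ≤ t → ∀ x : ℝ,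
        4 * c ^ 2 * t - (1 - ε) / (2 * c) * Real.log t ≤ x → x < 4 * c ^ 2 * t →
        ‖ModulatedWave.qEl c a x t‖ ≤ C * t ^ (-(1 / 2) : ℝ))
      ∧
      -- the expansion of the phases
      (∀ n : ℕ, 1 ≤ n → ∀ γ : ℝ, 0 < γ → ∃ C T : ℝ, ∀ t : ℝ, T ≤ t → ∀ x : ℝ,
        4 * c ^ 2 * t - γ * Real.log t < x → x < 4 * c ^ 2 * t →
        |α n x t
            - (-(2 * (n : ℝ) - 1 / 2) * Real.log (Real.log (1 / ModulatedWave.vFun c x t)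
                  / (ModulatedWave.vFun c x t * t))
                - 8 * c ^ 3 * t * ModulatedWave.vFun c x t
                    / Real.log (1 / ModulatedWave.vFun c x t)
                - (6 * (n : ℝ) - 7 / 2) * Real.log 2 - Real.log (h₁ ^ 2))|
          ≤ C * |Real.log (Real.log (1 / ModulatedWave.vFun c x t)) ^ 2
              / Real.log (ModulatedWave.vFun c x t)|)
      ∧
      -- boundedness of the phases
      (∀ n : ℕ, 1 ≤ n → ∀ δ γ : ℝ, 0 < δ → δ < γ → ∃ C T : ℝ, ∀ t : ℝ, T ≤ t → ∀ x : ℝ,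
        4 * c ^ 2 * t - γ * Real.log t < x → x < 4 * c ^ 2 * t - δ * Real.log t →
        |α n x t| ≤ C) := by
  refine ⟨ModulatedWave.phase c a, ?_, ?_, ?_, ?_, ?_⟩
  · intro n _ x t ht hx1 hx2
    exact ModulatedWave.phase_relation hc ha n ht hx1 hx2
  · exact fun N hN ε hε => ha.qEl_solitons hc N hN ε hε
  · exact fun ε hε => ha.qEl_small hc ε hε
  · exact fun n hn γ hγ => ha.phase_expansion hc n hn γ hγ
  · exact fun n hn δ γ hδ hδγ => ha.phase_bounded hc n hn δ γ hδ hδγ
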